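/- Let $d\in\{2,3\}$ and let $R,h,\rho,\beta>0$. Write points and velocities of $\mathbb R^d$ as $\mathbf x=(x,\mathbf x_\perp)$, $\mathbf v=(v_x,\mathbf v_\perp)$. A body of unit mass moves along the $x$-axis with velocity $V(t)$ and position $X(t)=\int_0^tV$; at time $t$ it occupies $C(t)=D(t)\cup S(t)$, where $D(t)=\{x=X(t),\,|\mathbf x_\perp|\le R\}$ is the base and $S(t)=\{0\le x-X(t)\le h,\ |\mathbf x_\perp|=R\}$ the lateral barrier. It is subject to a constant force $E$ and to a gas with phase-space density $f(\mathbf x,\mathbf v,t)$. A solution with initial velocity $V_0$ is a pair $(V,f)$ such that, for $t\ge 0$: * $(\partial_t+\mathbf v\cdot\nabla_{\mathbf x})f=0$ for $\mathbf x\notin C(t)$ (that is, $f$ is constant along free flights), and $f(\mathbf x,\mathbf v,0)=f_0(\mathbf v)=\rho(\beta/\pi)^{d/2}e^{-\beta|\mathbf v|^2}$; * with $f_\pm(\mathbf x,\mathbf v,t)=\lim_{\varepsilon\to0^+}f(\mathbf x\pm\varepsilon\mathbf v,\mathbf v,t\pm\varepsilon)$, one has $f_+(\mathbf x,\mathbf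 v',t)=f_-(\mathbf x,\mathbf v,t)$ on $D(t)$, with $\mathbf v'=(2V(t)-v_x,\mathbf v_\perp)$, and $f_+(\mathbf x,\tilde{\mathbf v},t)=f_-(\mathbf x,\mathbf v,t)$ on $S(t)$, with $\tilde{\mathbf v}=(v_x,\ \mathbf v_\perp-2(\mathbf v_\perp\cdot\hat{\mathbf x}_\perp)\hat{\mathbf x}_\perp)$, $\hat{\mathbf x}_\perp=\mathbf x_\perp/|\mathbf x_\perp|$; these conditions are imposed at transversal impacts away from the edge $D(t)\cap S(t)$ and for particles whose backward evolution down to time $0$ consists of free flights and finitely many such impacts; on the remaining, negligible, set of particles $f$ is normalized to $f_0$; * $V$ is locally absolutely continuous, $V(0)=V_0$, and $\dot V(t)=E-F(t)$ for almost every $t$, where $$F(t)=2\int_{|\mathbf x_\perp|\le R}d\mathbf x_\perp\Big[\int_{v_x<V(t)}-\int_{v_x>V(t)}\Big](v_x-V(t))^2f_-(X(t),\mathbf x_\perp,\mathbf v,t)\,d\mathbf v ,$$ the integrals being absolutely convergent for almost every $t$ and $F$ locally integrable. Let $$F_0(V)=2\rho\Big(\frac\beta\pi\Big)^{d/2}\,|\{\mathbf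 x_\perp\in\mathbb R^{d-1}:|\mathbf x_\perp|\le R\}|\int_{\mathbb R^{d-1}}e^{-\beta|\mathbf v_\perp|^2}d\mathbf v_\perp\Big[\int_{u<V}-\int_{u\ge V}\Big](u-V)^2e^{-\beta u^2}\,du$$ be the friction without recollisions, let $V_\infty>0$ be such that $F_0(V_\infty)=E$, and put $C_-=F_0'(V_\infty)$. **Theorem.** There are $\gamma_0>0$ and $A_->0$, depending only on $d,\beta,\rho,E,R,h,V_\infty$, such that for every $\gamma\in(0,\gamma_0)$ there is $\bar t>0$ (depending on $\gamma$) for which every solution $(V,f)$ with $V(0)=V_0=V_\infty-\gamma$ satisfies $$V_\infty-V(t)\ \ge\ \gamma e^{-C_-t}+\frac{A_-\gamma^4}{t^3}\,\chi\{t>\bar t\}\qquad\text{for all }t\ge0 .$$ -/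

import Mathlib

noncomputable section

namespace HollowCylinder

open MeasureTheory Set Filter Topology

/-- The directions orthogonal to the `x`-axis, in space dimension `d`. -/
abbrev Transverse (d : ℕ) : Type := EuclideanSpace ℝ (Fin (d - 1))

/-- Positions `(x, x_⊥)` and velocities `(v_x, v_⊥)` in space dimension `d`. -/
abbrev Vect (d : ℕ) : Type := ℝ × Transverse d

/-- The data of the model: radius `R` of the base, length `h` of the lateral barrier, density
`ρ` and inverse temperature `β` of the gas, external force `E`. The body has mass `1`. -/
structure Model (d : ℕ) where
  R : ℝ
  h : ℝ
  ρ : ℝ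
  β : ℝ
  E : ℝ

variable {d : ℕ}

/-- The Maxwell–Boltzmann density of the unperturbed gas. -/
def Model.f₀ (M : Model d) (v : Vect d) : ℝ :=
  M.ρ * (M.β / Real.pi) ^ ((d : ℝ) / 2) * Real.exp (-M.β * (v.1 ^ 2 + ‖v.2‖ ^ 2))

/-- The constant `A` in front of the friction in absence of recollisions: it contains the area of
the base and the integral over the transverse velocity. -/
def Model.A (M : Model d) : ℝ :=
  2 * M.ρ * (M.β / Real.pi) ^ ((d : ℝ) / 2) *
    volume.real (Metric.closedBall (0 : Transverse d) M.R) *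
      ∫ w : Transverse d, Real.exp (-M.β * ‖w‖ ^ 2)

/-- The friction `F₀(V)` in absence of recollisions. -/
def Model.F₀ (M : Model d) (V : ℝ) : ℝ :=
  M.A * ((∫ u in Iio V, (u - V) ^ 2 * Real.exp (-M.β * u ^ 2)) -
    ∫ u in Ici V, (u - V) ^ 2 * Real.exp (-M.β * u ^ 2))

/-- The position of the base at time `t`, for a body that moves with velocity `V` from `0`. -/
def position (V : ℝ → ℝ) (t : ℝ) : ℝ := ∫ τ in (0 : ℝ)..t, V τ

/-- The base of the body at time `t`. -/
def Model.base (M : Model d) (V : ℝ → ℝ) (t : ℝ) : Set (Vect d) :=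
  {x | x.1 = position V t ∧ ‖x.2‖ ≤ M.R}

/-- The lateral barrier at time `t`. -/
def Model.side (M : Model d) (V : ℝ → ℝ) (t : ℝ) : Set (Vect d) :=
  {x | 0 ≤ x.1 - position V t ∧ x.1 - position V t ≤ M.h ∧ ‖x.2‖ = M.R}

/-- The body at time `t`. -/
def Model.body (M : Model d) (V : ℝ → ℝ) (t : ℝ) : Set (Vect d) :=
  M.base V t ∪ M.side V t

/-- Elastic reflection on the base, when the body has velocity `W`. -/
def reflectBase (W : ℝ) (v : Vect d) : Vect d := (2 * W - v.1, v.2)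

/-- Elastic reflection on the barrier at a point with transverse position `y`: the transverse
velocity changes by `- 2 |v_⊥| cos θ ŷ`, where `θ` is the angle between `v_⊥` and `y`. -/
def reflectSide (y : Transverse d) (v : Vect d) : Vect d :=
  (v.1, v.2 - (2 * inner ℝ v.2 y / ‖y‖ ^ 2) • y)

/-- A particle with velocity `v` at the point `x` can hit the base (away from its edge) at
time `t`: it is not at rest relative to the base. -/
def Model.HitsBase (M : Model d) (V : ℝ → ℝ) (t : ℝ) (x v : Vect d) : Prop :=
  x ∈ M.base V t ∧ ‖x.2‖ < M.R ∧ v.1 ≠ V t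

/-- A particle with velocity `v` at the point `x` can hit the barrier (away from the edge of the
base) at time `t`: it does not move tangentially. -/
def Model.HitsSide (M : Model d) (V : ℝ → ℝ) (t : ℝ) (x v : Vect d) : Prop :=
  x ∈ M.side V t ∧ 0 < x.1 - position V t ∧ inner ℝ v.2 x.2 ≠ 0

/-- `M.History V t x v v₀`: a particle which arrives at time `t` at the point `x` with velocity `v`
(the velocity before the impact, if `x` is on the body) comes, through free flights and finitely
many elastic collisions during `(0, t)`, from a particle with velocity `v₀` at time `0`. -/
inductive Model.History (M : Model d) (V : ℝ → ℝ) : ℝ → Vect d → Vect d → Vect d → Prop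
  | free (t : ℝ) (x v : Vect d) (ht : 0 ≤ t)
      (hfree : ∀ τ ∈ Ioo 0 t, x - (t - τ) • v ∉ M.body V τ) : M.History V t x v v
  | base (t s : ℝ) (x v v₀ : Vect d) (hs : 0 < s) (hst : s < t)
      (hfree : ∀ τ ∈ Ioo s t, x - (t - τ) • v ∉ M.body V τ)
      (hhit : M.HitsBase V s (x - (t - s) • v) v)
      (hprev : M.History V s (x - (t - s) • v) (reflectBase (V s) v) v₀) : M.History V t x v v₀
  | side (t s : ℝ) (x v v₀ : Vect d) (hs : 0 < s) (hst : s < t)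
      (hfree : ∀ τ ∈ Ioo s t, x - (t - τ) • v ∉ M.body V τ)
      (hhit : M.HitsSide V s (x - (t - s) • v) v)
      (hprev : M.History V s (x - (t - s) • v) (reflectSide (x - (t - s) • v).2 v) v₀) :
      M.History V t x v v₀

/-- The backward evolution of the particle is defined up to time `0`. It fails to be so only on a
negligible set of particles: those that somewhere in the past hit the edge of the base, were
tangent to the body, or collided infinitely often. -/
def Model.Regular (M : Model d) (V : ℝ → ℝ) (t : ℝ) (x v : Vect d) : Prop :=
  ∃ v₀, M.History V t x v v₀

/-- The trace `f₋(x, v, t)`, the limit of `f(x - εv, v, t - ε)` as `ε → 0⁺`. -/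
def traceBefore (f : ℝ → Vect d → Vect d → ℝ) (t : ℝ) (x v : Vect d) : ℝ :=
  limUnder (𝓝[>] (0 : ℝ)) fun ε => f (t - ε) (x - ε • v) v

/-- The trace `f₊(x, v, t)`, the limit of `f(x + εv, v, t + ε)` as `ε → 0⁺`. -/
def traceAfter (f : ℝ → Vect d → Vect d → ℝ) (t : ℝ) (x v : Vect d) : ℝ :=
  limUnder (𝓝[>] (0 : ℝ)) fun ε => f (t + ε) (x + ε • v) v

/-- `f t x v` is the density of the gas in the presence of a body moving with velocity `V`.
As `f` jumps across the trajectories that touch the edges of the body, the free Vlasov equation is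
read along characteristics: `f` is constant along every free flight. Near a transversal impact `f` is
therefore constant along the incoming and the outgoing flight, and the two traces in the boundary
conditions are genuine limits. On the negligible set of particles without a backward evolution
the density, which is defined up to null sets only, is normalized to its equilibrium value. -/
structure Model.IsGasDensity (M : Model d) (V : ℝ → ℝ) (f : ℝ → Vect d → Vect d → ℝ) :
    Prop where
  initial : ∀ x v, f 0 x v = M.f₀ v
  vlasov : ∀ s t x v, 0 ≤ s → s ≤ t → (∀ τ ∈ Icc s t, x - (t - τ) • v ∉ M.body V τ) →
    f t x v = f s (x - (t - s) • v) v
  boundary_base : ∀ t x v, 0 < t → M.HitsBase V t x v → M.Regular V t x v →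
    traceAfter f t x (reflectBase (V t) v) = traceBefore f t x v
  boundary_side : ∀ t x v, 0 < t → M.HitsSide V t x v → M.Regular V t x v →
    traceAfter f t x (reflectSide x.2 v) = traceBefore f t x v
  normalized : ∀ t x v, 0 ≤ t → x ∉ M.body V t → ¬ M.Regular V t x v → f t x v = M.f₀ v

/-- Pairs `(x_⊥, v)` of particles that hit the base from the front, when its velocity is `W`. -/
def Model.front (M : Model d) (W : ℝ) : Set (Transverse d × Vect d) :=
  {p | ‖p.1‖ ≤ M.R ∧ p.2.1 < W}

/-- Pairs `(x_⊥, v)` of particles that hit the base from behind, when its velocity is `W`. -/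
def Model.back (M : Model d) (W : ℝ) : Set (Transverse d × Vect d) :=
  {p | ‖p.1‖ ≤ M.R ∧ W < p.2.1}

/-- The integrand `(v_x - V(t))² f₋(X(t), x_⊥, v, t)` of the force. -/
def pressure (V : ℝ → ℝ) (f : ℝ → Vect d → Vect d → ℝ) (t : ℝ) (p : Transverse d × Vect d) : ℝ :=
  (p.2.1 - V t) ^ 2 * traceBefore f t (position V t, p.1) p.2

/-- The action `F(t)` of the gas on the base. -/
def Model.force (M : Model d) (V : ℝ → ℝ) (f : ℝ → Vect d → Vect d → ℝ) (t : ℝ) : ℝ :=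
  2 * (∫ p in M.front (V t), pressure V f t p) - 2 * ∫ p in M.back (V t), pressure V f t p

/-- `(V, f)` solves the coupled problem of the gas and the body for `t ≥ 0`, with `V(0) = V₀`.
The equation of motion `dV/dt = E - F(t)` is understood for almost every `t`, with `V` locally
absolutely continuous, i.e. in integrated form. -/
structure Model.IsSolution (M : Model d) (V₀ : ℝ) (V : ℝ → ℝ)
    (f : ℝ → Vect d → Vect d → ℝ) : Prop where
  gas : M.IsGasDensity V f
  integrable : ∀ᵐ t ∂(volume.restrict (Ioi (0 : ℝ))),
    IntegrableOn (pressure V f t) (M.front (V t)) ∧ IntegrableOn (pressure V f t) (M.back (V t))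
  force_integrable : ∀ t, 0 ≤ t → IntervalIntegrable (M.force V f) volume 0 t
  motion : ∀ t, 0 ≤ t → V t = V₀ + ∫ τ in (0 : ℝ)..t, (M.E - M.force V f τ)

end HollowCylinder

end

noncomputable section

namespace HollowCylinder

open MeasureTheory Set Filter Topology

variable {d : ℕ}

/-! Write `W = Vinf - V`. The hollow fixes the sign of the excess `F - F₀(V)`. A particle that hits
the base twice does not rise above the rim of the barrier in between (`NoEscape`), so a particle
hitting the front had all its earlier base collisions in front. Such a collision at time `s`
replaces, backward in time, the longitudinal velocity `u > V s` by `2 V s - u`, and `u² - (2 V s -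
u)² = 4 V s (u - V s) > 0`. The Maxwellian carried by the particle is therefore at least the
equilibrium one. Behind the base all signs are reversed, and both effects increase the friction
(`History.sq_compare`, `GoodTime.excess_sign`). Since `F₀'` increases with `|V|`, `F ≥ F₀` and `F₀'
≤ F₀'(Vinf)` below `Vinf` give `W ≥ γ exp (-C t)` (`IsSolution.exp_le`).

The sign needs a prior bound on the trajectory. Only particles whose velocity is a mean velocity of
the body over some `[s, t]` contribute to the excess. If these means are within `δ` of `V t`, the
excess is `O(δ³)` (`GoodTime.abs_force_sub_le`). For `|W|` of order `γ / t²` one has `δ` of order `γ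
/ t`, and `δ³` is small against `|W|`; a bootstrap closes this (`IsSolution.decay_step`,
`abs_le_decay`). As the profile is integrable, the body stays within `γ L` of uniform motion, which
yields `NoEscape`.

The term `γ⁴ / t³` comes from particles reflected in an initial layer `[0, s₀]`, where `W ≥ 4γ/5`.
Those that hit again at time `t` have `Vinf - u` between the means of `W` over `[s₀, t]` and over
`[0, t]`, a window of length of order `γ / t`. On it `(V t - u)²` is at least of order `γ² / t²`,
and the gain in the Maxwellian is of order `γ` (`LayerBounds.exists_hit`, `GoodTime.force_sub_ge`).
A barrier function turns this source into the bound on `W` (`IsSolution.tail_le`).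

The value of `f₋` is read off the backward billiard for almost every particle
(`IsGasDensity.ae_trace`). The exceptions, particles that start on the body at time `0`, are
negligible by `volume_returnSet` and `volume_grazing`. -/

/-! ### The friction without recollisions and its slope -/

/-- The odd extension `z ↦ z |z|` of the square. -/
def signedSq (z : ℝ) : ℝ := z * |z|

theorem hasDerivAt_signedSq (z : ℝ) : HasDerivAt signedSq (2 * |z|) z := by
  rcases lt_trichotomy z 0 with hz | rfl | hz
  · have h : HasDerivAt (fun y : ℝ => -(y ^ 2)) (-(2 * z)) z := by
      simpa using (hasDerivAt_pow 2 z).fun_neg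
    rw [abs_of_neg hz, mul_neg]
    refine h.congr_of_eventuallyEq ?_
    filter_upwards [Iio_mem_nhds hz] with y hy
    rw [signedSq, abs_of_neg hy]; ring
  · rw [abs_zero, mul_zero, hasDerivAt_iff_isLittleO]
    simp only [signedSq, abs_zero, mul_zero, sub_zero, smul_zero]
    have : (fun x : ℝ => |x|) =o[𝓝 0] (fun _ => (1 : ℝ)) := by
      rw [Asymptotics.isLittleO_one_iff]
      simpa using (continuous_abs (G := ℝ)).tendsto 0
    simpa using (Asymptotics.isBigO_refl (fun x : ℝ => x) (𝓝 0)).mul_isLittleO this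
  · have h : HasDerivAt (fun y : ℝ => y ^ 2) (2 * z) z := by
      simpa using hasDerivAt_pow 2 z
    rw [abs_of_pos hz]
    refine h.congr_of_eventuallyEq ?_
    filter_upwards [Ioi_mem_nhds hz] with y hy
    rw [signedSq, abs_of_pos hy]; ring

theorem continuous_signedSq : Continuous signedSq := by
  unfold signedSq; fun_prop

theorem integrable_poly_gaussian {β : ℝ} (hβ : 0 < β) (n : ℕ) :
    Integrable fun u : ℝ => |u| ^ n * Real.exp (-β * u ^ 2) := by
  have h := integrable_rpow_mul_exp_neg_mul_sq hβ (s := n) (by linarith [n.cast_nonneg (α := ℝ)])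
  simp only [Real.rpow_natCast] at h
  refine h.abs.congr (ae_of_all _ fun u => ?_)
  simp [abs_mul, abs_pow, abs_of_pos (Real.exp_pos _)]

theorem integrable_gaussian_of_le {β : ℝ} (hβ : 0 < β) {g : ℝ → ℝ} (hg : Continuous g) (C : ℝ)
    (hC : ∀ u, |g u| ≤ C * (1 + |u| ^ 2)) :
    Integrable fun u : ℝ => g u * Real.exp (-β * u ^ 2) := by
  have h := ((integrable_poly_gaussian hβ 0).add (integrable_poly_gaussian hβ 2)).const_mul C
  refine h.mono' (by fun_prop) (ae_of_all _ fun u => ?_)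
  rw [norm_mul, Real.norm_eq_abs, Real.norm_eq_abs, abs_of_pos (Real.exp_pos _)]
  calc |g u| * Real.exp (-β * u ^ 2) ≤ C * (1 + |u| ^ 2) * Real.exp (-β * u ^ 2) := by
        gcongr; exact hC u
    _ = _ := by simp; ring

theorem integrable_sq_gaussian {β : ℝ} (hβ : 0 < β) (V : ℝ) :
    Integrable fun u : ℝ => (u - V) ^ 2 * Real.exp (-β * u ^ 2) := by
  refine integrable_gaussian_of_le hβ (by fun_prop) (2 * (1 + V ^ 2)) fun u => ?_
  rw [abs_of_nonneg (sq_nonneg _), sq_abs]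
  nlinarith [sq_nonneg (u + V), sq_nonneg (u * V)]

theorem integrable_abs_gaussian {β : ℝ} (hβ : 0 < β) (V : ℝ) :
    Integrable fun u : ℝ => 2 * |V - u| * Real.exp (-β * u ^ 2) := by
  refine integrable_gaussian_of_le hβ (by fun_prop) (2 * (1 + |V|)) fun u => ?_
  rw [abs_of_nonneg (by positivity)]
  have h1 := abs_sub V u
  nlinarith [sq_nonneg (|u| - 1), abs_nonneg u, abs_nonneg V, mul_nonneg (abs_nonneg V) (sq_nonneg |u|), sq_nonneg (|u|)]

theorem integrable_signedSq_gaussian {β : ℝ} (hβ : 0 < β) (V : ℝ) :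
    Integrable fun u : ℝ => signedSq (V - u) * Real.exp (-β * u ^ 2) := by
  refine (integrable_sq_gaussian hβ V).mono' ?_ (ae_of_all _ fun u => ?_)
  · have := continuous_signedSq
    exact Continuous.aestronglyMeasurable (by fun_prop)
  · rw [norm_mul, Real.norm_eq_abs, Real.norm_eq_abs, abs_of_pos (Real.exp_pos _), signedSq,
      abs_mul, abs_abs, abs_mul_abs_self]
    apply le_of_eq; ring

/-- The friction without recollisions as a convolution. -/
theorem Model.F₀_eq (M : Model d) (hβ : 0 < M.β) (V : ℝ) :
    M.F₀ V = M.A * ∫ u, signedSq (V - u) * Real.exp (-M.β * u ^ 2) := by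
  have h1 : ∫ u in Iio V, (u - V) ^ 2 * Real.exp (-M.β * u ^ 2) =
      ∫ u in Iio V, signedSq (V - u) * Real.exp (-M.β * u ^ 2) := by
    refine setIntegral_congr_fun measurableSet_Iio fun u (hu : u < V) => ?_
    simp only [signedSq, abs_of_pos (sub_pos.2 hu)]; ring
  have h2 : ∫ u in Ici V, (u - V) ^ 2 * Real.exp (-M.β * u ^ 2) =
      -∫ u in Ici V, signedSq (V - u) * Real.exp (-M.β * u ^ 2) := by
    rw [← integral_neg]
    refine setIntegral_congr_fun measurableSet_Ici fun u (hu : V ≤ u) => ?_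
    simp only [signedSq, abs_of_nonpos (sub_nonpos.2 hu)]; ring
  rw [Model.F₀, h1, h2, sub_neg_eq_add, ← compl_Iio,
    integral_add_compl measurableSet_Iio (integrable_signedSq_gaussian hβ V)]

/-- The derivative of the friction without recollisions. -/
def Model.dF₀ (M : Model d) (V : ℝ) : ℝ :=
  M.A * ∫ u, 2 * |V - u| * Real.exp (-M.β * u ^ 2)

/-- In convolution form there are no moving end points, so one differentiates under the integral; on
a neighbourhood of radius one the derivative of the integrand is dominated by a first-order
polynomial in `|V - u|` times the Gaussian. -/
theorem Model.hasDerivAt_F₀ (M : Model d) (hβ : 0 < M.β) (V : ℝ) :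
    HasDerivAt M.F₀ (M.dF₀ V) V := by
  have key := hasDerivAt_integral_of_dominated_loc_of_deriv_le (μ := volume)
    (F := fun V u => signedSq (V - u) * Real.exp (-M.β * u ^ 2))
    (F' := fun V u => 2 * |V - u| * Real.exp (-M.β * u ^ 2)) (x₀ := V)
    (s := Ioo (V - 1) (V + 1)) (bound := fun u => (2 * (|V - u| + 1)) * Real.exp (-M.β * u ^ 2))
    (Ioo_mem_nhds (by linarith) (by linarith))
    (Eventually.of_forall fun x => (integrable_signedSq_gaussian hβ x).aestronglyMeasurable)
    (integrable_signedSq_gaussian hβ V) (integrable_abs_gaussian hβ V).aestronglyMeasurable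
    (ae_of_all _ fun u x hx => ?_) ?_ (ae_of_all _ fun u x _ => ?_)
  · have := (key.2.const_mul M.A)
    refine this.congr_of_eventuallyEq (Eventually.of_forall fun x => M.F₀_eq hβ x)
  · rw [norm_mul, Real.norm_eq_abs, Real.norm_eq_abs, abs_of_pos (Real.exp_pos _),
      abs_of_nonneg (by positivity)]
    gcongr
    have : |x - u| ≤ |x - V| + |V - u| := abs_sub_le x V u
    have : |x - V| ≤ 1 := abs_le.2 ⟨by linarith [hx.1], by linarith [hx.2]⟩
    linarith
  · have h0 := (integrable_poly_gaussian hβ 0).const_mul 2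
    refine ((integrable_abs_gaussian hβ V).add h0).congr (ae_of_all _ fun u => ?_)
    simp; ring
  · refine HasDerivAt.mul_const ?_ _
    exact (hasDerivAt_signedSq (x - u)).comp_sub_const x u

/-- Averaging over `u` and `-u` and using `|V - u| + |V + u| = 2 max |V| |u|` makes the monotonicity
in `|V|` visible pointwise. -/
theorem integral_gaussian_symm {β : ℝ} (hβ : 0 < β) (V : ℝ) :
    ∫ u : ℝ, 2 * |V - u| * Real.exp (-β * u ^ 2) =
      ∫ u : ℝ, 2 * max |V| |u| * Real.exp (-β * u ^ 2) := by
  have h1 : ∫ u : ℝ, 2 * |V + u| * Real.exp (-β * u ^ 2) =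
      ∫ u : ℝ, 2 * |V - u| * Real.exp (-β * u ^ 2) := by
    rw [← integral_neg_eq_self (fun u : ℝ => 2 * |V - u| * Real.exp (-β * u ^ 2))]
    simp
  have hi : Integrable fun u : ℝ => 2 * |V + u| * Real.exp (-β * u ^ 2) := by
    simpa using (integrable_abs_gaussian hβ V).comp_neg
  have h2 : ∫ u : ℝ, 2 * |V - u| * Real.exp (-β * u ^ 2) =
      2⁻¹ * ((∫ u : ℝ, 2 * |V - u| * Real.exp (-β * u ^ 2)) +
        ∫ u : ℝ, 2 * |V + u| * Real.exp (-β * u ^ 2)) := by rw [h1]; ring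
  rw [h2, ← integral_add (integrable_abs_gaussian hβ V) hi, ← integral_const_mul]
  congr 1 with u
  have : |V - u| + |V + u| = 2 * max |V| |u| := by
    rcases abs_cases V with ⟨h, _⟩ | ⟨h, _⟩ <;> rcases abs_cases u with ⟨h', _⟩ | ⟨h', _⟩ <;>
    rcases abs_cases (V - u) with ⟨h'', _⟩ | ⟨h'', _⟩ <;>
    rcases abs_cases (V + u) with ⟨h3, _⟩ | ⟨h3, _⟩ <;>
    rw [h, h', h'', h3, max_def] <;> split_ifs <;> linarith
  linear_combination (Real.exp (-β * u ^ 2)) * this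

theorem integrable_max_gaussian {β : ℝ} (hβ : 0 < β) (V : ℝ) :
    Integrable fun u : ℝ => 2 * max |V| |u| * Real.exp (-β * u ^ 2) := by
  refine integrable_gaussian_of_le hβ (by fun_prop) (2 * (1 + |V|)) fun u => ?_
  rw [abs_of_nonneg (by positivity)]
  have h1 : max |V| |u| ≤ |V| + |u| := max_le (by linarith [abs_nonneg u]) (by linarith [abs_nonneg V])
  nlinarith [sq_nonneg (|u| - 1), abs_nonneg u, abs_nonneg V, mul_nonneg (abs_nonneg V) (sq_nonneg |u|), sq_nonneg (|u|)]

theorem integrable_gaussian_transverse {β : ℝ} (hβ : 0 < β) :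
    Integrable fun w : Transverse d => Real.exp (-β * ‖w‖ ^ 2) := by
  refine Integrable.of_integral_ne_zero ?_
  rw [GaussianFourier.integral_rexp_neg_mul_sq_norm hβ]
  positivity

theorem gaussian_transverse_pos {β : ℝ} (hβ : 0 < β) :
    0 < ∫ w : Transverse d, Real.exp (-β * ‖w‖ ^ 2) := by
  rw [GaussianFourier.integral_rexp_neg_mul_sq_norm hβ]
  positivity

theorem volume_closedBall_pos {R : ℝ} (hR : 0 < R) :
    0 < volume.real (Metric.closedBall (0 : Transverse d) R) :=
  ENNReal.toReal_pos (Metric.measure_closedBall_pos _ _ hR).ne' measure_closedBall_lt_top.ne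

theorem Model.A_pos (M : Model d) (hR : 0 < M.R) (hρ : 0 < M.ρ) (hβ : 0 < M.β) : 0 < M.A := by
  have h1 := volume_closedBall_pos (d := d) hR
  have h2 := gaussian_transverse_pos (d := d) hβ
  unfold Model.A
  positivity

/-- Source of both slope bounds on `F₀`: at least `dF₀ 0` everywhere, which gives a restoring force,
and at most `dF₀ Vinf` on `(0, Vinf)`, which gives the exact exponential rate. -/
theorem Model.dF₀_mono (M : Model d) (hA : 0 < M.A) (hβ : 0 < M.β) {V V' : ℝ}
    (h : |V| ≤ |V'|) : M.dF₀ V ≤ M.dF₀ V' := by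
  rw [Model.dF₀, Model.dF₀, integral_gaussian_symm hβ, integral_gaussian_symm hβ]
  refine mul_le_mul_of_nonneg_left ?_ hA.le
  refine integral_mono (integrable_max_gaussian hβ V) (integrable_max_gaussian hβ V') fun u => ?_
  dsimp only
  gcongr

theorem Model.dF₀_zero_pos (M : Model d) (hA : 0 < M.A) (hβ : 0 < M.β) : 0 < M.dF₀ 0 := by
  refine mul_pos hA ?_
  refine (integral_pos_iff_support_of_nonneg (fun u => by positivity)
    (integrable_abs_gaussian hβ 0)).2 ?_
  have : Function.support (fun u : ℝ => 2 * |0 - u| * Real.exp (-M.β * u ^ 2)) = {0}ᶜ := by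
    ext u; simp
  rw [this, measure_compl (measurableSet_singleton _) (by simp)]
  simp

theorem Model.F₀_sub_le (M : Model d) (hβ : 0 < M.β) {V V' C : ℝ}
    (h : V ≤ V') (hC : ∀ W ∈ Ioo V V', M.dF₀ W ≤ C) : M.F₀ V' - M.F₀ V ≤ C * (V' - V) := by
  rcases h.eq_or_lt with rfl | h
  · simp
  obtain ⟨c, hc, hc'⟩ := exists_hasDerivAt_eq_slope M.F₀ M.dF₀ h
    (fun x _ => (M.hasDerivAt_F₀ hβ x).continuousAt.continuousWithinAt)
    (fun x _ => M.hasDerivAt_F₀ hβ x)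
  rw [eq_div_iff (sub_pos.2 h).ne'] at hc'
  rw [← hc']
  exact mul_le_mul_of_nonneg_right (hC c hc) (sub_pos.2 h).le

theorem Model.le_F₀_sub (M : Model d) (hA : 0 < M.A) (hβ : 0 < M.β) {V V' : ℝ}
    (h : V ≤ V') : M.dF₀ 0 * (V' - V) ≤ M.F₀ V' - M.F₀ V := by
  rcases h.eq_or_lt with rfl | h
  · simp
  obtain ⟨c, hc, hc'⟩ := exists_hasDerivAt_eq_slope M.F₀ M.dF₀ h
    (fun x _ => (M.hasDerivAt_F₀ hβ x).continuousAt.continuousWithinAt)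
    (fun x _ => M.hasDerivAt_F₀ hβ x)
  rw [eq_div_iff (sub_pos.2 h).ne'] at hc'
  rw [← hc']
  exact mul_le_mul_of_nonneg_right (M.dF₀_mono hA hβ (by simp)) (sub_pos.2 h).le

/-! ### The position of the base -/

theorem intervalIntegrable_of_continuousOn_Ici {V : ℝ → ℝ} (hV : ContinuousOn V (Ici 0)) {a b : ℝ}
    (ha : 0 ≤ a) (hb : 0 ≤ b) : IntervalIntegrable V volume a b :=
  (hV.mono fun _ hx => (le_min ha hb).trans hx.1).intervalIntegrable

theorem position_sub {V : ℝ → ℝ} (hV : ContinuousOn V (Ici 0)) {a b : ℝ}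
    (ha : 0 ≤ a) (hb : 0 ≤ b) : position V b - position V a = ∫ τ in a..b, V τ :=
  intervalIntegral.integral_interval_sub_left (intervalIntegrable_of_continuousOn_Ici hV le_rfl hb)
    (intervalIntegrable_of_continuousOn_Ici hV le_rfl ha)

theorem position_zero (V : ℝ → ℝ) : position V 0 = 0 := intervalIntegral.integral_same

theorem hasDerivAt_position {V : ℝ → ℝ} (hV : ContinuousOn V (Ici 0)) {t : ℝ} (ht : 0 < t) :
    HasDerivAt (position V) (V t) t := by
  refine intervalIntegral.integral_hasDerivAt_right
    (intervalIntegrable_of_continuousOn_Ici hV le_rfl ht.le) ?_ (hV.continuousAt (Ici_mem_nhds ht))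
  exact ContinuousOn.stronglyMeasurableAtFilter isOpen_Ioi (hV.mono Ioi_subset_Ici_self) t ht

/-- Nothing is known about `V` at negative times; clamping the time at `0` gives globally
continuous, hence measurable, functions for the null-set arguments. -/
theorem continuous_position_max {V : ℝ → ℝ} (hV : ContinuousOn V (Ici 0)) :
    Continuous fun t => position V (max t 0) := by
  have hc : Continuous fun t => V (max t 0) :=
    hV.comp_continuous (by fun_prop) fun t => le_max_right t 0
  have h1 : (fun t => position V (max t 0)) = fun t => ∫ τ in (0 : ℝ)..(max t 0), V (max τ 0) := by
    ext t
    refine intervalIntegral.integral_congr fun τ hτ => ?_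
    rw [uIcc_of_le (le_max_right t 0)] at hτ
    simp [max_eq_left hτ.1]
  rw [h1]
  exact (intervalIntegral.continuous_primitive (fun a b => hc.intervalIntegrable a b) 0).comp
    (by fun_prop)

theorem continuousOn_position {V : ℝ → ℝ} (hV : ContinuousOn V (Ici 0)) :
    ContinuousOn (position V) (Ici 0) :=
  (continuous_position_max hV).continuousOn.congr fun t (ht : 0 ≤ t) => by
    simp [max_eq_left ht]

/-! ### Returns to the base at the initial time -/

/-- The hypothesis makes `g` injective on `S` with a Lipschitz inverse, and Lipschitz maps preserve
nullity for the two-dimensional Hausdorff measure, which is Lebesgue measure on the plane. No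
measurability of `S` or `g` is needed. -/
theorem volume_eq_zero_of_image {S N : Set (ℝ × ℝ)} (g : ℝ × ℝ → ℝ × ℝ) (C : ℝ)
    (hg : ∀ p ∈ S, ∀ q ∈ S, dist p q ≤ C * dist (g p) (g q)) (hgN : MapsTo g S N)
    (hN : volume N = 0) : volume S = 0 := by
  have hinj : InjOn g S := fun p hp q hq h => by
    have := hg p hp q hq
    rw [h, dist_self, mul_zero] at this
    exact dist_le_zero.1 this
  have hleft : ∀ p ∈ S, Function.invFunOn g S (g p) = p := fun p hp =>
    hinj (Function.invFunOn_mem ⟨p, hp, rfl⟩) hp (Function.invFunOn_eq ⟨p, hp, rfl⟩)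
  have hlip : LipschitzOnWith (Real.toNNReal C) (Function.invFunOn g S) (g '' S) := by
    refine LipschitzOnWith.of_dist_le_mul ?_
    rintro _ ⟨p, hp, rfl⟩ _ ⟨q, hq, rfl⟩
    rw [hleft p hp, hleft q hq]
    exact (hg p hp q hq).trans (by gcongr; exact Real.le_coe_toNNReal C)
  have himg : Function.invFunOn g S '' (g '' S) = S := by
    rw [image_image]
    exact (image_congr hleft).trans (image_id' S)
  have h := hlip.hausdorffMeasure_image_le (d := 2) (by norm_num)
  rw [himg, hausdorffMeasure_prod_real, measure_mono_null hgN.image_subset hN, mul_zero] at h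
  exact le_antisymm h zero_le

theorem volume_graph_eq_zero {α : Type*} [MeasurableSpace α] {μ : Measure α} [SFinite μ]
    {g : α → ℝ} (hg : Measurable g) : (μ.prod (volume : Measure ℝ)) {p | p.2 = g p.1} = 0 := by
  have hm : MeasurableSet {p : α × ℝ | p.2 = g p.1} :=
    measurableSet_eq_fun measurable_snd (hg.comp measurable_fst)
  rw [Measure.measure_prod_null hm]
  refine ae_of_all _ fun x => ?_
  have : Prod.mk x ⁻¹' {p : α × ℝ | p.2 = g p.1} = {g x} := by ext; simp
  simp [this]

/-- The pairs `(t, v)` such that a particle that hits the base at time `t` with longitudinal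
velocity `v` has, after `k` previous collisions with the base, been on it at time `0`. -/
def returnSet (V : ℝ → ℝ) : ℕ → Set (ℝ × ℝ)
  | 0 => {p | 0 < p.1 ∧ p.2 ≠ V p.1 ∧ position V p.1 = p.1 * p.2}
  | k + 1 => {p | p.2 ≠ V p.1 ∧ ∃ s, 0 < s ∧ s < p.1 ∧
      position V p.1 - position V s = p.2 * (p.1 - s) ∧ (s, 2 * V s - p.2) ∈ returnSet V k}

/-- The map from `(t, v)` to the earlier collision `(s, v)` expands distances up to a constant as
long as `v` stays away from `V t`: the impact at `t` is transversal, so `t` depends in a Lipschitz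
way on `(s, v)`. This holds on countably many pieces, with any choice of `s`. -/
theorem volume_flight_eq_zero {V : ℝ → ℝ} (hV : ContinuousOn V (Ici 0)) {Q : Set (ℝ × ℝ)}
    (hQ : volume Q = 0) :
    volume {p : ℝ × ℝ | p.2 ≠ V p.1 ∧ ∃ s, 0 < s ∧ s < p.1 ∧
      position V p.1 - position V s = p.2 * (p.1 - s) ∧ (s, p.2) ∈ Q} = 0 := by
  set P := {p : ℝ × ℝ | p.2 ≠ V p.1 ∧ ∃ s, 0 < s ∧ s < p.1 ∧
      position V p.1 - position V s = p.2 * (p.1 - s) ∧ (s, p.2) ∈ Q} with hP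
  have hunif : ∀ n : ℕ, ∃ η > 0, ∀ a ∈ Icc (0 : ℝ) n, ∀ b ∈ Icc (0 : ℝ) n, |a - b| ≤ η →
      |V a - V b| ≤ 1 / (2 * (n + 1)) := by
    intro n
    have huc := isCompact_Icc.uniformContinuousOn_of_continuous
      (hV.mono (fun x hx => hx.1 : Icc (0 : ℝ) n ⊆ Ici 0))
    obtain ⟨η, hη, h⟩ := Metric.uniformContinuousOn_iff.1 huc (1 / (2 * (n + 1))) (by positivity)
    refine ⟨η / 2, by positivity, fun a ha b hb hab => (h a ha b hb ?_).le⟩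
    rw [Real.dist_eq]; linarith
  choose η hη hVη using hunif
  -- On a piece, `t` and `v` are bounded, the impact has relative speed at least `1 / (n + 1)`, and
  -- `t` varies so little that `V` oscillates by at most half of this.
  have hcover : P ⊆ ⋃ n : ℕ, ⋃ j : ℕ, {p ∈ P | p.1 ≤ n ∧ |p.2| ≤ n ∧ 1 / (n + 1) ≤ |V p.1 - p.2| ∧
      j * η n ≤ p.1 ∧ p.1 ≤ (j + 1) * η n} := by
    rintro ⟨t, v⟩ hp
    have hp' := hp
    obtain ⟨hne, s, hs, hst, -, -⟩ := hp'
    simp only at hne hst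
    obtain ⟨n₁, h₁⟩ := exists_nat_one_div_lt (abs_pos.2 (sub_ne_zero.2 hne.symm))
    obtain ⟨n₂, h₂⟩ := exists_nat_ge (max t |v|)
    set n := max n₁ n₂
    have hn₂ : (n₂ : ℝ) ≤ n := by exact_mod_cast le_max_right n₁ n₂
    have hn₁ : (n₁ : ℝ) ≤ n := by exact_mod_cast le_max_left n₁ n₂
    have ht0 : 0 ≤ t / η n := div_nonneg (hs.trans hst).le (hη n).le
    simp only [mem_iUnion]
    refine ⟨n, ⌊t / η n⌋₊, hp, ((le_max_left _ _).trans h₂).trans hn₂,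
      ((le_max_right _ _).trans h₂).trans hn₂, ?_, ?_, ?_⟩
    · exact (one_div_le_one_div_of_le (by positivity) (by linarith)).trans h₁.le
    · exact (le_div_iff₀ (hη n)).1 (Nat.floor_le ht0)
    · exact (div_le_iff₀ (hη n)).1 (Nat.lt_floor_add_one _).le
  refine measure_mono_null hcover (measure_iUnion_null fun n => measure_iUnion_null fun j => ?_)
  have hex : ∀ p : ℝ × ℝ, ∃ s, p ∈ P → 0 < s ∧ s < p.1 ∧
      position V p.1 - position V s = p.2 * (p.1 - s) ∧ (s, p.2) ∈ Q := fun p => by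
    by_cases h : p ∈ P
    · exact h.2.imp fun s hs _ => hs
    · exact ⟨0, fun h' => absurd h' h⟩
  choose σ hσ using hex
  obtain ⟨B, hB⟩ := isCompact_Icc.exists_bound_of_continuousOn
    (hV.mono (fun x hx => hx.1 : Icc (0 : ℝ) n ⊆ Ici 0))
  have hB0 : 0 ≤ B := (norm_nonneg _).trans (hB 0 ⟨le_rfl, n.cast_nonneg⟩)
  refine volume_eq_zero_of_image (fun p => (σ p, p.2)) (1 + 2 * (n + 1) * (B + 2 * n)) ?_
    (fun p hp => (hσ p hp.1).2.2.2) hQ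
  rintro p ⟨hpP, hpn, hpv, hpd, hpj, hpj'⟩ q ⟨hqP, hqn, hqv, hqd, hqj, hqj'⟩
  obtain ⟨hs, hst, hX, -⟩ := hσ p hpP
  obtain ⟨hs', hst', hX', -⟩ := hσ q hqP
  obtain ⟨t, v⟩ := p
  obtain ⟨t', v'⟩ := q
  simp only at *
  generalize σ (t, v) = s at *
  generalize σ (t', v') = s' at *
  set D := dist (s, v) (s', v') with hD
  have hDs : |s - s'| ≤ D := by rw [hD, Prod.dist_eq, Real.dist_eq]; exact le_max_left _ _
  have hDv : |v - v'| ≤ D := by 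
    rw [hD, Prod.dist_eq, Real.dist_eq, Real.dist_eq]; exact le_max_right _ _
  have hD0 : 0 ≤ D := dist_nonneg
  have ht : 0 < t := hs.trans hst
  have ht' : 0 < t' := hs'.trans hst'
  have htt : |t' - t| ≤ η n := abs_le.2 ⟨by linarith, by linarith⟩
  have hXs : |position V s' - position V s| ≤ B * |s - s'| := by
    rw [position_sub hV hs.le hs'.le, abs_sub_comm s s']
    refine intervalIntegral.norm_integral_le_of_norm_le_const fun x hx => hB x ?_
    have := uIoc_subset_uIcc hx
    rcases this with ⟨h1, h2⟩
    exact ⟨(le_min hs.le hs'.le).trans h1, h2.trans (max_le (by linarith) (by linarith))⟩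
  have hlow : |position V t' - position V t - (t' - t) * V t| ≤ 1 / (2 * (n + 1)) * |t' - t| := by
    have h1 : position V t' - position V t - (t' - t) * V t = ∫ τ in t..t', (V τ - V t) := by
      rw [intervalIntegral.integral_sub (intervalIntegrable_of_continuousOn_Ici hV ht.le ht'.le)
        (by simp), position_sub hV ht.le ht'.le]
      simp
    rw [h1, ← Real.norm_eq_abs]
    refine intervalIntegral.norm_integral_le_of_norm_le_const fun x hx => ?_
    have hx' := uIoc_subset_uIcc hx
    have hxt : |x - t| ≤ |t' - t| := abs_sub_left_of_mem_uIcc hx'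
    refine hVη n x ⟨(le_min ht.le ht'.le).trans hx'.1, hx'.2.trans (max_le hpn hqn)⟩ t
      ⟨ht.le, hpn⟩ (hxt.trans htt)
  have hdt : |t' - t| ≤ 2 * (n + 1) * (B + 2 * n) * D := by
    have hn1 : (0 : ℝ) < n + 1 := by positivity
    -- Difference of the two flight equations. The first term on the right is at most half of the
    -- guaranteed left-hand side and is absorbed.
    have e1 : (V t - v) * (t' - t) = -(position V t' - position V t - (t' - t) * V t) +
        (position V s' - position V s) + (v' - v) * (t' - s) - v' * (s' - s) := by
      linear_combination hX' - hX
    have e2 : |V t - v| * |t' - t| ≤ 1 / (2 * (n + 1)) * |t' - t| + B * D + D * n + n * D := by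
      rw [← abs_mul, e1]
      refine (abs_sub _ _).trans (add_le_add ((abs_add_le _ _).trans (add_le_add
        ((abs_add_le _ _).trans (add_le_add ?_ ?_)) ?_)) ?_)
      · rwa [abs_neg]
      · exact hXs.trans (by gcongr)
      · rw [abs_mul]
        refine mul_le_mul (by rwa [abs_sub_comm]) (abs_le.2 ⟨by linarith, by linarith⟩)
          (abs_nonneg _) hD0
      · rw [abs_mul]
        exact mul_le_mul hqv (by rwa [abs_sub_comm]) (abs_nonneg _) (by positivity)
    have e3 : 1 / ((n : ℝ) + 1) * |t' - t| ≤ |V t - v| * |t' - t| := by gcongr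
    have e4 : 1 / (2 * ((n : ℝ) + 1)) * |t' - t| ≤ (B + 2 * n) * D := by
      have : 1 / ((n : ℝ) + 1) = 2 * (1 / (2 * ((n : ℝ) + 1))) := by field_simp
      rw [this] at e3
      linarith
    rw [div_mul_eq_mul_div, one_mul, div_le_iff₀ (by positivity)] at e4
    linarith
  rw [Prod.dist_eq, Real.dist_eq, Real.dist_eq]
  have hCpos : 0 ≤ 2 * ((n : ℝ) + 1) * (B + 2 * n) * D := by positivity
  refine max_le ?_ ?_
  · rw [abs_sub_comm]; linarith
  · simp only; linarith

/-- For `k = 0` the set lies on the graph `v = X(t) / t`. A further collision pulls a null set back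
under the reflection `v ↦ 2 V s - v`, a measure-preserving shear, and then under a flight. -/
theorem volume_returnSet {V : ℝ → ℝ} (hV : ContinuousOn V (Ici 0)) (k : ℕ) :
    volume (returnSet V k) = 0 := by
  induction k with
  | zero =>
    have hm : Measurable fun t : ℝ => position V (max t 0) / t :=
      (continuous_position_max hV).measurable.div measurable_id
    refine measure_mono_null ?_ (volume_graph_eq_zero (μ := (volume : Measure ℝ)) hm)
    rintro ⟨t, v⟩ ⟨ht, -, h⟩
    simp only at ht h
    simp only [mem_ofPred_eq, max_eq_left ht.le]
    rw [h]; field_simp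
  | succ k ih =>
    have hc : Continuous fun t => V (max t 0) :=
      hV.comp_continuous (by fun_prop) fun t => le_max_right t 0
    have hshear : MeasurePreserving (fun p : ℝ × ℝ => (p.1, 2 * V (max p.1 0) - p.2))
        (volume.prod volume) (volume.prod volume) := by
      refine MeasurePreserving.skew_product (MeasurePreserving.id volume)
        (g := fun s v => 2 * V (max s 0) - v) ?_ (ae_of_all _ fun s => ?_)
      · exact ((continuous_const.mul (hc.comp continuous_fst)).sub continuous_snd).measurable
      · exact (Measure.measurePreserving_sub_left volume (2 * V (max s 0))).map_eq
    have h0 := hshear.quasiMeasurePreserving.preimage_null ih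
    refine measure_mono_null ?_ (volume_flight_eq_zero hV h0)
    rintro ⟨t, v⟩ ⟨hne, s, hs, hst, hX, hmem⟩
    refine ⟨hne, s, hs, hst, hX, ?_⟩
    simpa [max_eq_left hs.le] using hmem

theorem ae_notMem_returnSet {V : ℝ → ℝ} (hV : ContinuousOn V (Ici 0)) :
    ∀ᵐ t : ℝ, ∀ᵐ v : ℝ, ∀ k, (t, v) ∉ returnSet V k := by
  refine Measure.ae_ae_of_ae_prod (p := fun z : ℝ × ℝ => ∀ k, z ∉ returnSet V k) ?_
  refine ae_all_iff.2 fun k => ?_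
  exact measure_eq_zero_iff_ae_notMem.1 (volume_returnSet hV k)

/-! ### Transverse motion -/

/-- `|v|²` times the square of the half chord that the ball of radius `R` cuts from the line
through `x` in direction `v`. -/
def disc (R : ℝ) (x v : Transverse d) : ℝ := inner ℝ x v ^ 2 + ‖v‖ ^ 2 * (R ^ 2 - ‖x‖ ^ 2)

/-- A particle moving freely or reflected by the sphere of radius `R`, which is at `x` with
velocity `v`, can be on this sphere a time `τ` earlier only if this holds. -/
def Grazing (R : ℝ) (τ : ℝ) (x v : Transverse d) : Prop :=
  ∃ k : ℤ, inner ℝ x v - τ * ‖v‖ ^ 2 = (2 * k + 1) * √(disc R x v)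

theorem disc_add_smul (R c : ℝ) (x v : Transverse d) : disc R (x + c • v) v = disc R x v := by
  have h : ‖x + c • v‖ ^ 2 = ‖x‖ ^ 2 + 2 * c * inner ℝ x v + c ^ 2 * ‖v‖ ^ 2 := by
    rw [norm_add_sq_real, inner_smul_right, norm_smul, mul_pow, Real.norm_eq_abs, sq_abs]; ring
  rw [disc, disc, h, inner_add_left, inner_smul_left, real_inner_self_eq_norm_sq]
  simp; ring

/-- Fix `v ≠ 0` and `k`. Translating `x` by `c v` keeps `disc` and shifts `⟪x, v⟫` by `c ‖v‖²`, so
different translates of the slice are disjoint. A set with infinitely many disjoint translates by a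
bounded sequence is null. -/
theorem volume_grazing (hd : 2 ≤ d) (R τ : ℝ) :
    (volume.prod volume) {q : Transverse d × Transverse d | Grazing R τ q.2 q.1} = 0 := by
  have hset : {q : Transverse d × Transverse d | Grazing R τ q.2 q.1} =
      ⋃ k : ℤ, {q | inner ℝ q.2 q.1 - τ * ‖q.1‖ ^ 2 = (2 * k + 1) * √(disc R q.2 q.1)} := by
    ext q; simp [Grazing]
  rw [hset]
  refine measure_iUnion_null fun k => ?_
  have hmeas : MeasurableSet {q : Transverse d × Transverse d |
      inner ℝ q.2 q.1 - τ * ‖q.1‖ ^ 2 = (2 * k + 1) * √(disc R q.2 q.1)} := by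
    refine (isClosed_eq ?_ ?_).measurableSet
    · fun_prop
    · unfold disc; fun_prop
  rw [Measure.measure_prod_null hmeas]
  have : Nonempty (Fin (d - 1)) := ⟨⟨0, by omega⟩⟩
  have hne : ∀ᵐ v : Transverse d, v ≠ 0 := Measure.ae_ne volume 0
  filter_upwards [hne] with v hv
  have hv2 : ‖v‖ ^ 2 ≠ 0 := by positivity
  refine Measure.addHaar_eq_zero_of_disjoint_translates volume (fun n : ℕ => (1 / ((n : ℝ) + 1)) • v)
    ?_ ?_ (measurable_prodMk_left hmeas)
  · refine (Metric.isBounded_closedBall (x := (0 : Transverse d)) (r := ‖v‖)).subset ?_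
    rintro _ ⟨n, rfl⟩
    rw [mem_closedBall_zero_iff, norm_smul, Real.norm_eq_abs, abs_of_nonneg (by positivity)]
    refine mul_le_of_le_one_left (norm_nonneg _) ?_
    rw [div_le_one (by positivity)]; linarith [n.cast_nonneg (α := ℝ)]
  · intro n m hnm
    refine Set.disjoint_left.2 ?_
    intro z hzn hzm
    simp only [singleton_add, mem_image, mem_preimage, mem_ofPred_eq] at hzn hzm
    obtain ⟨x, hx, hxz⟩ := hzn
    obtain ⟨y, hy, hyz⟩ := hzm
    have hxe : x = z + (-(1 / ((n : ℝ) + 1))) • v := by rw [← hxz, neg_smul]; abel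
    have hye : y = z + (-(1 / ((m : ℝ) + 1))) • v := by rw [← hyz, neg_smul]; abel
    rw [hxe, disc_add_smul, inner_add_left, inner_smul_left, real_inner_self_eq_norm_sq] at hx
    rw [hye, disc_add_smul, inner_add_left, inner_smul_left, real_inner_self_eq_norm_sq] at hy
    have h1 : (1 / ((n : ℝ) + 1) - 1 / ((m : ℝ) + 1)) * ‖v‖ ^ 2 = 0 := by
      simp only [conj_trivial] at hx hy
      linear_combination hy - hx
    have h2 : 1 / ((n : ℝ) + 1) = 1 / ((m : ℝ) + 1) :=
      sub_eq_zero.1 ((mul_eq_zero.1 h1).resolve_right hv2)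
    rw [one_div, one_div, inv_inj, add_left_inj] at h2
    exact hnm (by exact_mod_cast h2)

theorem quasiMeasurePreserving_transverse :
    Measure.QuasiMeasurePreserving (fun p : Transverse d × Vect d => (p.2.2, p.1))
      volume (volume.prod volume) := by
  have h1 : Measure.QuasiMeasurePreserving
      (Prod.map (Prod.snd : ℝ × Transverse d → Transverse d) (id : Transverse d → Transverse d))
      (volume.prod volume) (volume.prod volume) :=
    MeasureTheory.QuasiMeasurePreserving.prodMap Measure.quasiMeasurePreserving_snd
      (Measure.QuasiMeasurePreserving.id volume)
  exact h1.comp (Measure.measurePreserving_swap).quasiMeasurePreserving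

theorem ae_not_grazing (hd : 2 ≤ d) (R τ : ℝ) :
    ∀ᵐ p : Transverse d × Vect d, ¬ Grazing R τ p.1 p.2.2 :=
  quasiMeasurePreserving_transverse.ae
    (measure_eq_zero_iff_ae_notMem.1 (volume_grazing hd R τ))

theorem ae_transverse_ne_zero (hd : 2 ≤ d) : ∀ᵐ p : Transverse d × Vect d, p.2.2 ≠ 0 := by
  have : Nonempty (Fin (d - 1)) := ⟨⟨0, by omega⟩⟩
  have hne : ∀ᵐ v : Transverse d, v ≠ 0 := Measure.ae_ne volume 0
  have h : Measure.QuasiMeasurePreserving (fun p : Transverse d × Vect d => p.2.2)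
      volume volume :=
    Measure.quasiMeasurePreserving_snd.comp Measure.quasiMeasurePreserving_snd
  exact h.ae hne

theorem ae_longitudinal {P : ℝ → Prop} (h : ∀ᵐ v, P v) :
    ∀ᵐ p : Transverse d × Vect d, P p.2.1 := by
  have h' : Measure.QuasiMeasurePreserving (fun p : Transverse d × Vect d => p.2.1)
      volume volume :=
    Measure.quasiMeasurePreserving_fst.comp Measure.quasiMeasurePreserving_snd
  exact h'.ae h

theorem ae_norm_ne {R : ℝ} (hR : 0 < R) : ∀ᵐ p : Transverse d × Vect d, ‖p.1‖ ≠ R := by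
  have h : ∀ᵐ x : Transverse d, ‖x‖ ≠ R := by
    have := Measure.addHaar_sphere_of_ne_zero (volume : Measure (Transverse d)) 0 hR.ne'
    filter_upwards [measure_eq_zero_iff_ae_notMem.1 this] with x hx
    simpa using hx
  exact (Measure.quasiMeasurePreserving_fst (μ := (volume : Measure (Transverse d)))
    (ν := (volume : Measure (Vect d)))).ae h

/-- Almost no particle hits the edge of the base. -/
theorem ae_not_edge {V : ℝ → ℝ} (hV : ContinuousOn V (Ici 0)) (hd : 2 ≤ d) (R t : ℝ) :
    ∀ᵐ p : Transverse d × Vect d, ∀ s, 0 ≤ s → s < t →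
      position V t - position V s = p.2.1 * (t - s) → ¬ Grazing R (t - s) p.1 p.2.2 := by
  -- For fixed `k`, grazing determines the flight time `t - s` from the transverse data as `σ k`.
  -- The longitudinal equation then determines `v_x` as `g k`, so the bad set lies in countably many
  -- graphs.
  let σ : ℤ → Transverse d × Transverse d → ℝ := fun k q =>
    (inner ℝ q.1 q.2 - (2 * k + 1) * √(disc R q.1 q.2)) / ‖q.2‖ ^ 2
  have hσ : ∀ k, Measurable (σ k) := fun k => by
    refine Measurable.div (Continuous.measurable ?_) (by fun_prop)
    unfold disc; fun_prop
  let g : ℤ → Transverse d × Transverse d → ℝ := fun k q =>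
    (position V t - position V (max (t - σ k q) 0)) / σ k q
  have hg : ∀ k, Measurable (g k) := fun k =>
    (((continuous_position_max hV).measurable.comp
      ((hσ k).const_sub t)).const_sub _).div (hσ k)
  have hmap : Measure.QuasiMeasurePreserving
      (fun p : Transverse d × Vect d => ((p.1, p.2.2), p.2.1)) volume
      ((volume.prod volume).prod volume) := by
    have h1 : MeasurePreserving (Prod.map (id : Transverse d → Transverse d)
        (Prod.swap : ℝ × Transverse d → Transverse d × ℝ)) (volume.prod (volume.prod volume))
        (volume.prod (volume.prod volume)) :=
      (MeasurePreserving.id volume).prod Measure.measurePreserving_swap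
    exact ((measurePreserving_prodAssoc volume volume volume).symm.comp h1).quasiMeasurePreserving
  have hnull : ∀ᵐ p : Transverse d × Vect d, ∀ k, p.2.1 ≠ g k (p.1, p.2.2) :=
    ae_all_iff.2 fun k => hmap.ae (measure_eq_zero_iff_ae_notMem.1 (volume_graph_eq_zero (hg k)))
  filter_upwards [hnull, ae_transverse_ne_zero hd] with p hp hp0 s hs hst hX ⟨k, hk⟩
  have hn : ‖p.2.2‖ ^ 2 ≠ 0 := by positivity
  have hσs : σ k (p.1, p.2.2) = t - s := by
    simp only [σ]
    rw [div_eq_iff hn]; linear_combination hk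
  refine hp k ?_
  have : t - s ≠ 0 := (sub_pos.2 hst).ne'
  simp only [g, hσs, sub_sub_cancel, max_eq_left hs]
  rw [hX]; field_simp

/-! ### Elementary properties of reflections and flights -/

theorem flight_eq (x v : Vect d) (t t' τ : ℝ) :
    x - (t - t') • v - (t' - τ) • v = x - (t - τ) • v := by
  module

theorem reflectBase_reflectBase (W : ℝ) (v : Vect d) : reflectBase W (reflectBase W v) = v := by
  ext <;> simp [reflectBase]

theorem inner_reflectSide {y : Transverse d} (hy : y ≠ 0) (v : Vect d) :
    inner ℝ y (reflectSide y v).2 = -inner ℝ y v.2 := by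
  have : ‖y‖ ^ 2 ≠ 0 := by positivity
  simp only [reflectSide, inner_sub_right, inner_smul_right, real_inner_self_eq_norm_sq,
    real_inner_comm y v.2]
  rw [div_mul_cancel₀ _ this]; ring

theorem norm_reflectSide (y : Transverse d) (v : Vect d) :
    ‖(reflectSide y v).2‖ = ‖v.2‖ := by
  rcases eq_or_ne y 0 with rfl | hy
  · simp [reflectSide]
  have h : ‖y‖ ^ 2 ≠ 0 := by positivity
  have : ‖(reflectSide y v).2‖ ^ 2 = ‖v.2‖ ^ 2 := by
    simp only [reflectSide]
    rw [norm_sub_sq_real, inner_smul_right, norm_smul, mul_pow, Real.norm_eq_abs, sq_abs]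
    field_simp
    ring
  exact (sq_eq_sq₀ (norm_nonneg _) (norm_nonneg _)).1 this

theorem reflectSide_reflectSide (y : Transverse d) (v : Vect d) :
    reflectSide y (reflectSide y v) = v := by
  rcases eq_or_ne y 0 with rfl | hy
  · simp [reflectSide]
  have h : inner ℝ (reflectSide y v).2 y = -inner ℝ v.2 y := by
    rw [real_inner_comm, inner_reflectSide hy, real_inner_comm]
  refine Prod.ext rfl ?_
  rw [reflectSide, h]
  simp only [reflectSide]
  module

theorem grazing_flight (R t s : ℝ) (x v : Transverse d) :
    Grazing R s (x - (t - s) • v) v ↔ Grazing R t x v := by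
  have h : x - (t - s) • v = x + (-(t - s)) • v := by module
  simp only [Grazing, h, disc_add_smul, inner_add_left, inner_smul_left,
    real_inner_self_eq_norm_sq, conj_trivial]
  refine exists_congr fun k => ?_
  constructor <;> intro h <;> linarith

theorem disc_of_norm_eq {R : ℝ} {x v : Transverse d} (hx : ‖x‖ = R) :
    √(disc R x v) = |inner ℝ x v| := by
  rw [disc, hx, sub_self, mul_zero, add_zero, Real.sqrt_sq_eq_abs]

theorem grazing_of_norm_eq {R : ℝ} {x v : Transverse d} (hx : ‖x‖ = R) : Grazing R 0 x v := by
  rw [Grazing, disc_of_norm_eq hx]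
  rcases abs_cases (inner ℝ x v) with ⟨h, _⟩ | ⟨h, _⟩
  · exact ⟨0, by rw [h]; simp⟩
  · exact ⟨-1, by rw [h]; push_cast; ring⟩

theorem disc_reflectSide {R : ℝ} (hR : 0 < R) {x : Transverse d} (hx : ‖x‖ = R) (v : Vect d) :
    disc R x (reflectSide x v).2 = disc R x v.2 := by
  have hx0 : x ≠ 0 := by rintro rfl; simp at hx; linarith
  rw [disc, disc, inner_reflectSide hx0, norm_reflectSide]; ring

/-- On the sphere `√disc = |⟪x, v⟫|`, and the reflection changes the sign of `⟪x, v⟫`: the odd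
multiple moves by two, that is, `k` by one. Together with `grazing_flight` this makes grazing an
invariant of the billiard. -/
theorem grazing_reflectSide {R s : ℝ} (hR : 0 < R) {x : Transverse d} (hx : ‖x‖ = R) {v : Vect d}
    (h : Grazing R s x v.2) : Grazing R s x (reflectSide x v).2 := by
  have hx0 : x ≠ 0 := by rintro rfl; simp at hx; linarith
  obtain ⟨k, hk⟩ := h
  rw [Grazing, disc_reflectSide hR hx, inner_reflectSide hx0, norm_reflectSide]
  rw [disc_of_norm_eq hx] at hk ⊢
  rcases abs_cases (inner ℝ x v.2) with ⟨h, _⟩ | ⟨h, _⟩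
  · exact ⟨k - 1, by rw [h] at hk ⊢; push_cast; linear_combination hk⟩
  · exact ⟨k + 1, by rw [h] at hk ⊢; push_cast; linear_combination hk⟩

theorem grazing_reflectSide_iff {R s : ℝ} (hR : 0 < R) {x : Transverse d} (hx : ‖x‖ = R)
    {v : Vect d} : Grazing R s x (reflectSide x v).2 ↔ Grazing R s x v.2 :=
  ⟨fun h => by simpa [reflectSide_reflectSide] using grazing_reflectSide hR hx h,
    grazing_reflectSide hR hx⟩

/-! ### Traces -/

theorem traceBefore_eq {f : ℝ → Vect d → Vect d → ℝ} {t c : ℝ} {x v : Vect d}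
    (h : ∀ᶠ τ in 𝓝[<] t, f τ (x - (t - τ) • v) v = c) : traceBefore f t x v = c := by
  refine Tendsto.limUnder_eq (tendsto_const_nhds.congr' ?_)
  have ht : Tendsto (fun ε : ℝ => t - ε) (𝓝[>] 0) (𝓝[<] t) := by
    refine tendsto_nhdsWithin_iff.2 ⟨?_, ?_⟩
    · have : Tendsto (fun ε : ℝ => t - ε) (𝓝 0) (𝓝 (t - 0)) := by
        exact (continuous_const.sub continuous_id).tendsto 0
      rw [sub_zero] at this
      exact this.mono_left nhdsWithin_le_nhds
    · filter_upwards [self_mem_nhdsWithin] with ε (hε : 0 < ε)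
      exact sub_lt_self t hε
  filter_upwards [ht.eventually h] with ε hε
  rw [← hε, sub_sub_cancel]

theorem traceAfter_eq {f : ℝ → Vect d → Vect d → ℝ} {s c : ℝ} {x v : Vect d}
    (h : ∀ᶠ τ in 𝓝[>] s, f τ (x + (τ - s) • v) v = c) : traceAfter f s x v = c := by
  refine Tendsto.limUnder_eq (tendsto_const_nhds.congr' ?_)
  have ht : Tendsto (fun ε : ℝ => s + ε) (𝓝[>] 0) (𝓝[>] s) := by
    refine tendsto_nhdsWithin_iff.2 ⟨?_, ?_⟩
    · have : Tendsto (fun ε : ℝ => s + ε) (𝓝 0) (𝓝 (s + 0)) := by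
        exact (continuous_const.add continuous_id).tendsto 0
      rw [add_zero] at this
      exact this.mono_left nhdsWithin_le_nhds
    · filter_upwards [self_mem_nhdsWithin] with ε (hε : 0 < ε)
      exact lt_add_of_pos_right s hε
  filter_upwards [ht.eventually h] with ε hε
  rw [← hε, add_sub_cancel_left]

theorem Model.IsGasDensity.vlasov_flight {M : Model d} {V : ℝ → ℝ} {f : ℝ → Vect d → Vect d → ℝ}
    (hf : M.IsGasDensity V f) {t a b : ℝ} {x v : Vect d} (ha : 0 ≤ a) (hab : a ≤ b)
    (hfree : ∀ τ ∈ Icc a b, x - (t - τ) • v ∉ M.body V τ) :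
    f b (x - (t - b) • v) v = f a (x - (t - a) • v) v := by
  rw [← flight_eq x v t b a]
  exact hf.vlasov a b _ v ha hab fun τ hτ => by rw [flight_eq]; exact hfree τ hτ

theorem Model.IsGasDensity.trace_flight {M : Model d} {V : ℝ → ℝ} {f : ℝ → Vect d → Vect d → ℝ}
    (hf : M.IsGasDensity V f) {s t : ℝ} {x v : Vect d} (hs : 0 ≤ s) (hst : s < t)
    (hfree : ∀ τ ∈ Ioo s t, x - (t - τ) • v ∉ M.body V τ) :
    traceBefore f t x v = traceAfter f s (x - (t - s) • v) v := by
  obtain ⟨m, hm⟩ := nonempty_Ioo.2 hst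
  have hc : ∀ τ ∈ Ioo s t, f τ (x - (t - τ) • v) v = f m (x - (t - m) • v) v := by
    intro τ hτ
    rcases le_total m τ with h | h
    · exact hf.vlasov_flight (hs.trans hm.1.le) h fun r hr =>
        hfree r ⟨hm.1.trans_le hr.1, hr.2.trans_lt hτ.2⟩
    · exact (hf.vlasov_flight (hs.trans hτ.1.le) h fun r hr =>
        hfree r ⟨hτ.1.trans_le hr.1, hr.2.trans_lt hm.2⟩).symm
  rw [traceBefore_eq (c := f m (x - (t - m) • v) v), traceAfter_eq (c := f m (x - (t - m) • v) v)]
  · filter_upwards [Ioo_mem_nhdsGT hst] with τ hτ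
    rw [← hc τ hτ]
    congr 1
    module
  · filter_upwards [Ioo_mem_nhdsLT hst] with τ hτ
    exact hc τ hτ

/-- The particle at `x` with velocity `v` at time `t` has been on the base at time `0`, if it
underwent a certain sequence of collisions. -/
def Returns (V : ℝ → ℝ) (t : ℝ) (x v : Vect d) : Prop :=
  x.1 = t * v.1 ∨ ∃ k s, 0 < s ∧ s < t ∧ x.1 - (t - s) * v.1 = position V s ∧
    (s, 2 * V s - v.1) ∈ returnSet V k

/-- The boundary conditions carry the trace back through each collision. Only the first flight can
fail: constancy of `f` down to time `0` needs the particle off the body at time `0` too, whereas a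
history is free on an open interval. Starting on the base gives `Returns`, starting on the barrier
gives `Grazing`, and both propagate forward along the history. -/
theorem Model.IsGasDensity.trace_history {M : Model d} (hR : 0 < M.R) {V : ℝ → ℝ}
    {f : ℝ → Vect d → Vect d → ℝ} (hf : M.IsGasDensity V f) {t : ℝ} {x v v₀ : Vect d}
    (H : M.History V t x v v₀) (ht : 0 < t) :
    traceBefore f t x v = M.f₀ v₀ ∨ Grazing M.R t x.2 v.2 ∨ Returns V t x v := by
  induction H with
  | free t x v _ hfree =>
    by_cases h0 : x - (t - 0) • v ∈ M.body V 0
    · rcases h0 with h0 | h0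
      · right; right; left
        have := h0.1
        rw [position_zero] at this
        simpa [sub_eq_zero] using this
      · right; left
        refine (grazing_flight M.R t 0 x.2 v.2).1 (grazing_of_norm_eq ?_)
        simpa using h0.2.2
    · left
      refine traceBefore_eq ?_
      filter_upwards [Ioo_mem_nhdsLT ht] with τ hτ
      rw [hf.vlasov_flight le_rfl hτ.1.le fun r hr => ?_, hf.initial]
      rcases hr.1.eq_or_lt with rfl | h
      · exact h0
      · exact hfree r ⟨h, hr.2.trans_lt hτ.2⟩
  | base t s x v v₀ hs hst hfree hhit hprev ih =>
    -- Here `v` is the outgoing velocity; the boundary condition is applied to its reflection, and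
    -- the reflection is an involution.
    have hhit' : M.HitsBase V s (x - (t - s) • v) (reflectBase (V s) v) :=
      ⟨hhit.1, hhit.2.1, fun h => hhit.2.2 (by simp only [reflectBase] at h; linarith)⟩
    have h1 := hf.boundary_base s _ _ hs hhit' ⟨v₀, hprev⟩
    rw [reflectBase_reflectBase] at h1
    have hX : (x - (t - s) • v).1 = position V s := hhit.1.1
    rw [hf.trace_flight hs.le hst hfree, h1]
    rcases ih hs with h | h | h
    · exact Or.inl h
    · exact Or.inr (Or.inl ((grazing_flight M.R t s x.2 v.2).1 h))
    · right; right; right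
      have hX' : x.1 - (t - s) * v.1 = position V s := by simpa using hX
      rcases h with h | ⟨k, s', hs', hss', hX2, hmem⟩
      · exact ⟨0, s, hs, hst, hX', hs, hhit'.2.2, hX ▸ h⟩
      · refine ⟨k + 1, s, hs, hst, hX', hhit'.2.2, s', hs', hss', ?_, hmem⟩
        rw [hX] at hX2
        simp only [reflectBase] at hX2
        simp only
        linarith
  | side t s x v v₀ hs hst hfree hhit hprev ih =>
    have hn : ‖(x - (t - s) • v).2‖ = M.R := hhit.1.2.2
    have hx0 : (x - (t - s) • v).2 ≠ 0 := by intro h; rw [h] at hn; simp at hn; linarith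
    have hhit' : M.HitsSide V s (x - (t - s) • v) (reflectSide (x - (t - s) • v).2 v) := by
      refine ⟨hhit.1, hhit.2.1, ?_⟩
      rw [real_inner_comm, inner_reflectSide hx0, real_inner_comm]
      exact neg_ne_zero.2 hhit.2.2
    have h1 := hf.boundary_side s _ _ hs hhit' ⟨v₀, hprev⟩
    rw [reflectSide_reflectSide] at h1
    rw [hf.trace_flight hs.le hst hfree, h1]
    rcases ih hs with h | h | h
    · exact Or.inl h
    · right; left
      exact (grazing_flight M.R t s x.2 v.2).1 ((grazing_reflectSide_iff hR hn).1 h)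
    · right; right
      rcases h with h | ⟨k, s', hs', hss', hX2, hmem⟩
      · left
        simp [reflectSide] at h
        linarith
      · right
        refine ⟨k, s', hs', hss'.trans hst, ?_, hmem⟩
        simp [reflectSide] at hX2
        linarith

theorem Model.History.extend {M : Model d} {V : ℝ → ℝ} {t t' : ℝ} {x v v₀ : Vect d} (htt : t' ≤ t)
    (H : M.History V t' (x - (t - t') • v) v v₀)
    (hfree : ∀ τ ∈ Ico t' t, x - (t - τ) • v ∉ M.body V τ) : M.History V t x v v₀ := by
  have key : ∀ s, (∀ τ ∈ Ioo s t', x - (t - t') • v - (t' - τ) • v ∉ M.body V τ) →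
      ∀ τ ∈ Ioo s t, x - (t - τ) • v ∉ M.body V τ := by
    intro s h τ hτ
    rcases lt_or_ge τ t' with h' | h'
    · rw [← flight_eq x v t t' τ]; exact h τ ⟨hτ.1, h'⟩
    · exact hfree τ ⟨h', hτ.2⟩
  cases H with
  | free _ _ _ ht h => exact .free t x v (ht.trans htt) (key 0 h)
  | base _ s _ _ _ hs hst h hhit hprev =>
    rw [flight_eq] at hhit hprev
    exact .base t s x v v₀ hs (hst.trans_le htt) (key s h) hhit hprev
  | side _ s _ _ _ hs hst h hhit hprev =>
    rw [flight_eq] at hhit hprev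
    exact .side t s x v v₀ hs (hst.trans_le htt) (key s h) hhit hprev

/-- If the particle had a history at a time just before `t`, it would extend along the last free
piece to `t`. So `f` takes its normalized value all along that piece. -/
theorem Model.IsGasDensity.trace_of_not_regular {M : Model d} {V : ℝ → ℝ}
    {f : ℝ → Vect d → Vect d → ℝ} (hf : M.IsGasDensity V f) {t : ℝ} {x v : Vect d}
    (ht : 0 < t) (hfree : ∀ᶠ τ in 𝓝[<] t, x - (t - τ) • v ∉ M.body V τ)
    (hreg : ¬ M.Regular V t x v) : traceBefore f t x v = M.f₀ v := by
  obtain ⟨a, hat, ha⟩ := (mem_nhdsLT_iff_exists_Ioo_subset).1 hfree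
  refine traceBefore_eq ?_
  filter_upwards [Ioo_mem_nhdsLT (max_lt ht hat)] with τ hτ
  have h0 : 0 < τ := (le_max_left _ _).trans_lt hτ.1
  have h1 : a < τ := (le_max_right _ _).trans_lt hτ.1
  refine hf.normalized τ _ v h0.le (ha ⟨h1, hτ.2⟩) fun ⟨v₀, H⟩ => hreg ⟨v₀, ?_⟩
  exact H.extend hτ.2.le fun r hr => ha ⟨h1.trans_le hr.1, hr.2⟩

/-! ### Arrivals at the base -/

theorem eventually_pos_left {y : ℝ → ℝ} {y' t : ℝ} (h : HasDerivAt y y' t) (h0 : y t = 0)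
    (hy' : y' < 0) : ∀ᶠ τ in 𝓝[<] t, 0 < y τ := by
  have h1 := (hasDerivWithinAt_iff_tendsto_slope' (s := Iio t) self_notMem_Iio).1
    h.hasDerivWithinAt
  filter_upwards [h1.eventually (gt_mem_nhds hy'), self_mem_nhdsWithin] with τ hτ (hτt : τ < t)
  rw [slope_def_field, h0, sub_zero, div_neg_iff] at hτ
  rcases hτ with hτ | hτ
  · exact hτ.1
  · linarith [hτ.2]

theorem eventually_neg_left {y : ℝ → ℝ} {y' t : ℝ} (h : HasDerivAt y y' t) (h0 : y t = 0)
    (hy' : 0 < y') : ∀ᶠ τ in 𝓝[<] t, y τ < 0 := by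
  filter_upwards [eventually_pos_left h.fun_neg (by simp [h0]) (neg_lt_zero.2 hy')] with τ hτ
  linarith

theorem deriv_nonneg_of_pos_right {y : ℝ → ℝ} {y' s : ℝ} (h : HasDerivAt y y' s) (h0 : y s = 0)
    (hpos : ∀ᶠ τ in 𝓝[>] s, 0 < y τ) : 0 ≤ y' := by
  have h1 := (hasDerivWithinAt_iff_tendsto_slope' (s := Ioi s) self_notMem_Ioi).1
    h.hasDerivWithinAt
  refine ge_of_tendsto h1 ?_
  filter_upwards [hpos, self_mem_nhdsWithin] with τ hτ (hτs : s < τ)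
  rw [slope_def_field, h0, sub_zero]
  exact div_nonneg hτ.le (sub_pos.2 hτs).le

theorem deriv_nonpos_of_neg_right {y : ℝ → ℝ} {y' s : ℝ} (h : HasDerivAt y y' s) (h0 : y s = 0)
    (hneg : ∀ᶠ τ in 𝓝[>] s, y τ < 0) : y' ≤ 0 := by
  have := deriv_nonneg_of_pos_right h.fun_neg (by simp [h0])
    (hneg.mono fun τ hτ => neg_pos.2 hτ)
  linarith

theorem hasDerivAt_relative {V : ℝ → ℝ} (hV : ContinuousOn V (Ici 0)) {s : ℝ} (hs : 0 < s)
    (a b u : ℝ) : HasDerivAt (fun τ => a - (b - τ) * u - position V τ) (u - V s) s := by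
  have h1 : HasDerivAt (fun τ => a - (b - τ) * u) u s := by
    have := (((hasDerivAt_id s).const_sub b).mul_const u).const_sub a
    simpa using this
  exact h1.sub (hasDerivAt_position hV hs)

/-- The point `p` is in front of the base, inside the cylinder on it. -/
def Model.Inside (M : Model d) (V : ℝ → ℝ) (τ : ℝ) (p : Vect d) : Prop :=
  position V τ < p.1 ∧ ‖p.2‖ < M.R

/-- The point `p` is behind the base or outside the infinite cylinder around the axis. -/
def Model.Outside (M : Model d) (V : ℝ → ℝ) (τ : ℝ) (p : Vect d) : Prop :=
  p.1 < position V τ ∨ M.R < ‖p.2‖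

theorem Model.not_mem_body_of_inside_lt {M : Model d} {V : ℝ → ℝ} {τ : ℝ} {p : Vect d}
    (h : p.1 ≠ position V τ) (h' : ‖p.2‖ < M.R) : p ∉ M.body V τ := by
  rintro (hp | hp)
  · exact h hp.1
  · exact h'.ne hp.2.2

theorem eventually_norm_lt (R : ℝ) (t : ℝ) (x v : Transverse d) (hx : ‖x‖ < R) :
    ∀ᶠ τ in 𝓝[<] t, ‖x - (t - τ) • v‖ < R := by
  have hc : ContinuousAt (fun τ : ℝ => ‖x - (t - τ) • v‖) t := by fun_prop
  refine (hc.eventually (gt_mem_nhds ?_)).filter_mono nhdsWithin_le_nhds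
  simpa using hx

theorem Model.inside_of_lt {M : Model d} {V : ℝ → ℝ} (hV : ContinuousOn V (Ici 0)) {t : ℝ}
    (ht : 0 < t) {x v : Vect d} (hx : x.1 = position V t) (hxR : ‖x.2‖ < M.R) (hv : v.1 < V t) :
    ∀ᶠ τ in 𝓝[<] t, M.Inside V τ (x - (t - τ) • v) := by
  filter_upwards [eventually_norm_lt M.R t x.2 v.2 hxR,
    eventually_pos_left (hasDerivAt_relative hV ht x.1 t v.1) (by simp [hx]) (sub_neg.2 hv)]
    with τ h1 h2
  exact ⟨by simpa using h2, by simpa using h1⟩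

theorem behind_of_lt {V : ℝ → ℝ} (hV : ContinuousOn V (Ici 0)) {t : ℝ}
    (ht : 0 < t) {x v : Vect d} (hx : x.1 = position V t) (hv : V t < v.1) :
    ∀ᶠ τ in 𝓝[<] t, (x - (t - τ) • v).1 < position V τ := by
  filter_upwards [eventually_neg_left (hasDerivAt_relative hV ht x.1 t v.1) (by simp [hx])
    (sub_pos.2 hv)] with τ h2
  simpa using h2

theorem Model.free_before_base {M : Model d} {V : ℝ → ℝ} (hV : ContinuousOn V (Ici 0)) {t : ℝ}
    (ht : 0 < t) {x v : Vect d} (hx : x.1 = position V t) (hxR : ‖x.2‖ < M.R) (hv : v.1 ≠ V t) :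
    ∀ᶠ τ in 𝓝[<] t, x - (t - τ) • v ∉ M.body V τ := by
  rcases hv.lt_or_gt with hv | hv
  · filter_upwards [M.inside_of_lt hV ht hx hxR hv] with τ h
    exact M.not_mem_body_of_inside_lt h.1.ne' h.2
  · filter_upwards [behind_of_lt hV ht hx hv, eventually_norm_lt M.R t x.2 v.2 hxR] with τ h h'
    exact M.not_mem_body_of_inside_lt h.ne (by simpa using h')

/-- The trace of the density at almost every particle that hits the base. -/
theorem Model.IsGasDensity.ae_trace {M : Model d} (hd : 2 ≤ d) (hR : 0 < M.R) {V : ℝ → ℝ}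
    (hV : ContinuousOn V (Ici 0)) {f : ℝ → Vect d → Vect d → ℝ} (hf : M.IsGasDensity V f) :
    ∀ᵐ t : ℝ, 0 < t → ∀ᵐ p : Transverse d × Vect d, ‖p.1‖ ≤ M.R → ‖p.1‖ < M.R ∧ p.2.1 ≠ V t ∧
      (¬ M.Regular V t (position V t, p.1) p.2 →
        traceBefore f t (position V t, p.1) p.2 = M.f₀ p.2) ∧
      (∀ v₀, M.History V t (position V t, p.1) p.2 v₀ →
        traceBefore f t (position V t, p.1) p.2 = M.f₀ v₀) := by
  filter_upwards [ae_notMem_returnSet hV] with t hret ht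
  filter_upwards [ae_norm_ne hR, ae_not_grazing hd M.R t, ae_longitudinal hret,
    ae_longitudinal (Measure.ae_ne volume (V t))] with p hpR hgr hpret hpV hle
  have hlt : ‖p.1‖ < M.R := lt_of_le_of_ne hle hpR
  refine ⟨hlt, hpV, fun h => hf.trace_of_not_regular ht
    (M.free_before_base hV ht rfl hlt hpV) h, fun v₀ H => ?_⟩
  rcases hf.trace_history hR H ht with h | h | h
  · exact h
  · exact absurd h hgr
  · exfalso
    -- At a point of the base, the two cases of `Returns` are membership in `returnSet V 0` and in
    -- `returnSet V (k + 1)`.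
    rcases h with h | ⟨k, s, hs, hst, hX, hmem⟩
    · exact hpret 0 ⟨ht, hpV, h⟩
    · refine hpret (k + 1) ⟨hpV, s, hs, hst, ?_, hmem⟩
      simp only at hX ⊢
      linarith

/-! ### Collisions along a history -/

/-- Lateral reflections do not affect `v_x`, so the longitudinal motion is uniform back to the last
base collision, if there is one. -/
theorem Model.History.longitudinal {M : Model d} {V : ℝ → ℝ} {t : ℝ} {x v v₀ : Vect d}
    (H : M.History V t x v v₀) :
    v₀.1 = v.1 ∨ ∃ s, 0 < s ∧ s < t ∧ x.1 - (t - s) * v.1 = position V s := by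
  induction H with
  | free => exact Or.inl rfl
  | base t s x v v₀ hs hst hfree hhit hprev ih =>
    exact Or.inr ⟨s, hs, hst, by simpa using hhit.1.1⟩
  | side t s x v v₀ hs hst hfree hhit hprev ih =>
    rcases ih with h | ⟨s', hs', hss', h⟩
    · exact Or.inl h
    · refine Or.inr ⟨s', hs', hss'.trans hst, ?_⟩
      simp [reflectSide] at h
      linarith

theorem Model.History.norm_transverse {M : Model d} {V : ℝ → ℝ} {t : ℝ} {x v v₀ : Vect d}
    (H : M.History V t x v v₀) : ‖v₀.2‖ = ‖v.2‖ := by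
  induction H with
  | free => rfl
  | base t s x v v₀ hs hst hfree hhit hprev ih => exact ih
  | side t s x v v₀ hs hst hfree hhit hprev ih => rw [ih, norm_reflectSide]

/-- A free flight that stays below the upper rim of the barrier does not leave or enter the
hollow. -/
theorem Model.inside_or_outside {M : Model d} {V : ℝ → ℝ} (hV : ContinuousOn V (Ici 0)) {s t : ℝ}
    (hs : 0 ≤ s) {x v : Vect d} (hfree : ∀ τ ∈ Ioo s t, x - (t - τ) • v ∉ M.body V τ)
    (hlow : ∀ τ ∈ Ioo s t, (x - (t - τ) • v).1 - position V τ < M.h) :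
    (∀ τ ∈ Ioo s t, M.Inside V τ (x - (t - τ) • v)) ∨
      ∀ τ ∈ Ioo s t, M.Outside V τ (x - (t - τ) • v) := by
  have hX : ContinuousOn (position V) (Ioo s t) :=
    (continuousOn_position hV).mono fun τ hτ => hs.trans hτ.1.le
  have h1 : ContinuousOn (fun τ => (x - (t - τ) • v).1 - position V τ) (Ioo s t) :=
    ContinuousOn.sub (by fun_prop) hX
  have h2 : ContinuousOn (fun τ => ‖(x - (t - τ) • v).2‖) (Ioo s t) := by fun_prop
  have hI : IsOpen (Ioo s t ∩ {τ | M.Inside V τ (x - (t - τ) • v)}) := by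
    have := (h1.isOpen_inter_preimage isOpen_Ioo (isOpen_Ioi (a := 0))).inter
      (h2.isOpen_inter_preimage isOpen_Ioo (isOpen_Iio (a := M.R)))
    convert this using 1
    ext τ
    simp only [Model.Inside, mem_inter_iff, mem_preimage, mem_Ioi, mem_Iio, sub_pos, mem_ofPred_eq]
    tauto
  have hO : IsOpen (Ioo s t ∩ {τ | M.Outside V τ (x - (t - τ) • v)}) := by
    have := (h1.isOpen_inter_preimage isOpen_Ioo (isOpen_Iio (a := 0))).union
      (h2.isOpen_inter_preimage isOpen_Ioo (isOpen_Ioi (a := M.R)))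
    convert this using 1
    ext τ
    simp only [Model.Outside, mem_inter_iff, mem_preimage, mem_Ioi, mem_Iio, sub_neg, mem_union,
      mem_ofPred_eq]
    tauto
  -- Below the rim, the part of the sphere above the base belongs to the barrier and is not met. The
  -- flight is thus covered by two disjoint open sets, and connectedness of the interval decides
  -- between them.
  have hcov : Ioo s t ⊆ (Ioo s t ∩ {τ | M.Inside V τ (x - (t - τ) • v)}) ∪
      (Ioo s t ∩ {τ | M.Outside V τ (x - (t - τ) • v)}) := by
    intro τ hτ
    by_cases hout : M.Outside V τ (x - (t - τ) • v)
    · exact Or.inr ⟨hτ, hout⟩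
    · refine Or.inl ⟨hτ, ?_⟩
      simp only [Model.Outside, not_or, not_lt] at hout
      refine ⟨lt_of_le_of_ne hout.1 fun h => hfree τ hτ (Or.inl ⟨h.symm, hout.2⟩),
        lt_of_le_of_ne hout.2 fun h => hfree τ hτ (Or.inr ⟨sub_nonneg.2 hout.1, (hlow τ hτ).le, h⟩)⟩
  have hdisj : Disjoint (Ioo s t ∩ {τ | M.Inside V τ (x - (t - τ) • v)})
      (Ioo s t ∩ {τ | M.Outside V τ (x - (t - τ) • v)}) := by
    refine Set.disjoint_left.2 ?_
    rintro τ ⟨-, hi⟩ ⟨-, ho⟩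
    rcases ho with ho | ho
    · exact lt_asymm ho hi.1
    · exact lt_asymm ho hi.2
  by_cases hne : (Ioo s t ∩ (Ioo s t ∩ {τ | M.Inside V τ (x - (t - τ) • v)})).Nonempty
  · exact Or.inl fun τ hτ =>
      (isPreconnected_Ioo.subset_left_of_subset_union hI hO hdisj hcov hne hτ).2
  · refine Or.inr fun τ hτ => ?_
    rcases hcov hτ with h | h
    · exact absurd ⟨τ, hτ, h⟩ hne
    · exact h.2

theorem hasDerivAt_norm_sq_flight (t s : ℝ) (x v : Transverse d) (R : ℝ) :
    HasDerivAt (fun τ => ‖x - (t - τ) • v‖ ^ 2 - R ^ 2) (2 * inner ℝ (x - (t - s) • v) v) s := by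
  have h1 : HasDerivAt (fun τ : ℝ => x - (t - τ) • v) v s := by
    have := (((hasDerivAt_id s).const_sub t).smul_const v).const_sub x
    simpa using this
  exact h1.norm_sq.sub_const _

/-- No particle that collides twice with the base reaches the upper rim of the barrier
in between. -/
def Model.NoEscape (M : Model d) (V : ℝ → ℝ) : Prop :=
  ∀ s T u, 0 ≤ s → s < T → position V T - position V s = u * (T - s) →
    ∀ τ ∈ Icc s T, position V s + u * (τ - s) - position V τ < M.h

/-- Between base collisions a particle stays on the side of the body it arrives from. Inside the
hollow each earlier base collision has `v_x > V s`, behind it `v_x < V s`; since `V s > 0`, the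
identity `v² - (2 V s - v)² = 4 V s (v - V s)` fixes the sign of the change. The later base
collision time `T` is carried through the induction because `NoEscape` concerns a whole passage
between base collisions, which may contain lateral reflections. -/
theorem Model.History.sq_compare {M : Model d} (hR : 0 < M.R) {V : ℝ → ℝ}
    (hV : ContinuousOn V (Ici 0)) (hpos : ∀ t, 0 ≤ t → 0 < V t) (hesc : M.NoEscape V) {t : ℝ}
    {x v v₀ : Vect d} (H : M.History V t x v v₀) :
    ∀ T, t ≤ T → x.1 + (T - t) * v.1 = position V T →
      ((∀ᶠ τ in 𝓝[<] t, M.Inside V τ (x - (t - τ) • v)) → v₀.1 ^ 2 ≤ v.1 ^ 2) ∧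
      ((∀ᶠ τ in 𝓝[<] t, M.Outside V τ (x - (t - τ) • v)) → v.1 ^ 2 ≤ v₀.1 ^ 2) := by
  have hdich : ∀ {t s s' T : ℝ} {x v : Vect d}, 0 ≤ s' → s' ≤ s → s < t → t ≤ T →
      (∀ τ ∈ Ioo s t, x - (t - τ) • v ∉ M.body V τ) →
      x.1 - (t - s') * v.1 = position V s' → x.1 + (T - t) * v.1 = position V T →
      ((∀ᶠ τ in 𝓝[<] t, M.Inside V τ (x - (t - τ) • v)) →
        ∀ τ ∈ Ioo s t, M.Inside V τ (x - (t - τ) • v)) ∧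
      ((∀ᶠ τ in 𝓝[<] t, M.Outside V τ (x - (t - τ) • v)) →
        ∀ τ ∈ Ioo s t, M.Outside V τ (x - (t - τ) • v)) := by
    intro t s s' T x v hs' hss hst htT hfree hXs hXT
    have hlow : ∀ τ ∈ Ioo s t, (x - (t - τ) • v).1 - position V τ < M.h := by
      intro τ hτ
      have := hesc s' T v.1 hs' (hss.trans_lt (hst.trans_le htT))
        (by rw [← hXs, ← hXT]; ring) τ ⟨hss.trans hτ.1.le, hτ.2.le.trans htT⟩
      rw [← hXs] at this
      simp only [Prod.fst_sub, Prod.smul_fst, smul_eq_mul]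
      linarith
    have hboth : ∀ {P Q : ℝ → Prop}, (∀ τ, ¬ (P τ ∧ Q τ)) → (∀ᶠ τ in 𝓝[<] t, P τ) →
        ¬ ∀ τ ∈ Ioo s t, Q τ := by
      intro P Q hPQ hP hQ
      obtain ⟨τ, h1, h2⟩ := (hP.and (Ioo_mem_nhdsLT hst)).exists
      exact hPQ τ ⟨h1, hQ τ h2⟩
    have hne : ∀ τ, ¬ (M.Inside V τ (x - (t - τ) • v) ∧ M.Outside V τ (x - (t - τ) • v)) := by
      rintro τ ⟨hi, ho | ho⟩
      · exact lt_asymm ho hi.1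
      · exact lt_asymm ho hi.2
    rcases M.inside_or_outside hV (hs'.trans hss) hfree hlow with h | h
    · exact ⟨fun _ => h, fun h' => absurd h (hboth (fun τ hτ => hne τ hτ.symm) h')⟩
    · exact ⟨fun h' => absurd h (hboth hne h'), fun _ => h⟩
  induction H with
  | free => exact fun _ _ _ => ⟨fun _ => le_rfl, fun _ => le_rfl⟩
  | base t s x v v₀ hs hst hfree hhit hprev ih =>
    intro T htT hXT
    have hXs : x.1 - (t - s) * v.1 = position V s := by simpa using hhit.1.1
    have hR' : ‖(x - (t - s) • v).2‖ < M.R := hhit.2.1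
    obtain ⟨hin, hout⟩ := hdich hs.le le_rfl hst htT hfree hXs hXT
    have ih' := ih s le_rfl (by simpa using hXs)
    have hd := hasDerivAt_relative hV hs x.1 t v.1
    have h0 : x.1 - (t - s) * v.1 - position V s = 0 := by rw [hXs, sub_self]
    have hVs := hpos s hs.le
    refine ⟨fun harr => ?_, fun harr => ?_⟩
    · have h1 : 0 ≤ v.1 - V s := by
        refine deriv_nonneg_of_pos_right hd h0 ?_
        filter_upwards [Ioo_mem_nhdsGT hst] with τ hτ
        have := (hin harr τ hτ).1
        simpa using this
      have h2 : V s < v.1 := lt_of_le_of_ne (by linarith) (Ne.symm hhit.2.2)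
      refine (ih'.1 (M.inside_of_lt hV hs hhit.1.1 hR' ?_)).trans ?_
      · simp only [reflectBase]; linarith
      · simp only [reflectBase]; nlinarith
    · have h1 : v.1 - V s ≤ 0 := by
        refine deriv_nonpos_of_neg_right hd h0 ?_
        have hc : ContinuousAt (fun τ : ℝ => ‖(x - (t - τ) • v).2‖) s := by fun_prop
        filter_upwards [Ioo_mem_nhdsGT hst,
          (hc.eventually (gt_mem_nhds hR')).filter_mono nhdsWithin_le_nhds] with τ hτ hτR
        have := (hout harr τ hτ).resolve_right (not_lt.2 hτR.le)
        simpa using this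
      have h2 : v.1 < V s := lt_of_le_of_ne (by linarith) hhit.2.2
      refine le_trans ?_ (ih'.2 ((behind_of_lt hV hs hhit.1.1 (v := reflectBase (V s) v)
        ?_).mono fun _ => Or.inl))
      · simp only [reflectBase]; nlinarith
      · simp only [reflectBase]; linarith
  | side t s x v v₀ hs hst hfree hhit hprev ih =>
    intro T htT hXT
    -- Without an earlier base collision `v_x` never changed and `NoEscape` says nothing, but then
    -- the claim is an equality.
    rcases hprev.longitudinal with h | ⟨s', hs', hss', hXs⟩
    · have h' : v₀.1 = v.1 := h
      rw [h']
      exact ⟨fun _ => le_rfl, fun _ => le_rfl⟩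
    have hXs' : x.1 - (t - s') * v.1 = position V s' := by
      simp [reflectSide] at hXs
      linarith
    obtain ⟨hin, hout⟩ := hdich hs'.le hss'.le hst htT hfree hXs' hXT
    have hn : ‖(x - (t - s) • v).2‖ = M.R := hhit.1.2.2
    have hx0 : (x - (t - s) • v).2 ≠ 0 := by intro h; rw [h] at hn; simp at hn; linarith
    have hinner := inner_reflectSide hx0 v
    have ih' := ih T (hst.le.trans htT) (by simp [reflectSide]; linarith)
    have hd := hasDerivAt_norm_sq_flight t s x.2 v.2 M.R
    have h0 : ‖x.2 - (t - s) • v.2‖ ^ 2 - M.R ^ 2 = 0 := by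
      have : ‖x.2 - (t - s) • v.2‖ = M.R := hn
      rw [this, sub_self]
    have hne : inner ℝ (x.2 - (t - s) • v.2) v.2 ≠ 0 := by
      rw [real_inner_comm]; exact hhit.2.2
    set z := x - (t - s) • v with hz
    have hd' := hasDerivAt_norm_sq_flight s s z.2 (reflectSide z.2 v).2 M.R
    simp only [sub_self, zero_smul, sub_zero] at hd'
    rw [hinner] at hd'
    refine ⟨fun harr => ih'.1 ?_, fun harr => ih'.2 ?_⟩
    · have h1 : 2 * inner ℝ (x.2 - (t - s) • v.2) v.2 ≤ 0 := by
        refine deriv_nonpos_of_neg_right hd h0 ?_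
        filter_upwards [Ioo_mem_nhdsGT hst] with τ hτ
        have := (hin harr τ hτ).2
        simp only [Prod.snd_sub, Prod.smul_snd] at this
        nlinarith [norm_nonneg (x.2 - (t - τ) • v.2)]
      have h2 : inner ℝ z.2 v.2 < 0 := lt_of_le_of_ne (by simp only [hz, Prod.snd_sub, Prod.smul_snd]; linarith) hne
      have hd2 := hasDerivAt_relative hV hs z.1 s v.1
      have hc : ∀ᶠ τ in 𝓝[<] s, 0 < z.1 - (s - τ) * v.1 - position V τ := by
        refine (hd2.continuousAt.eventually (lt_mem_nhds ?_)).filter_mono nhdsWithin_le_nhds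
        simpa using hhit.2.1
      have hneg := eventually_pos_left hd'.fun_neg (by simp [hn]) (by linarith)
      filter_upwards [hc, hneg] with τ hτ hτ'
      refine ⟨by simpa [reflectSide] using hτ, ?_⟩
      simp only [Prod.snd_sub, Prod.smul_snd]
      exact lt_of_pow_lt_pow_left₀ 2 hR.le (by linarith)
    · have hd2 := hasDerivAt_relative hV hs x.1 t v.1
      have hc : ∀ᶠ τ in 𝓝[>] s, 0 < x.1 - (t - τ) * v.1 - position V τ := by
        refine (hd2.continuousAt.eventually (lt_mem_nhds ?_)).filter_mono nhdsWithin_le_nhds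
        simpa [hz] using hhit.2.1
      have h1 : 0 ≤ 2 * inner ℝ (x.2 - (t - s) • v.2) v.2 := by
        refine deriv_nonneg_of_pos_right hd h0 ?_
        filter_upwards [Ioo_mem_nhdsGT hst, hc] with τ hτ hτc
        have := (hout harr τ hτ).resolve_left (by simp; linarith)
        simp only [Prod.snd_sub, Prod.smul_snd] at this
        nlinarith [norm_nonneg (x.2 - (t - τ) • v.2)]
      have h2 : 0 < inner ℝ z.2 v.2 := lt_of_le_of_ne (by simp only [hz, Prod.snd_sub, Prod.smul_snd]; linarith) hne.symm
      filter_upwards [eventually_pos_left hd' (by simp [hn]) (by linarith)] with τ hτ'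
      right
      simp only [Prod.snd_sub, Prod.smul_snd]
      exact lt_of_pow_lt_pow_left₀ 2 (norm_nonneg _) (by linarith)

/-! ### Construction of histories inside the hollow -/

theorem norm_sq_flight (R τ : ℝ) (x v : Transverse d) :
    ‖v‖ ^ 2 * (‖x - τ • v‖ ^ 2 - R ^ 2) =
      (inner ℝ x v - τ * ‖v‖ ^ 2) ^ 2 - disc R x v := by
  rw [norm_sub_sq_real, inner_smul_right, norm_smul, mul_pow, Real.norm_eq_abs, sq_abs, disc]
  ring

/-- The billiard in the hollow: the last flight before the time `a`. -/
theorem Model.exists_last_flight {M : Model d} (hR : 0 < M.R) {V : ℝ → ℝ} {a : ℝ} (ha : 0 ≤ a)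
    {D c N : ℝ} (hD : 0 < D) (hN : 0 < N) (hc : c = 2 * √D / N) (n : ℕ) :
    ∀ (t : ℝ) (x v : Vect d), a < t → ‖v.2‖ ^ 2 = N → disc M.R x.2 v.2 = D →
      (inner ℝ x.2 v.2 ≤ √D ∧ -√D < inner ℝ x.2 v.2) →
      t - a < (inner ℝ x.2 v.2 + √D) / N + n * c → ¬ Grazing M.R (t - a) x.2 v.2 →
      (∀ τ ∈ Ioo a t, 0 < (x - (t - τ) • v).1 - position V τ ∧
        (x - (t - τ) • v).1 - position V τ < M.h) →
      ∃ t' x' v', a < t' ∧ (∀ v₀, M.History V t' x' v' v₀ → M.History V t x v v₀) ∧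
        v'.1 = v.1 ∧ x'.1 - (t' - a) * v'.1 = x.1 - (t - a) * v.1 ∧ ‖v'.2‖ = ‖v.2‖ ∧
        disc M.R (x' - (t' - a) • v').2 v'.2 = D ∧
        (∀ s, Grazing M.R (a - s) (x' - (t' - a) • v').2 v'.2 ↔ Grazing M.R (t - s) x.2 v.2) ∧
        ‖(x' - (t' - a) • v').2‖ < M.R ∧
        ∀ τ ∈ Ioo a t', x' - (t' - τ) • v' ∉ M.body V τ := by
  have hsq : √D ^ 2 = D := Real.sq_sqrt hD.le
  have hsp : 0 < √D := Real.sqrt_pos.2 hD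
  have hflight : ∀ (t : ℝ) (x v : Vect d), ‖v.2‖ ^ 2 = N → disc M.R x.2 v.2 = D →
      inner ℝ x.2 v.2 ≤ √D → ∀ τ, τ < t → t - τ < (inner ℝ x.2 v.2 + √D) / N →
      ‖(x - (t - τ) • v).2‖ < M.R := by
    intro t x v hvN hxD hb1 τ hτ htime
    simp only [Prod.snd_sub, Prod.smul_snd]
    have h1 := norm_sq_flight M.R (t - τ) x.2 v.2
    rw [hvN, hxD] at h1
    have h2 : (t - τ) * N < inner ℝ x.2 v.2 + √D := by rwa [← lt_div_iff₀ hN]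
    have h3 : 0 < (t - τ) * N := mul_pos (by linarith) hN
    have h4 : (inner ℝ x.2 v.2 - (t - τ) * N) ^ 2 < D := by rw [← hsq]; nlinarith
    have h5 : N * (‖x.2 - (t - τ) • v.2‖ ^ 2 - M.R ^ 2) < 0 := by rw [h1]; linarith
    have h6 := neg_of_mul_neg_right h5 hN.le
    exact lt_of_pow_lt_pow_left₀ 2 hR.le (by linarith)
  have hgf : ∀ (t s r : ℝ) (x v : Vect d),
      Grazing M.R (s - r) (x - (t - s) • v).2 v.2 ↔ Grazing M.R (t - r) x.2 v.2 := by
    intro t s r x v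
    have := grazing_flight M.R (t - r) (s - r) x.2 v.2
    rwa [show t - r - (s - r) = t - s by ring] at this
  have hdisc : ∀ (c : ℝ) (x v : Vect d), disc M.R (x - c • v).2 v.2 = disc M.R x.2 v.2 := by
    intro c x v
    have : (x - c • v).2 = x.2 + (-c) • v.2 := by
      simp only [Prod.snd_sub, Prod.smul_snd]; module
    rw [this, disc_add_smul]
  induction n with
  | zero =>
    intro t x v hat hvN hxD ⟨hb1, hb2⟩ htime hgr hy
    have hflt : ∀ τ, a ≤ τ → τ < t → ‖(x - (t - τ) • v).2‖ < M.R := by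
      intro τ haτ hτ
      refine hflight t x v hvN hxD hb1 τ hτ ?_
      simp only [CharP.cast_eq_zero, zero_mul, add_zero] at htime
      linarith
    refine ⟨t, x, v, hat, fun v₀ h => h, rfl, rfl, rfl, (hdisc _ x v).trans hxD,
      fun s => hgf t a s x v, hflt a le_rfl hat, fun τ hτ => ?_⟩
    exact M.not_mem_body_of_inside_lt (by linarith [(hy τ hτ).1]) (hflt τ hτ.1.le hτ.2)
  | succ n ih =>
    intro t x v hat hvN hxD ⟨hb1, hb2⟩ htime hgr hy
    by_cases hshort : t - a < (inner ℝ x.2 v.2 + √D) / N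
    · have hflt : ∀ τ, a ≤ τ → τ < t → ‖(x - (t - τ) • v).2‖ < M.R := fun τ haτ hτ =>
        hflight t x v hvN hxD hb1 τ hτ (by linarith)
      refine ⟨t, x, v, hat, fun v₀ h => h, rfl, rfl, rfl, (hdisc _ x v).trans hxD,
        fun s => hgf t a s x v, hflt a le_rfl hat, fun τ hτ => ?_⟩
      exact M.not_mem_body_of_inside_lt (by linarith [(hy τ hτ).1]) (hflt τ hτ.1.le hτ.2)
    set b := inner ℝ x.2 v.2 with hb
    have hfl : 0 < (b + √D) / N := div_pos (by linarith) hN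
    obtain ⟨s, hs⟩ : ∃ s, s = t - (b + √D) / N := ⟨_, rfl⟩
    have hts : t - s = (b + √D) / N := by rw [hs]; ring
    have has : a < s := by
      -- If the lateral impact fell exactly at time `a`, `⟪x, v⟫` would have dropped to `-√D`, the
      -- odd multiple with `k = -1`.
      refine lt_of_le_of_ne (by linarith [not_lt.1 hshort]) fun h => hgr ⟨-1, ?_⟩
      rw [hvN, hxD, h, hts, div_mul_cancel₀ _ hN.ne']
      push_cast; ring
    have hst : s < t := by linarith
    obtain ⟨z, hz⟩ : ∃ z, z = x - (t - s) • v := ⟨_, rfl⟩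
    have hzv : inner ℝ z.2 v.2 = -√D := by
      rw [hz]
      simp only [Prod.snd_sub, Prod.smul_snd]
      rw [inner_sub_left, inner_smul_left, real_inner_self_eq_norm_sq, hvN, conj_trivial, hts,
        div_mul_cancel₀ _ hN.ne']
      ring
    have hzR : ‖z.2‖ = M.R := by
      have h1 := norm_sq_flight M.R (t - s) x.2 v.2
      rw [hvN, hxD, hts, div_mul_cancel₀ _ hN.ne', ← hts] at h1
      have h2 : N * (‖z.2‖ ^ 2 - M.R ^ 2) = 0 := by
        rw [hz]
        simp only [Prod.snd_sub, Prod.smul_snd]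
        rw [h1, ← hb]; linear_combination hsq
      have h3 := (mul_eq_zero.1 h2).resolve_left hN.ne'
      exact (sq_eq_sq₀ (norm_nonneg _) hR.le).1 (by linarith)
    have hz0 : z.2 ≠ 0 := by intro h; rw [h] at hzR; simp at hzR; linarith
    have hyz := hy s ⟨has, hst⟩
    rw [← hz] at hyz
    have hz1 : z.1 = x.1 - (t - s) * v.1 := by rw [hz]; simp
    obtain ⟨t', x', v', hat', hH, hv1, hx1, hvn, hd', hg', hxR, hfree⟩ := ih s z (reflectSide z.2 v)
      has (by rw [norm_reflectSide, hvN])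
      (by rw [disc_reflectSide hR hzR, hz, hdisc, hxD])
      (by rw [inner_reflectSide hz0, hzv, neg_neg]; exact ⟨le_rfl, by linarith⟩)
      (by
        rw [inner_reflectSide hz0, hzv, neg_neg]
        -- After the reflection `⟪x, v⟫ = √D`, so the next backward flight is a full chord and uses
        -- up one of the `n` remaining durations `c`.
        have : (√D + √D) / N = c := by rw [hc]; ring
        rw [this]
        push_cast at htime
        linarith)
      (by rw [grazing_reflectSide_iff hR hzR, hz, hgf]; exact hgr)
      (fun τ hτ => by
        have h := hy τ ⟨hτ.1, hτ.2.trans hst⟩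
        have e : (z - (s - τ) • reflectSide z.2 v).1 = (x - (t - τ) • v).1 := by
          simp only [reflectSide, Prod.fst_sub, Prod.smul_fst, smul_eq_mul, hz1]; ring
        rwa [e])
    refine ⟨t', x', v', hat', fun v₀ h => ?_, hv1, ?_, hvn.trans (norm_reflectSide _ _), hd',
      fun r => ?_, hxR, hfree⟩
    · refine .side t s x v v₀ (ha.trans_lt has) hst (fun τ hτ => ?_) ?_ ?_
      · exact M.not_mem_body_of_inside_lt (by linarith [(hy τ ⟨has.trans hτ.1, hτ.2⟩).1])
          (hflight t x v hvN hxD hb1 τ hτ.2 (by linarith [hτ.1]))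
      · rw [← hz]
        refine ⟨⟨hyz.1.le, hyz.2.le, hzR⟩, hyz.1, ?_⟩
        rw [real_inner_comm, hzv]
        exact (neg_lt_zero.2 hsp).ne
      · rw [← hz]
        exact hH v₀ h
    · rw [hx1, hz1]
      simp only [reflectSide]
      ring
    · rw [hg', grazing_reflectSide_iff hR hzR, hz, hgf]

/-- Inside the ball `√disc` strictly exceeds `|⟪x, v⟫|`, so chords have positive duration and
finitely many of them cover the time down to `a`. -/
theorem Model.exists_last_flight_of_lt {M : Model d} (hR : 0 < M.R) {V : ℝ → ℝ} {a t : ℝ}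
    (ha : 0 ≤ a) (hat : a < t) {x v : Vect d} (hx : ‖x.2‖ < M.R) (hv : v.2 ≠ 0)
    (hgr : ¬ Grazing M.R (t - a) x.2 v.2)
    (hy : ∀ τ ∈ Ioo a t, 0 < x.1 - (t - τ) * v.1 - position V τ ∧
      x.1 - (t - τ) * v.1 - position V τ < M.h) :
    ∃ t' x' v', a < t' ∧ (∀ v₀, M.History V t' x' v' v₀ → M.History V t x v v₀) ∧
      v'.1 = v.1 ∧ x'.1 - (t' - a) * v'.1 = x.1 - (t - a) * v.1 ∧ ‖v'.2‖ = ‖v.2‖ ∧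
      (∀ s, Grazing M.R (a - s) (x' - (t' - a) • v').2 v'.2 ↔ Grazing M.R (t - s) x.2 v.2) ∧
      ‖(x' - (t' - a) • v').2‖ < M.R ∧
      ∀ τ ∈ Ioo a t', x' - (t' - τ) • v' ∉ M.body V τ := by
  have hN : 0 < ‖v.2‖ ^ 2 := by positivity
  have h1 : 0 < ‖v.2‖ ^ 2 * (M.R ^ 2 - ‖x.2‖ ^ 2) :=
    mul_pos hN (by nlinarith [norm_nonneg x.2])
  have hD : 0 < disc M.R x.2 v.2 := by
    unfold disc; nlinarith [sq_nonneg (inner ℝ x.2 v.2)]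
  have hb : |inner ℝ x.2 v.2| < √(disc M.R x.2 v.2) := by
    rw [← Real.sqrt_sq_eq_abs]
    exact Real.sqrt_lt_sqrt (sq_nonneg _) (by unfold disc; linarith)
  rw [abs_lt] at hb
  set c := 2 * √(disc M.R x.2 v.2) / ‖v.2‖ ^ 2 with hc
  have hcpos : 0 < c := by have := Real.sqrt_pos.2 hD; positivity
  obtain ⟨n, hn⟩ := exists_nat_gt ((t - a) / c)
  rw [div_lt_iff₀ hcpos] at hn
  have hfl : 0 < (inner ℝ x.2 v.2 + √(disc M.R x.2 v.2)) / ‖v.2‖ ^ 2 :=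
    div_pos (by linarith) hN
  obtain ⟨t', x', v', h1, h2, h3, h4, h5, -, h6, h7, h8⟩ :=
    M.exists_last_flight hR ha hD hN hc n t x v hat rfl rfl ⟨hb.2.le, hb.1⟩ (by linarith) hgr
      (by simpa using hy)
  exact ⟨t', x', v', h1, h2, h3, h4, h5, h6, h7, h8⟩

/-- A particle that hits the front of the base exactly twice, without leaving the hollow. -/
theorem Model.exists_history_of_recollision {M : Model d} (hR : 0 < M.R) {V : ℝ → ℝ} {s t : ℝ}
    (hs : 0 < s) (hst : s < t) {x : Transverse d} {v : Vect d} (hx : ‖x‖ < M.R) (hv : v.2 ≠ 0)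
    (hXs : position V t - (t - s) * v.1 = position V s) (hVs : v.1 ≠ V s)
    (hgr : ¬ Grazing M.R (t - s) x v.2) (hgr₀ : ¬ Grazing M.R t x v.2)
    (hy : ∀ τ ∈ Ioo s t, 0 < position V t - (t - τ) * v.1 - position V τ ∧
      position V t - (t - τ) * v.1 - position V τ < M.h)
    (hy₀ : ∀ τ ∈ Ioo 0 s, 0 < position V s - (s - τ) * (2 * V s - v.1) - position V τ ∧
      position V s - (s - τ) * (2 * V s - v.1) - position V τ < M.h) :
    ∃ v₀, M.History V t (position V t, x) v v₀ ∧ v₀.1 = 2 * V s - v.1 := by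
  obtain ⟨t', x', v', hst', hH, hv1, hx1, hvn, hg, hxR, hfree⟩ :=
    M.exists_last_flight_of_lt hR hs.le hst (x := (position V t, x)) hx hv hgr hy
  have hv' : v'.2 ≠ 0 := by rw [← norm_ne_zero_iff, hvn]; exact norm_ne_zero_iff.2 hv
  have hz1 : (x' - (t' - s) • v').1 = position V s := by
    simpa [hXs] using hx1
  obtain ⟨z, hz⟩ : ∃ z, z = x' - (t' - s) • v' := ⟨_, rfl⟩
  rw [← hz] at hg hxR hz1
  -- Grazing at time `0` is invariant along the billiard, and the base reflection leaves the
  -- transverse velocity alone; hence `hgr₀` also excludes it for the flight before `s`.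
  have hg0 := hg 0
  simp only [sub_zero] at hg0
  obtain ⟨t'', x'', v'', hst'', hH', hw1, -, -, -, -, hfree'⟩ :=
    M.exists_last_flight_of_lt hR le_rfl hs (x := z) (v := reflectBase (V s) v') hxR hv'
      (by simpa [reflectBase, hg0] using hgr₀)
      (by simpa [reflectBase, hz1, hv1] using hy₀)
  refine ⟨v'', hH _ (.base t' s x' v' v'' hs hst' hfree ?_ ?_), ?_⟩
  · rw [← hz]
    exact ⟨⟨hz1, hxR.le⟩, hxR, hv1 ▸ hVs⟩
  · rw [← hz]
    exact hH' _ (.free t'' x'' v'' hst''.le hfree')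
  · rw [hw1]; simp [reflectBase, hv1]

/-! ### The force -/

/-- The normalization of the Maxwell–Boltzmann density. -/
def Model.amplitude (M : Model d) : ℝ := M.ρ * (M.β / Real.pi) ^ ((d : ℝ) / 2)

theorem Model.f₀_eq (M : Model d) (v : Vect d) :
    M.f₀ v = M.amplitude * (Real.exp (-M.β * v.1 ^ 2) * Real.exp (-M.β * ‖v.2‖ ^ 2)) := by
  rw [Model.f₀, Model.amplitude, ← Real.exp_add]
  congr 2; ring

theorem Model.amplitude_pos (M : Model d) (hρ : 0 < M.ρ) (hβ : 0 < M.β) : 0 < M.amplitude := by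
  unfold Model.amplitude; positivity

theorem Model.A_eq (M : Model d) : M.A = 2 * (M.amplitude *
    (volume.real (Metric.closedBall (0 : Transverse d) M.R) *
      ∫ w : Transverse d, Real.exp (-M.β * ‖w‖ ^ 2))) := by
  rw [Model.A, Model.amplitude]; ring

theorem Model.front_eq (M : Model d) (W : ℝ) :
    M.front W = Metric.closedBall 0 M.R ×ˢ (Iio W ×ˢ univ) := by
  ext p; simp [Model.front]

theorem Model.back_eq (M : Model d) (W : ℝ) :
    M.back W = Metric.closedBall 0 M.R ×ˢ (Ioi W ×ˢ univ) := by
  ext p; simp [Model.back]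

theorem setIntegral_slab (M : Model d) (S : Set ℝ) (g : ℝ → ℝ) :
    ∫ p in (Metric.closedBall (0 : Transverse d) M.R) ×ˢ (S ×ˢ (univ : Set (Transverse d))),
        g p.2.1 * Real.exp (-M.β * ‖p.2.2‖ ^ 2) =
      volume.real (Metric.closedBall (0 : Transverse d) M.R) *
        ((∫ u in S, g u) * ∫ w : Transverse d, Real.exp (-M.β * ‖w‖ ^ 2)) := by
  have h1 := setIntegral_prod_mul (μ := (volume : Measure (Transverse d)))
    (ν := (volume : Measure (Vect d))) (fun _ => (1 : ℝ))
    (fun q : Vect d => g q.1 * Real.exp (-M.β * ‖q.2‖ ^ 2)) (Metric.closedBall 0 M.R)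
    (S ×ˢ (univ : Set (Transverse d)))
  have h2 := setIntegral_prod_mul (μ := (volume : Measure ℝ))
    (ν := (volume : Measure (Transverse d))) g
    (fun w : Transverse d => Real.exp (-M.β * ‖w‖ ^ 2)) S univ
  simp only [one_mul] at h1
  have h3 : ∫ q : Vect d in S ×ˢ (univ : Set (Transverse d)), g q.1 * Real.exp (-M.β * ‖q.2‖ ^ 2) =
      (∫ u in S, g u) * ∫ w : Transverse d, Real.exp (-M.β * ‖w‖ ^ 2) := by
    rw [Measure.restrict_univ] at h2
    exact h2
  rw [h3] at h1
  rw [show (∫ _ in Metric.closedBall (0 : Transverse d) M.R, (1 : ℝ)) =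
    volume.real (Metric.closedBall (0 : Transverse d) M.R) by simp] at h1
  exact h1

theorem integrableOn_slab (M : Model d) (hβ : 0 < M.β) {S : Set ℝ} {g : ℝ → ℝ}
    (hg : IntegrableOn g S) :
    IntegrableOn (fun p : Transverse d × Vect d => g p.2.1 * Real.exp (-M.β * ‖p.2.2‖ ^ 2))
      ((Metric.closedBall (0 : Transverse d) M.R) ×ˢ (S ×ˢ (univ : Set (Transverse d)))) := by
  have h1 : Integrable (fun q : Vect d => g q.1 * Real.exp (-M.β * ‖q.2‖ ^ 2))
      ((volume.restrict S).prod (volume.restrict univ)) := by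
    rw [Measure.restrict_univ]
    exact Integrable.mul_prod hg (integrable_gaussian_transverse hβ)
  rw [Measure.prod_restrict] at h1
  have h0 : Integrable (fun _ : Transverse d => (1 : ℝ))
      (volume.restrict (Metric.closedBall (0 : Transverse d) M.R)) :=
    integrableOn_const measure_closedBall_lt_top.ne
  have h2 := Integrable.mul_prod h0 h1
  rw [Measure.prod_restrict] at h2
  simp only [one_mul] at h2
  exact h2

theorem Model.F₀_eq_integral (M : Model d) (W : ℝ) :
    M.F₀ W = 2 * (∫ p in M.front W, (p.2.1 - W) ^ 2 * M.f₀ p.2) -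
      2 * ∫ p in M.back W, (p.2.1 - W) ^ 2 * M.f₀ p.2 := by
  have h : ∀ p : Transverse d × Vect d, (p.2.1 - W) ^ 2 * M.f₀ p.2 = M.amplitude *
      (((p.2.1 - W) ^ 2 * Real.exp (-M.β * p.2.1 ^ 2)) * Real.exp (-M.β * ‖p.2.2‖ ^ 2)) := by
    intro p; rw [M.f₀_eq]; ring
  simp only [h, integral_const_mul, M.front_eq, M.back_eq]
  rw [setIntegral_slab M (Iio W) (fun u => (u - W) ^ 2 * Real.exp (-M.β * u ^ 2)),
    setIntegral_slab M (Ioi W) (fun u => (u - W) ^ 2 * Real.exp (-M.β * u ^ 2)), Model.F₀,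
    integral_Ici_eq_integral_Ioi, M.A_eq]
  ring

theorem Model.integrableOn_equilibrium (M : Model d) (hβ : 0 < M.β) (W : ℝ) (S : Set ℝ) :
    IntegrableOn (fun p : Transverse d × Vect d => (p.2.1 - W) ^ 2 * M.f₀ p.2)
      ((Metric.closedBall (0 : Transverse d) M.R) ×ˢ (S ×ˢ (univ : Set (Transverse d)))) := by
  have h : ∀ p : Transverse d × Vect d, (p.2.1 - W) ^ 2 * M.f₀ p.2 = M.amplitude *
      (((p.2.1 - W) ^ 2 * Real.exp (-M.β * p.2.1 ^ 2)) * Real.exp (-M.β * ‖p.2.2‖ ^ 2)) := by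
    intro p; rw [M.f₀_eq]; ring
  simp only [h]
  exact (integrableOn_slab M hβ (integrable_sq_gaussian hβ W).integrableOn).const_mul M.amplitude

/-- The contribution of a particle to the difference between the force and the friction without
recollisions. -/
def Model.excess (M : Model d) (V : ℝ → ℝ) (f : ℝ → Vect d → Vect d → ℝ) (t : ℝ)
    (p : Transverse d × Vect d) : ℝ :=
  (p.2.1 - V t) ^ 2 * (traceBefore f t (position V t, p.1) p.2 - M.f₀ p.2)

theorem Model.integrableOn_excess {M : Model d} (hβ : 0 < M.β) {V : ℝ → ℝ}
    {f : ℝ → Vect d → Vect d → ℝ} {t : ℝ}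
    (h : IntegrableOn (pressure V f t) (M.front (V t)) ∧
      IntegrableOn (pressure V f t) (M.back (V t))) :
    IntegrableOn (M.excess V f t) (M.front (V t)) ∧
      IntegrableOn (M.excess V f t) (M.back (V t)) := by
  have e : M.excess V f t = fun p => pressure V f t p - (p.2.1 - V t) ^ 2 * M.f₀ p.2 := by
    ext p; rw [Model.excess, pressure]; ring
  rw [e]
  refine ⟨h.1.sub ?_, h.2.sub ?_⟩
  · rw [M.front_eq]; exact M.integrableOn_equilibrium hβ _ _
  · rw [M.back_eq]; exact M.integrableOn_equilibrium hβ _ _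

theorem Model.force_sub_F₀ {M : Model d} (hβ : 0 < M.β) {V : ℝ → ℝ}
    {f : ℝ → Vect d → Vect d → ℝ} {t : ℝ}
    (h : IntegrableOn (pressure V f t) (M.front (V t)) ∧
      IntegrableOn (pressure V f t) (M.back (V t))) :
    M.force V f t - M.F₀ (V t) = 2 * (∫ p in M.front (V t), M.excess V f t p) -
      2 * ∫ p in M.back (V t), M.excess V f t p := by
  have e : M.excess V f t = fun p => pressure V f t p - (p.2.1 - V t) ^ 2 * M.f₀ p.2 := by
    ext p; rw [Model.excess, pressure]; ring
  rw [e, integral_sub h.1, integral_sub h.2, Model.force, M.F₀_eq_integral]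
  · ring
  · rw [M.back_eq]; exact M.integrableOn_equilibrium hβ _ _
  · rw [M.front_eq]; exact M.integrableOn_equilibrium hβ _ _

theorem Model.measurableSet_front (M : Model d) (W : ℝ) : MeasurableSet (M.front W) := by
  rw [M.front_eq]
  exact Metric.isClosed_closedBall.measurableSet.prod (measurableSet_Iio.prod MeasurableSet.univ)

theorem Model.measurableSet_back (M : Model d) (W : ℝ) : MeasurableSet (M.back W) := by
  rw [M.back_eq]
  exact Metric.isClosed_closedBall.measurableSet.prod (measurableSet_Ioi.prod MeasurableSet.univ)

/-- The set of times at which the force is given by the backward evolution of almost every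
particle. -/
def Model.GoodTime (M : Model d) (V : ℝ → ℝ) (f : ℝ → Vect d → Vect d → ℝ) (t : ℝ) : Prop :=
  (IntegrableOn (pressure V f t) (M.front (V t)) ∧
      IntegrableOn (pressure V f t) (M.back (V t))) ∧
    ∀ᵐ p : Transverse d × Vect d, ‖p.1‖ ≤ M.R → ‖p.1‖ < M.R ∧ p.2.1 ≠ V t ∧
      (¬ M.Regular V t (position V t, p.1) p.2 →
        traceBefore f t (position V t, p.1) p.2 = M.f₀ p.2) ∧
      (∀ v₀, M.History V t (position V t, p.1) p.2 v₀ →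
        traceBefore f t (position V t, p.1) p.2 = M.f₀ v₀)

theorem Model.IsSolution.ae_goodTime {M : Model d} (hd : 2 ≤ d) (hR : 0 < M.R) {V₀ : ℝ} {V : ℝ → ℝ}
    (hV : ContinuousOn V (Ici 0)) {f : ℝ → Vect d → Vect d → ℝ} (hs : M.IsSolution V₀ V f) :
    ∀ᵐ t : ℝ, 0 < t → M.GoodTime V f t := by
  filter_upwards [(ae_restrict_iff' measurableSet_Ioi).1 hs.integrable,
    hs.gas.ae_trace hd hR hV] with t h1 h2 ht
  exact ⟨h1 ht, h2 ht⟩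

/-- Only particles whose velocity is a mean velocity of the body contribute to the excess. -/
theorem Model.GoodTime.abs_force_sub_le {M : Model d} (hρ : 0 < M.ρ) (hβ : 0 < M.β)
    {V : ℝ → ℝ} {f : ℝ → Vect d → Vect d → ℝ} {t δ : ℝ}
    (ht : M.GoodTime V f t) (hδ : 0 ≤ δ)
    (hmean : ∀ s u, 0 < s → s < t → position V t - position V s = u * (t - s) → |u - V t| ≤ δ) :
    |M.force V f t - M.F₀ (V t)| ≤ 4 * M.A * δ ^ 3 := by
  have ha := M.amplitude_pos hρ hβ
  -- `δ²` bounds `(u - V t)²` and the interval of velocities has length `2δ`; this produces the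
  -- cube.
  set g : ℝ → ℝ := (Icc (V t - δ) (V t + δ)).indicator fun _ => M.amplitude * δ ^ 2 with hg
  have hgi : Integrable g :=
    (integrable_indicator_iff measurableSet_Icc).2 (integrableOn_const (by simp))
  have hgnn : ∀ u, 0 ≤ g u := fun u => indicator_nonneg (fun _ _ => by positivity) u
  have hgint : ∫ u, g u = 2 * M.amplitude * δ ^ 3 := by
    rw [hg, integral_indicator measurableSet_Icc]
    simp only [integral_const, measureReal_restrict_apply_univ, Real.volume_real_Icc, smul_eq_mul]
    rw [max_eq_left (by linarith)]; ring
  have hexp : ∀ v : Vect d, M.f₀ v ∈ Icc 0 (M.amplitude * Real.exp (-M.β * ‖v.2‖ ^ 2)) := by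
    intro v
    rw [M.f₀_eq]
    refine ⟨by positivity, ?_⟩
    refine mul_le_mul_of_nonneg_left (mul_le_of_le_one_left (Real.exp_pos _).le ?_) ha.le
    rw [Real.exp_le_one_iff]; nlinarith [sq_nonneg v.1]
  have hbound : ∀ᵐ p : Transverse d × Vect d, ‖p.1‖ ≤ M.R →
      ‖M.excess V f t p‖ ≤ g p.2.1 * Real.exp (-M.β * ‖p.2.2‖ ^ 2) := by
    filter_upwards [ht.2] with p hp hpR
    obtain ⟨hlt, hne, hnr, hH⟩ := hp hpR
    by_cases hreg : M.Regular V t (position V t, p.1) p.2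
    · obtain ⟨v₀, H⟩ := hreg
      rw [Model.excess, hH v₀ H]
      have hn := H.norm_transverse
      rcases H.longitudinal with h | ⟨s, hs, hst, hX⟩
      · have : M.f₀ v₀ = M.f₀ p.2 := by rw [M.f₀_eq, M.f₀_eq, h, hn]
        rw [this, sub_self, mul_zero, norm_zero]
        exact mul_nonneg (hgnn _) (Real.exp_pos _).le
      · have hu := hmean s p.2.1 hs hst (by simp only at hX; linarith)
        have hmem : p.2.1 ∈ Icc (V t - δ) (V t + δ) := by
          rw [abs_le] at hu; exact ⟨by linarith [hu.1], by linarith [hu.2]⟩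
        rw [hg, indicator_of_mem hmem, norm_mul, Real.norm_eq_abs, Real.norm_eq_abs,
          abs_of_nonneg (sq_nonneg _)]
        have h1 := hexp v₀
        have h2 := hexp p.2
        rw [hn] at h1
        have h3 : |M.f₀ v₀ - M.f₀ p.2| ≤ M.amplitude * Real.exp (-M.β * ‖p.2.2‖ ^ 2) :=
          abs_le.2 ⟨by linarith [h1.1, h2.2], by linarith [h1.2, h2.1]⟩
        have h4 : (p.2.1 - V t) ^ 2 ≤ δ ^ 2 := by rw [← sq_abs]; gcongr
        calc _ ≤ δ ^ 2 * (M.amplitude * Real.exp (-M.β * ‖p.2.2‖ ^ 2)) :=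
              mul_le_mul h4 h3 (abs_nonneg _) (sq_nonneg _)
          _ = _ := by ring
    · rw [Model.excess, hnr hreg, sub_self, mul_zero, norm_zero]
      exact mul_nonneg (hgnn _) (Real.exp_pos _).le
  have hslab : ∀ S : Set ℝ, MeasurableSet S →
      |∫ p in (Metric.closedBall (0 : Transverse d) M.R) ×ˢ (S ×ˢ (univ : Set (Transverse d))),
        M.excess V f t p| ≤ M.A * δ ^ 3 := by
    intro S hS
    have hms : MeasurableSet
        ((Metric.closedBall (0 : Transverse d) M.R) ×ˢ (S ×ˢ (univ : Set (Transverse d)))) :=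
      Metric.isClosed_closedBall.measurableSet.prod (hS.prod MeasurableSet.univ)
    refine (norm_integral_le_of_norm_le (integrableOn_slab M hβ hgi.integrableOn)
      ((ae_restrict_iff' hms).2 (hbound.mono fun p hp hm => hp (by simpa using hm.1)))).trans ?_
    rw [setIntegral_slab M S g, M.A_eq]
    have h1 : ∫ u in S, g u ≤ 2 * M.amplitude * δ ^ 3 :=
      (setIntegral_le_integral hgi (ae_of_all _ hgnn)).trans hgint.le
    have h2 := (gaussian_transverse_pos (d := d) hβ).le
    calc _ ≤ volume.real (Metric.closedBall (0 : Transverse d) M.R) *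
          ((2 * M.amplitude * δ ^ 3) * ∫ w : Transverse d, Real.exp (-M.β * ‖w‖ ^ 2)) := by gcongr
      _ = _ := by ring
  rw [M.force_sub_F₀ hβ ht.1, M.front_eq, M.back_eq]
  have h1 := abs_le.1 (hslab (Iio (V t)) measurableSet_Iio)
  have h2 := abs_le.1 (hslab (Ioi (V t)) measurableSet_Ioi)
  exact abs_le.2 ⟨by linarith [h1.1, h2.2], by linarith [h1.2, h2.1]⟩

theorem Model.f₀_le_f₀ {M : Model d} (hρ : 0 < M.ρ) (hβ : 0 < M.β) {v w : Vect d}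
    (h1 : w.1 ^ 2 ≤ v.1 ^ 2) (h2 : ‖w.2‖ = ‖v.2‖) : M.f₀ v ≤ M.f₀ w := by
  have ha := M.amplitude_pos hρ hβ
  rw [M.f₀_eq, M.f₀_eq, h2]
  have : -M.β * v.1 ^ 2 ≤ -M.β * w.1 ^ 2 := by nlinarith
  gcongr

/-- Particles slower than the base arrive from inside the hollow, faster ones from behind;
`sq_compare` then orders the longitudinal energies, and the transverse speed is conserved. -/
theorem Model.GoodTime.excess_sign {M : Model d} (hR : 0 < M.R) (hρ : 0 < M.ρ) (hβ : 0 < M.β)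
    {V : ℝ → ℝ} (hV : ContinuousOn V (Ici 0)) (hpos : ∀ t, 0 ≤ t → 0 < V t) (hesc : M.NoEscape V)
    {f : ℝ → Vect d → Vect d → ℝ} {t : ℝ} (ht0 : 0 < t) (ht : M.GoodTime V f t) :
    ∀ᵐ p : Transverse d × Vect d, (p ∈ M.front (V t) → 0 ≤ M.excess V f t p) ∧
      (p ∈ M.back (V t) → M.excess V f t p ≤ 0) := by
  filter_upwards [ht.2] with p hp
  by_cases hpR : ‖p.1‖ ≤ M.R
  swap
  · exact ⟨fun h => absurd h.1 hpR, fun h => absurd h.1 hpR⟩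
  obtain ⟨hlt, hne, hnr, hH⟩ := hp hpR
  rw [Model.excess]
  by_cases hreg : M.Regular V t (position V t, p.1) p.2
  · obtain ⟨v₀, H⟩ := hreg
    rw [hH v₀ H]
    obtain ⟨h1, h2⟩ := H.sq_compare hR hV hpos hesc t le_rfl (by simp)
    refine ⟨fun h => mul_nonneg (sq_nonneg _) (sub_nonneg.2 ?_),
      fun h => mul_nonpos_of_nonneg_of_nonpos (sq_nonneg _) (sub_nonpos.2 ?_)⟩
    · exact M.f₀_le_f₀ hρ hβ (h1 (M.inside_of_lt hV ht0 rfl hlt h.2)) H.norm_transverse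
    · refine M.f₀_le_f₀ hρ hβ (h2 ?_) H.norm_transverse.symm
      exact (behind_of_lt hV ht0 rfl h.2).mono fun _ => Or.inl
  · rw [hnr hreg, sub_self, mul_zero]
    exact ⟨fun _ => le_rfl, fun _ => le_rfl⟩

/-- The excess of the force is at least the contribution of any set of particles that hit the
front of the base. -/
theorem Model.GoodTime.le_force_sub {M : Model d} (hR : 0 < M.R) (hρ : 0 < M.ρ) (hβ : 0 < M.β)
    {V : ℝ → ℝ} (hV : ContinuousOn V (Ici 0)) (hpos : ∀ t, 0 ≤ t → 0 < V t) (hesc : M.NoEscape V)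
    {f : ℝ → Vect d → Vect d → ℝ} {t : ℝ} (ht0 : 0 < t) (ht : M.GoodTime V f t)
    {G : Set (Transverse d × Vect d)} (hG : G ⊆ M.front (V t)) :
    2 * ∫ p in G, M.excess V f t p ≤ M.force V f t - M.F₀ (V t) := by
  have hs := ht.excess_sign hR hρ hβ hV hpos hesc ht0
  have hi := M.integrableOn_excess hβ ht.1
  rw [M.force_sub_F₀ hβ ht.1]
  have h1 : ∫ p in G, M.excess V f t p ≤ ∫ p in M.front (V t), M.excess V f t p := by
    refine setIntegral_mono_set hi.1 ?_ (Eventually.of_forall fun p hp => hG hp)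
    exact (ae_restrict_iff' (M.measurableSet_front _)).2 (hs.mono fun p hp => hp.1)
  have h2 : ∫ p in M.back (V t), M.excess V f t p ≤ 0 :=
    integral_nonpos_of_ae ((ae_restrict_iff' (M.measurableSet_back _)).2 (hs.mono fun p hp => hp.2))
  linarith

theorem Model.GoodTime.force_sub_nonneg {M : Model d} (hR : 0 < M.R) (hρ : 0 < M.ρ) (hβ : 0 < M.β)
    {V : ℝ → ℝ} (hV : ContinuousOn V (Ici 0)) (hpos : ∀ t, 0 ≤ t → 0 < V t) (hesc : M.NoEscape V)
    {f : ℝ → Vect d → Vect d → ℝ} {t : ℝ} (ht0 : 0 < t) (ht : M.GoodTime V f t) :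
    0 ≤ M.force V f t - M.F₀ (V t) := by
  simpa using ht.le_force_sub hR hρ hβ hV hpos hesc ht0 (empty_subset _)

/-- Lower bound for the excess of the force due to particles that hit the front of the base
exactly twice. -/
theorem Model.GoodTime.force_sub_ge_of_recollision {M : Model d} (hd : 2 ≤ d) (hR : 0 < M.R)
    (hρ : 0 < M.ρ) (hβ : 0 < M.β) {V : ℝ → ℝ} (hV : ContinuousOn V (Ici 0))
    (hpos : ∀ t, 0 ≤ t → 0 < V t) (hesc : M.NoEscape V) {f : ℝ → Vect d → Vect d → ℝ} {t : ℝ}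
    (ht0 : 0 < t) (ht : M.GoodTime V f t) {a κ B u₁ u₂ : ℝ} (ha : 0 ≤ a) (hκ : 0 ≤ κ)
    (hu : u₁ ≤ u₂)
    (hrec : ∀ u ∈ Ioo u₁ u₂, a ≤ V t - u ∧ u < V t ∧ u ^ 2 ≤ B ∧ ∃ s, 0 < s ∧ s < t ∧
      position V t - (t - s) * u = position V s ∧ u ≠ V s ∧ κ ≤ u ^ 2 - (2 * V s - u) ^ 2 ∧
      (∀ τ ∈ Ioo s t, 0 < position V t - (t - τ) * u - position V τ ∧
        position V t - (t - τ) * u - position V τ < M.h) ∧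
      (∀ τ ∈ Ioo 0 s, 0 < position V s - (s - τ) * (2 * V s - u) - position V τ ∧
        position V s - (s - τ) * (2 * V s - u) - position V τ < M.h)) :
    M.A * ((u₂ - u₁) * (a ^ 2 * (M.β * κ * Real.exp (-M.β * B)))) ≤
      M.force V f t - M.F₀ (V t) := by
  have hamp := M.amplitude_pos hρ hβ
  set G : Set (Transverse d × Vect d) :=
    (Metric.closedBall (0 : Transverse d) M.R) ×ˢ (Ioo u₁ u₂ ×ˢ (univ : Set (Transverse d))) with hG
  have hGm : MeasurableSet G :=
    Metric.isClosed_closedBall.measurableSet.prod (measurableSet_Ioo.prod MeasurableSet.univ)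
  have hGs : G ⊆ M.front (V t) := by
    rintro p ⟨h1, h2, -⟩
    exact ⟨by simpa using h1, (hrec _ h2).2.1⟩
  refine le_trans ?_ (ht.le_force_sub hR hρ hβ hV hpos hesc ht0 hGs)
  set q := M.amplitude * (a ^ 2 * (M.β * κ * Real.exp (-M.β * B))) with hq
  have hint : IntegrableOn (fun p : Transverse d × Vect d =>
      q * Real.exp (-M.β * ‖p.2.2‖ ^ 2)) G :=
    integrableOn_slab M hβ (g := fun _ => q) (integrableOn_const (by simp))
  have hle : ∫ p in G, q * Real.exp (-M.β * ‖p.2.2‖ ^ 2) ≤ ∫ p in G, M.excess V f t p := by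
    refine integral_mono_ae hint ((M.integrableOn_excess hβ ht.1).1.mono_set hGs) ?_
    refine (ae_restrict_iff' hGm).2 ?_
    filter_upwards [ht.2, ae_not_grazing hd M.R t, ae_transverse_ne_zero hd,
      ae_not_edge hV hd M.R t] with p hp hgr hne hedge hpG
    obtain ⟨hlt, -, -, hH⟩ := hp (by simpa using hpG.1)
    obtain ⟨h1, h2, h3, s, hs, hst, hX, hVs, h4, hy, hy₀⟩ := hrec _ hpG.2.1
    obtain ⟨v₀, H, hv₀⟩ := M.exists_history_of_recollision hR hs hst hlt hne hX hVs
      (hedge s hs.le hst (by linarith)) hgr hy hy₀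
    rw [Model.excess, hH v₀ H, M.f₀_eq, M.f₀_eq, H.norm_transverse, hv₀]
    set w := 2 * V s - p.2.1 with hw
    set u := p.2.1 with hu'
    -- Factor out `exp (-β u²)` and use `1 + x ≤ exp x` with `x = β (u² - w²) ≥ β κ`.
    have e1 : M.β * κ * Real.exp (-M.β * B) ≤
        Real.exp (-M.β * w ^ 2) - Real.exp (-M.β * u ^ 2) := by
      have e2 : Real.exp (-M.β * w ^ 2) =
          Real.exp (-M.β * u ^ 2) * Real.exp (M.β * (u ^ 2 - w ^ 2)) := by
        rw [← Real.exp_add]; congr 1; ring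
      have e3 := Real.add_one_le_exp (M.β * (u ^ 2 - w ^ 2))
      have e4 : M.β * κ ≤ M.β * (u ^ 2 - w ^ 2) := by gcongr
      have e5 : Real.exp (-M.β * B) ≤ Real.exp (-M.β * u ^ 2) :=
        Real.exp_le_exp.2 (by nlinarith)
      rw [e2]
      calc M.β * κ * Real.exp (-M.β * B) ≤ M.β * κ * Real.exp (-M.β * u ^ 2) := by gcongr
        _ ≤ (Real.exp (M.β * (u ^ 2 - w ^ 2)) - 1) * Real.exp (-M.β * u ^ 2) := by
          gcongr; linarith
        _ = _ := by ring
    have e6 : a ^ 2 ≤ (u - V t) ^ 2 := by nlinarith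
    calc q * Real.exp (-M.β * ‖p.2.2‖ ^ 2)
        = M.amplitude * (a ^ 2 * (M.β * κ * Real.exp (-M.β * B))) *
          Real.exp (-M.β * ‖p.2.2‖ ^ 2) := rfl
      _ ≤ M.amplitude * ((u - V t) ^ 2 *
          (Real.exp (-M.β * w ^ 2) - Real.exp (-M.β * u ^ 2))) *
          Real.exp (-M.β * ‖p.2.2‖ ^ 2) := by gcongr
      _ = _ := by ring
  have hval := setIntegral_slab M (Ioo u₁ u₂) (fun _ => q)
  rw [← hG] at hval
  rw [hval] at hle
  have hconst : ∫ _ in Ioo u₁ u₂, q = (u₂ - u₁) * q := by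
    simp [Real.volume_real_Ioo, max_eq_left (sub_nonneg.2 hu)]
  rw [hconst] at hle
  rw [M.A_eq]
  calc _ = 2 * (volume.real (Metric.closedBall (0 : Transverse d) M.R) *
        ((u₂ - u₁) * q * ∫ w : Transverse d, Real.exp (-M.β * ‖w‖ ^ 2))) := by rw [hq]; ring
    _ ≤ _ := by gcongr

/-! ### Comparison for integral equations -/

/-- After the last time at which `D ≥ 0`, `D` would be negative, where `g ≥ 0` makes it
nondecreasing. The integral form is used because the force is controlled only almost everywhere. -/
theorem nonneg_of_integral_comparison {D g : ℝ → ℝ} {a T : ℝ} (haT : a ≤ T)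
    (hg : IntervalIntegrable g volume a T) (hD : ∀ t ∈ Icc a T, D t = D a + ∫ τ in a..t, g τ)
    (hDa : 0 ≤ D a) (hcmp : ∀ᵐ τ, τ ∈ Ioo a T → D τ < 0 → 0 ≤ g τ) : 0 ≤ D T := by
  by_contra! hneg
  have hcont : ContinuousOn D (Icc a T) := by
    have h := intervalIntegral.continuousOn_primitive_interval' hg left_mem_uIcc
    rw [uIcc_of_le haT] at h
    exact (continuousOn_const.add h).congr hD
  have hcpt : IsCompact (Icc a T ∩ D ⁻¹' Ici 0) := by
    refine isCompact_Icc.of_isClosed_subset ?_ inter_subset_left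
    exact hcont.preimage_isClosed_of_isClosed isClosed_Icc isClosed_Ici
  obtain ⟨s, ⟨hsI, hs0⟩, hmax⟩ := hcpt.exists_isGreatest ⟨a, ⟨le_rfl, haT⟩, hDa⟩
  have hsub : D T = D s + ∫ τ in s..T, g τ := by
    have h1 : IntervalIntegrable g volume a s := hg.mono_set (by
      rw [uIcc_of_le haT, uIcc_of_le hsI.1]; exact Icc_subset_Icc_right hsI.2)
    have h2 : IntervalIntegrable g volume s T := hg.mono_set (by
      rw [uIcc_of_le haT, uIcc_of_le hsI.2]; exact Icc_subset_Icc_left hsI.1)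
    rw [hD T ⟨haT, le_rfl⟩, hD s hsI, ← intervalIntegral.integral_add_adjacent_intervals h1 h2]
    ring
  have hnn : 0 ≤ ∫ τ in s..T, g τ := by
    rw [intervalIntegral.integral_of_le hsI.2, integral_Ioc_eq_integral_Ioo]
    refine setIntegral_nonneg_of_ae_restrict ((ae_restrict_iff' measurableSet_Ioo).2 ?_)
    filter_upwards [hcmp] with τ hτ hτI
    refine hτ ⟨hsI.1.trans_lt hτI.1, hτI.2⟩ ?_
    by_contra! h
    exact absurd (hmax ⟨⟨hsI.1.trans hτI.1.le, hτI.2.le⟩, h⟩) (not_le.2 hτI.1)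
  have : 0 ≤ D s := hs0
  linarith

/-! ### A priori bounds -/

section Solution

variable {M : Model d} {V₀ : ℝ} {V : ℝ → ℝ} {f : ℝ → Vect d → Vect d → ℝ}

theorem Model.IsSolution.intervalIntegrable (hs : M.IsSolution V₀ V f) {a b : ℝ} (ha : 0 ≤ a)
    (hb : 0 ≤ b) : IntervalIntegrable (fun τ => M.E - M.force V f τ) volume a b :=
  (intervalIntegrable_const).sub ((hs.force_integrable a ha).symm.trans (hs.force_integrable b hb))

theorem Model.IsSolution.continuousOn (hs : M.IsSolution V₀ V f) : ContinuousOn V (Ici 0) := by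
  have key : ∀ T, 0 ≤ T → ContinuousOn V (Icc 0 T) := by
    intro T hT
    have h := intervalIntegral.continuousOn_primitive_interval'
      (hs.intervalIntegrable le_rfl hT) left_mem_uIcc
    rw [uIcc_of_le hT] at h
    exact (continuousOn_const.add h).congr fun t ht => hs.motion t ht.1
  intro t (ht : 0 ≤ t)
  have h1 := (key (t + 1) (by linarith)) t ⟨ht, by linarith⟩
  refine h1.mono_of_mem_nhdsWithin ?_
  filter_upwards [self_mem_nhdsWithin, mem_nhdsWithin_of_mem_nhds (Iio_mem_nhds (lt_add_one t))]
    with x hx hx'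
  exact ⟨hx, hx'.le⟩

/-- Comparison of the velocity with a differentiable function `φ`. -/
theorem Model.IsSolution.compare (hs : M.IsSolution V₀ V f) {φ φ' : ℝ → ℝ} {σ a T Vinf : ℝ}
    (ha : 0 ≤ a) (haT : a ≤ T) (hφ : ∀ t ∈ Icc a T, HasDerivAt φ (φ' t) t)
    (hφc : ContinuousOn φ' (Icc a T)) (h0 : σ * (Vinf - V a) ≤ φ a)
    (hcmp : ∀ᵐ τ, τ ∈ Ioo a T → φ τ < σ * (Vinf - V τ) →
      σ * (M.force V f τ - M.E) ≤ φ' τ) :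
    σ * (Vinf - V T) ≤ φ T := by
  have hi := hs.intervalIntegrable ha (ha.trans haT)
  have hφi : IntervalIntegrable φ' volume a T :=
    ContinuousOn.intervalIntegrable (by rwa [uIcc_of_le haT])
  have hV : ∀ t ∈ Icc a T, V t = V a + ∫ τ in a..t, (M.E - M.force V f τ) := by
    intro t ht
    have h0t : 0 ≤ t := ha.trans ht.1
    rw [hs.motion t h0t, hs.motion a ha, ← intervalIntegral.integral_add_adjacent_intervals
      (hs.intervalIntegrable le_rfl ha) (hs.intervalIntegrable ha h0t)]
    ring
  -- The sign `σ = ±1` lets one comparison give upper and lower bounds on `Vinf - V`.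
  have h := nonneg_of_integral_comparison (D := fun t => φ t - σ * (Vinf - V t))
    (g := fun τ => φ' τ + σ * (M.E - M.force V f τ)) haT (hφi.add (hi.const_mul σ)) ?_
    (by simpa using h0) ?_
  · simpa using h
  · intro t ht
    have h1 : IntervalIntegrable φ' volume a t := hφi.mono_set (by
      rw [uIcc_of_le haT, uIcc_of_le ht.1]; exact Icc_subset_Icc_right ht.2)
    have h2 := hs.intervalIntegrable ha (ha.trans ht.1)
    have h3 : ∫ τ in a..t, φ' τ = φ t - φ a := by
      refine intervalIntegral.integral_eq_sub_of_hasDerivAt (fun x hx => ?_) h1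
      rw [uIcc_of_le ht.1] at hx
      exact hφ x ⟨hx.1, hx.2.trans ht.2⟩
    rw [intervalIntegral.integral_add h1 (h2.const_mul σ), h3,
      intervalIntegral.integral_const_mul, hV t ht]
    ring
  · filter_upwards [hcmp] with τ hτ hτI hτn
    have := hτ hτI (by linarith)
    linarith

end Solution

/-! ### Decay of the distance from the limiting velocity -/

/-- The profile that bounds the distance from the limiting velocity. -/
def decay (γ L t : ℝ) : ℝ := γ * L ^ 2 / (L + t) ^ 2

theorem hasDerivAt_decay {γ L t : ℝ} (hL : 0 < L) (ht : 0 ≤ t) :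
    HasDerivAt (decay γ L) (-(2 / (L + t)) * decay γ L t) t := by
  have h0 : L + t ≠ 0 := by positivity
  have h1 : HasDerivAt (fun τ : ℝ => (L + τ) ^ 2) (2 * (L + t)) t := by
    have := ((hasDerivAt_id t).const_add L).fun_pow 2
    simpa using this
  have h2 := h1.fun_inv (pow_ne_zero 2 h0)
  have h3 := h2.const_mul (γ * L ^ 2)
  unfold decay
  simp only [div_eq_mul_inv]
  refine h3.congr_deriv ?_
  field_simp

theorem continuousOn_decay {γ L : ℝ} (hL : 0 < L) : ContinuousOn (decay γ L) (Ici 0) :=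
  fun _ ht => (hasDerivAt_decay hL ht).continuousAt.continuousWithinAt

theorem integral_decay {γ L a b : ℝ} (hL : 0 < L) (ha : 0 ≤ a) (hab : a ≤ b) :
    ∫ τ in a..b, decay γ L τ = γ * L ^ 2 * (b - a) / ((L + a) * (L + b)) := by
  have hb := ha.trans hab
  have h1 : ∀ x ∈ uIcc a b, HasDerivAt (fun τ => -(γ * L ^ 2) * (L + τ)⁻¹) (decay γ L x) x := by
    intro x hx
    rw [uIcc_of_le hab] at hx
    have h0 : L + x ≠ 0 := by linarith [hx.1]
    have h2 : HasDerivAt (fun τ : ℝ => L + τ) 1 x := (hasDerivAt_id x).const_add L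
    have h3 := (h2.fun_inv h0).const_mul (-(γ * L ^ 2))
    refine h3.congr_deriv ?_
    unfold decay
    field_simp
  rw [intervalIntegral.integral_eq_sub_of_hasDerivAt h1
    (intervalIntegrable_of_continuousOn_Ici (continuousOn_decay hL) ha hb)]
  have h0 : L + a ≠ 0 := by positivity
  have h0 : L + b ≠ 0 := by positivity
  field_simp
  ring

theorem integral_decay_le {γ L a b : ℝ} (hγ : 0 ≤ γ) (hL : 0 < L) (ha : 0 ≤ a) (hab : a ≤ b) :
    ∫ τ in a..b, decay γ L τ ≤ γ * L := by
  have hb := ha.trans hab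
  rw [integral_decay hL ha hab, div_le_iff₀ (by positivity)]
  have h1 : b - a ≤ L + b := by linarith
  have h2 : L ≤ L + a := by linarith
  calc γ * L ^ 2 * (b - a) = γ * L * (L * (b - a)) := by ring
    _ ≤ γ * L * ((L + a) * (L + b)) := by gcongr

theorem decay_pos {γ L t : ℝ} (hγ : 0 < γ) (hL : 0 < L) (ht : 0 ≤ t) : 0 < decay γ L t := by
  unfold decay; positivity

theorem decay_le_div {γ L t : ℝ} (hγ : 0 ≤ γ) (hL : 0 < L) (ht : 0 ≤ t) :
    decay γ L t ≤ γ * L / (L + t) := by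
  unfold decay
  rw [div_le_div_iff₀ (by positivity) (by positivity)]
  have : L ≤ L + t := by linarith
  calc γ * L ^ 2 * (L + t) = γ * L * (L + t) * L := by ring
    _ ≤ γ * L * (L + t) * (L + t) := by gcongr
    _ = _ := by ring

theorem decay_le {γ L t : ℝ} (hγ : 0 ≤ γ) (hL : 0 < L) (ht : 0 ≤ t) : decay γ L t ≤ γ := by
  refine (decay_le_div hγ hL ht).trans ?_
  rw [div_le_iff₀ (by positivity)]
  nlinarith

section Solution

variable {M : Model d} {V₀ : ℝ} {V : ℝ → ℝ} {f : ℝ → Vect d → Vect d → ℝ}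

theorem position_sub_eq (hV : ContinuousOn V (Ici 0)) (Vinf : ℝ) {a b : ℝ} (ha : 0 ≤ a)
    (hb : 0 ≤ b) :
    position V b - position V a = Vinf * (b - a) - ∫ τ in a..b, (Vinf - V τ) := by
  rw [position_sub hV ha hb, intervalIntegral.integral_sub (by simp)
    (intervalIntegrable_of_continuousOn_Ici hV ha hb), intervalIntegral.integral_const, smul_eq_mul]
  ring

theorem abs_integral_le_decay {Vinf γ L a b : ℝ} (hL : 0 < L)
    (ha : 0 ≤ a) (hab : a ≤ b) (h : ∀ τ ∈ Ioo a b, |Vinf - V τ| ≤ decay γ L τ) :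
    |∫ τ in a..b, (Vinf - V τ)| ≤ ∫ τ in a..b, decay γ L τ := by
  have hb := ha.trans hab
  rw [← Real.norm_eq_abs]
  refine intervalIntegral.norm_integral_le_of_norm_le hab ?_
    (intervalIntegrable_of_continuousOn_Ici (continuousOn_decay hL) ha hb)
  have hne : ∀ᵐ τ : ℝ, τ ≠ b := Measure.ae_ne volume b
  filter_upwards [hne] with τ hτ hτI
  exact h τ ⟨hτI.1, lt_of_le_of_ne hτI.2 hτ⟩

/-- One step of the bootstrap for the decay of `Vinf - V`. -/
theorem Model.IsSolution.decay_step (hd : 2 ≤ d) (hR : 0 < M.R) (hρ : 0 < M.ρ) (hβ : 0 < M.β)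
    {Vinf γ L : ℝ} (hE : M.F₀ Vinf = M.E) (hγ : 0 < γ) (hL : L = 4 / M.dF₀ 0)
    (hsmall : 512 * M.A * γ ^ 2 ≤ M.dF₀ 0) (hs : M.IsSolution (Vinf - γ) V f) {T : ℝ} (hT : 0 ≤ T)
    (hboot : ∀ t ∈ Ico 0 T, |Vinf - V t| ≤ 2 * decay γ L t) : |Vinf - V T| ≤ decay γ L T := by
  have hA := M.A_pos hR hρ hβ
  have hc := M.dF₀_zero_pos hA hβ
  set c := M.dF₀ 0
  have hLpos : 0 < L := by rw [hL]; positivity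
  have hV := hs.continuousOn
  have h2d : ∀ t, 2 * decay γ L t = decay (2 * γ) L t := fun t => by unfold decay; ring
  have hV0 : V 0 = Vinf - γ := by simpa using hs.motion 0 le_rfl
  have hφ0 : decay γ L 0 = γ := by unfold decay; field_simp; simp
  have hr : ∀ t ∈ Ioo 0 T, M.GoodTime V f t →
      |M.force V f t - M.F₀ (V t)| ≤ c / 2 * decay γ L t := by
    intro t ht hgood
    have hLt : 0 < L + t := by linarith [ht.1]
    -- Under the bootstrap assumption both `|Vinf - V t|` and the mean of `|Vinf - V|` over any `[s,
    -- t]` are at most `2 γ L / (L + t)`; their sum is `δ`.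
    have h1 := hgood.abs_force_sub_le hρ hβ (δ := 4 * (γ * L / (L + t))) (by positivity) ?_
    · refine h1.trans ?_
      have e1 : 4 * M.A * (4 * (γ * L / (L + t))) ^ 3 =
          (256 * M.A * γ ^ 2) * (L / (L + t)) * decay γ L t := by
        unfold decay; field_simp; ring
      rw [e1]
      have e2 : L / (L + t) ≤ 1 := by rw [div_le_one hLt]; linarith [ht.1]
      have e3 := (decay_pos hγ hLpos ht.1.le).le
      refine mul_le_mul_of_nonneg_right ?_ e3
      calc 256 * M.A * γ ^ 2 * (L / (L + t)) ≤ 256 * M.A * γ ^ 2 * 1 := by gcongr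
        _ ≤ c / 2 := by linarith
    · intro s u hs0 hst hX
      have hts : 0 < t - s := sub_pos.2 hst
      rw [position_sub_eq hV Vinf hs0.le ht.1.le] at hX
      have e1 : (u - V t) * (t - s) = (Vinf - V t) * (t - s) - ∫ τ in s..t, (Vinf - V τ) := by
        linear_combination -hX
      have e2 := abs_integral_le_decay (γ := 2 * γ) hLpos hs0.le hst.le (Vinf := Vinf)
        fun τ hτ => by
          rw [← h2d]; exact hboot τ ⟨(hs0.trans hτ.1).le, hτ.2.trans ht.2⟩
      have e3 := hboot t ⟨ht.1.le, ht.2⟩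
      have e4 := decay_le_div hγ.le hLpos ht.1.le
      have e5 : ∫ τ in s..t, decay (2 * γ) L τ ≤ 2 * (γ * L / (L + t)) * (t - s) := by
        rw [integral_decay hLpos hs0.le hst.le, div_le_iff₀ (by positivity)]
        have : 2 * (γ * L / (L + t)) * (t - s) * ((L + s) * (L + t)) =
            2 * γ * L * (t - s) * (L + s) := by field_simp
        rw [this]
        calc 2 * γ * L ^ 2 * (t - s) = 2 * γ * L * (t - s) * L := by ring
          _ ≤ 2 * γ * L * (t - s) * (L + s) := by gcongr; linarith
      have e6 : |u - V t| * (t - s) ≤ 4 * (γ * L / (L + t)) * (t - s) := by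
        rw [← abs_of_pos hts, ← abs_mul, abs_of_pos hts, e1]
        refine (abs_sub _ _).trans ?_
        rw [abs_mul, abs_of_pos hts]
        have : |Vinf - V t| * (t - s) ≤ 2 * (γ * L / (L + t)) * (t - s) := by
          gcongr; linarith
        linarith
      exact le_of_mul_le_mul_right e6 hts
  -- The restoring force exceeds `c * decay` wherever the comparison is tested, and the excess takes
  -- at most half of it. The profile decays at rate `2 / (L + t) ≤ 2 / L = c / 2`, which is why `L =
  -- 4 / c`.
  have hφ' : ∀ t, 0 ≤ t → -(c / 2 * decay γ L t) ≤ -(2 / (L + t)) * decay γ L t := by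
    intro t ht
    have e1 : 2 / (L + t) ≤ c / 2 := by
      rw [div_le_div_iff₀ (by positivity) (by positivity)]
      have : c * L = 4 := by rw [hL]; field_simp
      nlinarith
    nlinarith [decay_pos hγ hLpos ht]
  have hder : ∀ t ∈ Icc 0 T, HasDerivAt (decay γ L) (-(2 / (L + t)) * decay γ L t) t :=
    fun t ht => hasDerivAt_decay hLpos ht.1
  have hcont : ContinuousOn (fun t => -(2 / (L + t)) * decay γ L t) (Icc 0 T) := by
    have h1 : ContinuousOn (decay γ L) (Icc 0 T) := (continuousOn_decay hLpos).mono fun t ht => ht.1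
    refine ContinuousOn.mul (ContinuousOn.neg (ContinuousOn.div (by fun_prop) (by fun_prop) ?_)) h1
    intro t ht
    linarith [ht.1]
  have hgood := hs.ae_goodTime hd hR hV
  refine abs_le.2 ⟨?_, ?_⟩
  · have := hs.compare (σ := -1) (Vinf := Vinf) le_rfl hT hder hcont (by rw [hV0, hφ0]; linarith) ?_
    · linarith
    · filter_upwards [hgood] with t hg ht hlt
      have h1 := abs_le.1 (hr t ht (hg ht.1))
      have h2 := hφ' t ht.1.le
      have h3 := decay_pos hγ hLpos ht.1.le
      have h4 := M.le_F₀_sub hA hβ (V := Vinf) (V' := V t) (by linarith)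
      rw [← hE]
      nlinarith [h1.1]
  · have := hs.compare (σ := 1) (Vinf := Vinf) le_rfl hT hder hcont (by rw [hV0, hφ0]; linarith) ?_
    · linarith
    · filter_upwards [hgood] with t hg ht hlt
      have h1 := abs_le.1 (hr t ht (hg ht.1))
      have h2 := hφ' t ht.1.le
      have h3 := decay_pos hγ hLpos ht.1.le
      have h4 := M.le_F₀_sub hA hβ (V := V t) (V' := Vinf) (by linarith)
      rw [← hE]
      nlinarith [h1.2]

/-- Continuity argument: at the first time when `|Vinf - V|` reached twice the profile, `decay_step`
would bound it by the profile itself. -/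
theorem Model.IsSolution.abs_le_decay (hd : 2 ≤ d) (hR : 0 < M.R) (hρ : 0 < M.ρ) (hβ : 0 < M.β)
    {Vinf γ L : ℝ} (hE : M.F₀ Vinf = M.E) (hγ : 0 < γ) (hL : L = 4 / M.dF₀ 0)
    (hsmall : 512 * M.A * γ ^ 2 ≤ M.dF₀ 0) (hs : M.IsSolution (Vinf - γ) V f) {t : ℝ}
    (ht : 0 ≤ t) : |Vinf - V t| ≤ decay γ L t := by
  have hLpos : 0 < L := by
    have := M.dF₀_zero_pos (M.A_pos hR hρ hβ) hβ
    rw [hL]; positivity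
  by_contra! hlt
  have hc1 : ContinuousOn (fun τ => |Vinf - V τ| - 2 * decay γ L τ) (Icc 0 t) := by
    have h1 : ContinuousOn V (Icc 0 t) := hs.continuousOn.mono fun τ hτ => hτ.1
    have h2 : ContinuousOn (decay γ L) (Icc 0 t) :=
      (continuousOn_decay hLpos).mono fun τ hτ => hτ.1
    fun_prop
  have hcpt : IsCompact (Icc 0 t ∩ (fun τ => |Vinf - V τ| - 2 * decay γ L τ) ⁻¹' Ici 0) :=
    isCompact_Icc.of_isClosed_subset
      (hc1.preimage_isClosed_of_isClosed isClosed_Icc isClosed_Ici) inter_subset_left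
  have hne : (Icc 0 t ∩ (fun τ => |Vinf - V τ| - 2 * decay γ L τ) ⁻¹' Ici 0).Nonempty := by
    by_contra! hemp
    refine absurd (hs.decay_step hd hR hρ hβ hE hγ hL hsmall ht fun τ hτ => ?_) (not_le.2 hlt)
    by_contra! h
    have : τ ∈ Icc 0 t ∩ (fun τ => |Vinf - V τ| - 2 * decay γ L τ) ⁻¹' Ici 0 :=
      ⟨⟨hτ.1, hτ.2.le⟩, by simp only [mem_preimage, mem_Ici]; linarith⟩
    rw [hemp] at this
    exact this
  obtain ⟨T, ⟨hTI, hT⟩, hmin⟩ := hcpt.exists_isLeast hne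
  have h1 := hs.decay_step hd hR hρ hβ hE hγ hL hsmall hTI.1 fun τ hτ => by
    by_contra! h
    exact absurd (hmin ⟨⟨hτ.1, hτ.2.le.trans hTI.2⟩, by
      simp only [mem_preimage, mem_Ici]; linarith⟩) (not_le.2 hτ.2)
  have h2 := decay_pos hγ hLpos hTI.1
  simp only [mem_preimage, mem_Ici] at hT
  linarith

/-- Since the profile has integral at most `γ L`, the body strays from motion at speed `Vinf` by at
most `γ L`. So does a particle that shares two positions with the base, and their distance is at
most `2 γ L < h`. -/
theorem Model.noEscape_of_decay (hV : ContinuousOn V (Ici 0)) {Vinf γ L : ℝ} (hγ : 0 < γ)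
    (hL : 0 < L) (hh : 2 * (γ * L) < M.h) (hdec : ∀ t, 0 ≤ t → |Vinf - V t| ≤ decay γ L t) :
    M.NoEscape V := by
  intro s T u hs hsT hX τ hτ
  have hint : ∀ {a b : ℝ}, 0 ≤ a → a ≤ b → |∫ σ in a..b, (Vinf - V σ)| ≤ γ * L := fun ha hab =>
    (abs_integral_le_decay hL ha hab fun σ hσ => hdec σ (ha.trans hσ.1.le)).trans
      (integral_decay_le hγ.le hL ha hab)
  have h1 := abs_le.1 (hint hs hτ.1)
  have h2 := hint hs hsT.le
  rw [position_sub_eq hV Vinf hs (hs.trans hsT.le)] at hX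
  have h3 := position_sub_eq hV Vinf hs (hs.trans hτ.1)
  have hTs : 0 < T - s := sub_pos.2 hsT
  have h4 : |(Vinf - u) * (T - s)| ≤ γ * L := by
    have : (Vinf - u) * (T - s) = ∫ σ in s..T, (Vinf - V σ) := by linear_combination hX
    rwa [this]
  have h5 : |(Vinf - u) * (τ - s)| ≤ γ * L := by
    refine le_trans ?_ h4
    rw [abs_mul, abs_mul]
    refine mul_le_mul_of_nonneg_left ?_ (abs_nonneg _)
    rw [abs_of_nonneg (sub_nonneg.2 hτ.1), abs_of_pos hTs]
    linarith [hτ.2]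
  have h6 := (abs_le.1 h5).1
  have : position V s + u * (τ - s) - position V τ =
      (∫ σ in s..τ, (Vinf - V σ)) - (Vinf - u) * (τ - s) := by linear_combination -h3
  rw [this]
  linarith [h1.2]

/-- Comparison with the solution of the linearized equation: a nonnegative excess only helps, and
`F₀' ≤ F₀'(Vinf)` on `(0, Vinf)` makes the linear rate the fastest possible. -/
theorem Model.IsSolution.exp_le (hd : 2 ≤ d) (hR : 0 < M.R) (hρ : 0 < M.ρ) (hβ : 0 < M.β)
    {Vinf γ : ℝ} (hE : M.F₀ Vinf = M.E) (hγ : 0 < γ)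
    (hs : M.IsSolution (Vinf - γ) V f) (hpos : ∀ t, 0 ≤ t → 0 < V t) (hesc : M.NoEscape V)
    {t : ℝ} (ht : 0 ≤ t) : γ * Real.exp (-(M.dF₀ Vinf) * t) ≤ Vinf - V t := by
  have hA := M.A_pos hR hρ hβ
  set C := M.dF₀ Vinf with hC
  have hCpos : 0 < C := (M.dF₀_zero_pos hA hβ).trans_le (M.dF₀_mono hA hβ (by simp))
  have hV0 : V 0 = Vinf - γ := by simpa using hs.motion 0 le_rfl
  have hder : ∀ τ ∈ Icc 0 t, HasDerivAt (fun τ => -(γ * Real.exp (-C * τ)))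
      (C * (γ * Real.exp (-C * τ))) τ := by
    intro τ _
    have h1 : HasDerivAt (fun τ : ℝ => -C * τ) (-C) τ := by
      simpa using (hasDerivAt_id τ).const_mul (-C)
    refine ((h1.exp.const_mul γ).fun_neg).congr_deriv ?_
    ring
  have h := hs.compare (σ := -1) (Vinf := Vinf) le_rfl ht hder (by fun_prop)
    (by simp [hV0]) ?_
  · linarith
  · filter_upwards [hs.ae_goodTime hd hR hs.continuousOn] with τ hg hτ hlt
    have h1 := (hg hτ.1).force_sub_nonneg hR hρ hβ hs.continuousOn hpos hesc hτ.1
    have h2 : 0 < γ * Real.exp (-C * τ) := by positivity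
    rw [← hE]
    -- The comparison must also cover `V τ > Vinf`, not yet excluded; there the friction alone is at
    -- least `E`.
    rcases le_total (V τ) Vinf with h3 | h3
    · have h4 := M.F₀_sub_le hβ h3 (C := C) fun W hW => M.dF₀_mono hA hβ (by
        have := hpos τ hτ.1.le
        rw [abs_of_pos (this.trans hW.1), abs_of_pos ((this.trans hW.1).trans hW.2)]
        exact hW.2.le)
      have h5 : C * (Vinf - V τ) ≤ C * (γ * Real.exp (-C * τ)) := by
        gcongr; linarith
      linarith
    · have h4 := M.le_F₀_sub hA hβ h3
      have h5 := mul_nonneg (M.dF₀_zero_pos hA hβ).le (sub_nonneg.2 h3)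
      have h6 := mul_pos hCpos h2
      linarith

end Solution

/-! ### The long-time recollisions with the initial layer -/

section Profile

variable {W : ℝ → ℝ} {γ L s₀ c₁ t : ℝ}

/-- The bounds on the distance `W` from the limiting velocity that force late recollisions with
particles which were reflected before the time `s₀`. -/
structure LayerBounds (W : ℝ → ℝ) (γ L s₀ c₁ : ℝ) : Prop where
  cont : ContinuousOn W (Ici 0)
  γ_pos : 0 < γ
  L_pos : 0 < L
  s₀_pos : 0 < s₀
  s₀_le : s₀ ≤ 1
  c₁_pos : 0 < c₁
  nonneg : ∀ τ, 0 ≤ τ → 0 ≤ W τ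
  upper : ∀ τ, 0 ≤ τ → W τ ≤ decay γ L τ
  initial : ∀ τ ∈ Icc 0 s₀, 4 / 5 * γ ≤ W τ
  lower : ∀ τ ∈ Icc 0 2, c₁ * γ ≤ W τ

theorem LayerBounds.integrable (h : LayerBounds W γ L s₀ c₁) {a b : ℝ} (ha : 0 ≤ a) (hb : 0 ≤ b) :
    IntervalIntegrable W volume a b := intervalIntegrable_of_continuousOn_Ici h.cont ha hb

theorem LayerBounds.integral_nonneg (h : LayerBounds W γ L s₀ c₁) {a b : ℝ} (ha : 0 ≤ a)
    (hab : a ≤ b) : 0 ≤ ∫ τ in a..b, W τ :=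
  intervalIntegral.integral_nonneg hab fun τ hτ => h.nonneg τ (ha.trans hτ.1)

theorem LayerBounds.integral_le_decay (h : LayerBounds W γ L s₀ c₁) {a b : ℝ} (ha : 0 ≤ a)
    (hab : a ≤ b) : ∫ τ in a..b, W τ ≤ ∫ τ in a..b, decay γ L τ :=
  intervalIntegral.integral_mono_on hab (h.integrable ha (ha.trans hab))
    (intervalIntegrable_of_continuousOn_Ici (continuousOn_decay h.L_pos) ha (ha.trans hab))
    fun τ hτ => h.upper τ (ha.trans hτ.1)

theorem LayerBounds.integral_le (h : LayerBounds W γ L s₀ c₁) {a b : ℝ} (ha : 0 ≤ a)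
    (hab : a ≤ b) : ∫ τ in a..b, W τ ≤ γ * L :=
  (h.integral_le_decay ha hab).trans (integral_decay_le h.γ_pos.le h.L_pos ha hab)

theorem LayerBounds.integral_add (h : LayerBounds W γ L s₀ c₁) {a b c : ℝ} (ha : 0 ≤ a)
    (hb : 0 ≤ b) (hc : 0 ≤ c) : (∫ τ in a..b, W τ) + ∫ τ in b..c, W τ = ∫ τ in a..c, W τ :=
  intervalIntegral.integral_add_adjacent_intervals (h.integrable ha hb) (h.integrable hb hc)

theorem LayerBounds.const_le_integral (h : LayerBounds W γ L s₀ c₁) {a b m : ℝ} (ha : 0 ≤ a)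
    (hab : a ≤ b) (hm : ∀ τ ∈ Icc a b, m ≤ W τ) : m * (b - a) ≤ ∫ τ in a..b, W τ := by
  have := intervalIntegral.integral_mono_on hab (intervalIntegrable_const (c := m))
    (h.integrable ha (ha.trans hab)) hm
  rw [intervalIntegral.integral_const, smul_eq_mul] at this
  linarith

/-- The mean of `W` over `[τ, t]` is largest for `τ ≤ s₀`. -/
theorem LayerBounds.integral_tail_le (h : LayerBounds W γ L s₀ c₁) (ht₁ : L / c₁ + 2 ≤ t)
    (ht₂ : L ^ 3 / c₁ ^ 2 + 2 ≤ t) {τ : ℝ} (hτ : s₀ ≤ τ) (hτt : τ < t) :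
    (∫ σ in τ..t, W σ) * (t - s₀) ≤ (∫ σ in s₀..t, W σ) * (t - τ) := by
  have hc := h.c₁_pos
  have hL := h.L_pos
  have hγ := h.γ_pos
  have hs0 := h.s₀_pos
  have hs1 := h.s₀_le
  have hτ0 : 0 ≤ τ := hs0.le.trans hτ
  have ht0 : 0 ≤ t := hτ0.trans hτt.le
  have hadd := h.integral_add hs0.le hτ0 ht0
  have hI := h.integral_le hs0.le (hτ.trans hτt.le)
  have hts : 0 < t - s₀ := by linarith
  have e1 : L ≤ c₁ * (t - s₀) := by
    have : L / c₁ ≤ t - s₀ := by linarith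
    rw [div_le_iff₀ hc] at this
    linarith
  have e2 : L ^ 3 ≤ c₁ ^ 2 * (t - s₀) := by
    have : L ^ 3 / c₁ ^ 2 ≤ t - s₀ := by linarith
    rw [div_le_iff₀ (by positivity)] at this
    linarith
  have hfirst : ∀ b, s₀ ≤ b → b ≤ s₀ + 1 → c₁ * γ * (b - s₀) ≤ ∫ σ in s₀..b, W σ :=
    fun b hb hb' => h.const_le_integral hs0.le hb fun σ hσ =>
      h.lower σ ⟨hs0.le.trans hσ.1, by linarith [hσ.2]⟩
  have hone : s₀ + 1 ≤ τ → c₁ * γ ≤ ∫ σ in s₀..τ, W σ := by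
    intro h1
    have h2 := hfirst (s₀ + 1) (by linarith) le_rfl
    have h3 := h.integral_add hs0.le (by linarith : 0 ≤ s₀ + 1) hτ0
    have h4 := h.integral_nonneg (by linarith : 0 ≤ s₀ + 1) h1
    linarith
  -- Either the mean over `[s₀, τ]` is at least the mean over `[s₀, t]`, or the mean over `[τ, t]`
  -- is below `c₁ γ / (t - s₀)`, itself a lower bound for the mean over `[s₀, t]`. The first
  -- alternative is used for `τ` close to `s₀` or moderately large, the second, through the explicit
  -- integral of the profile, for `τ` comparable with `t`.
  suffices hcase : (∫ σ in s₀..t, W σ) * (τ - s₀) ≤ (∫ σ in s₀..τ, W σ) * (t - s₀) ∨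
      (∫ σ in τ..t, W σ) * (t - s₀) ≤ c₁ * γ * (t - τ) ∧ s₀ + 1 ≤ τ by
    rcases hcase with hcase | ⟨hcase, h1⟩
    · rw [← hadd] at hcase ⊢; linarith
    · refine hcase.trans (mul_le_mul_of_nonneg_right ?_ (by linarith))
      have := h.integral_nonneg hτ0 hτt.le
      linarith [hone h1]
  have hγL : (∫ σ in s₀..t, W σ) * (τ - s₀) ≤ γ * L * (τ - s₀) :=
    mul_le_mul_of_nonneg_right hI (by linarith)
  rcases le_total τ (s₀ + 1) with h1 | h1
  · left
    have h2 := mul_le_mul_of_nonneg_right (hfirst τ hτ h1) hts.le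
    refine (hγL.trans ?_).trans h2
    calc γ * L * (τ - s₀) = γ * (τ - s₀) * L := by ring
      _ ≤ γ * (τ - s₀) * (c₁ * (t - s₀)) := by
        refine mul_le_mul_of_nonneg_left e1 (mul_nonneg hγ.le (by linarith))
      _ = _ := by ring
  rcases le_total (L * (τ - s₀)) (c₁ * (t - s₀)) with h2 | h2
  · left
    have h3 := mul_le_mul_of_nonneg_right (hone h1) hts.le
    refine (hγL.trans ?_).trans h3
    calc γ * L * (τ - s₀) = γ * (L * (τ - s₀)) := by ring
      _ ≤ γ * (c₁ * (t - s₀)) := by gcongr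
      _ = _ := by ring
  · right
    refine ⟨?_, h1⟩
    have h3 := h.integral_le_decay hτ0 hτt.le
    rw [integral_decay hL hτ0 hτt.le] at h3
    have hpos : 0 < (L + τ) * (L + t) := by positivity
    rw [le_div_iff₀ hpos] at h3
    refine le_of_mul_le_mul_right ?_ hpos
    have h4 : L ^ 2 * (t - s₀) ≤ c₁ * ((L + τ) * (L + t)) := by
      have h5 : c₁ * (t - s₀) ≤ L * (L + τ) := h2.trans (by gcongr; linarith)
      have h6 : L ^ 3 * (t - s₀) ≤ c₁ * (L * (L + τ)) * (L + t) := by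
        calc L ^ 3 * (t - s₀) ≤ c₁ ^ 2 * (t - s₀) * (t - s₀) := by gcongr
          _ = c₁ * (c₁ * (t - s₀)) * (t - s₀) := by ring
          _ ≤ c₁ * (L * (L + τ)) * (L + t) := by gcongr; linarith
      refine le_of_mul_le_mul_left ?_ hL
      calc L * (L ^ 2 * (t - s₀)) = L ^ 3 * (t - s₀) := by ring
        _ ≤ _ := h6
        _ = _ := by ring
    calc (∫ σ in τ..t, W σ) * (t - s₀) * ((L + τ) * (L + t))
        = (∫ σ in τ..t, W σ) * ((L + τ) * (L + t)) * (t - s₀) := by ring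
      _ ≤ γ * L ^ 2 * (t - τ) * (t - s₀) := mul_le_mul_of_nonneg_right h3 hts.le
      _ = γ * (t - τ) * (L ^ 2 * (t - s₀)) := by ring
      _ ≤ γ * (t - τ) * (c₁ * ((L + τ) * (L + t))) :=
        mul_le_mul_of_nonneg_left h4 (mul_nonneg hγ.le (by linarith))
      _ = _ := by ring

/-- The time of the first collision, in the initial layer, of a particle that hits the base at
time `t` with relative velocity between the means of `W` over `[s₀, t]` and `[0, t]`. -/
theorem LayerBounds.exists_hit (h : LayerBounds W γ L s₀ c₁) (ht₁ : L / c₁ + 2 ≤ t)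
    (ht₂ : L ^ 3 / c₁ ^ 2 + 2 ≤ t) {w : ℝ} (hw₁ : (∫ σ in s₀..t, W σ) < w * (t - s₀))
    (hw₂ : w * t < ∫ σ in (0 : ℝ)..t, W σ) :
    ∃ s, 0 < s ∧ s < s₀ ∧ w * (t - s) = (∫ σ in s..t, W σ) ∧
      ∀ τ ∈ Ioo s t, ∫ σ in τ..t, W σ < w * (t - τ) := by
  have hs0 := h.s₀_pos
  have hs1 := h.s₀_le
  have ht : 2 ≤ t := by have := div_pos h.L_pos h.c₁_pos; linarith
  have ht0 : 0 ≤ t := by linarith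
  have hts : 0 < t - s₀ := by linarith
  -- For `W = Vinf - V` this is the height above the base, at time `τ`, of the particle that moves
  -- with velocity `Vinf - w` and hits at time `t`.
  have hc : ContinuousOn (fun τ => w * (t - τ) - ∫ σ in τ..t, W σ) (Icc 0 s₀) := by
    have h1 : ContinuousOn (fun τ => ∫ σ in t..τ, W σ) (Icc 0 s₀) := by
      have := intervalIntegral.continuousOn_primitive_interval'
        (h.integrable le_rfl ht0) (right_mem_uIcc)
      rw [uIcc_of_le ht0] at this
      exact this.mono (Icc_subset_Icc_right (by linarith))
    have h2 : (fun τ => w * (t - τ) - ∫ σ in τ..t, W σ) =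
        fun τ => w * (t - τ) + ∫ σ in t..τ, W σ := by
      ext τ; rw [intervalIntegral.integral_symm]; ring
    rw [h2]
    exact ContinuousOn.add (by fun_prop) h1
  have hcpt : IsCompact (Icc 0 s₀ ∩ (fun τ => w * (t - τ) - ∫ σ in τ..t, W σ) ⁻¹' Iic 0) :=
    isCompact_Icc.of_isClosed_subset
      (hc.preimage_isClosed_of_isClosed isClosed_Icc isClosed_Iic) inter_subset_left
  -- The last time in the layer at which the height is not positive, so that the particle stays in
  -- front of the base afterwards.
  obtain ⟨s, ⟨hsI, hs⟩, hmax⟩ := hcpt.exists_isGreatest ⟨0, ⟨le_rfl, hs0.le⟩, by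
    simp only [mem_preimage, mem_Iic, sub_zero]; linarith⟩
  simp only [mem_preimage, mem_Iic] at hs
  have hss : s < s₀ := by
    refine lt_of_le_of_ne hsI.2 ?_
    rintro rfl
    linarith
  have hafter : ∀ τ ∈ Ioo s t, ∫ σ in τ..t, W σ < w * (t - τ) := by
    intro τ hτ
    rcases le_total s₀ τ with h1 | h1
    · have h2 := h.integral_tail_le ht₁ ht₂ h1 hτ.2
      have h3 : (∫ σ in s₀..t, W σ) * (t - τ) < w * (t - s₀) * (t - τ) :=
        mul_lt_mul_of_pos_right hw₁ (by linarith [hτ.2])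
      refine lt_of_mul_lt_mul_right ?_ hts.le
      linarith
    · by_contra! h2
      exact absurd (hmax ⟨⟨hsI.1.trans hτ.1.le, h1⟩, by
        simp only [mem_preimage, mem_Iic]; linarith⟩) (not_le.2 hτ.1)
  have hzero : w * (t - s) - (∫ σ in s..t, W σ) = 0 := by
    refine le_antisymm hs ?_
    have h1 : Tendsto (fun τ => w * (t - τ) - ∫ σ in τ..t, W σ) (𝓝[>] s)
        (𝓝 (w * (t - s) - ∫ σ in s..t, W σ)) := by
      refine (hc s hsI).mono_left ?_
      rw [← nhdsWithin_Ioo_eq_nhdsGT hss]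
      exact nhdsWithin_mono s fun τ hτ => ⟨hsI.1.trans hτ.1.le, hτ.2.le⟩
    refine ge_of_tendsto h1 ?_
    filter_upwards [Ioo_mem_nhdsGT hss] with τ hτ
    have := hafter τ ⟨hτ.1, by linarith [hτ.2]⟩
    linarith
  refine ⟨s, lt_of_le_of_ne hsI.1 ?_, hss, by linarith, hafter⟩
  rintro rfl
  simp only [sub_zero] at hzero
  linarith

end Profile

/-- For large times the recollisions with the particles reflected in the initial layer
increase the friction by at least `γ⁴ / t³`, up to a constant. -/
theorem Model.GoodTime.force_sub_ge {M : Model d} (hd : 2 ≤ d) (hR : 0 < M.R)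
    (hρ : 0 < M.ρ) (hβ : 0 < M.β) {V : ℝ → ℝ} (hV : ContinuousOn V (Ici 0))
    (hpos : ∀ t, 0 ≤ t → 0 < V t) (hesc : M.NoEscape V) {f : ℝ → Vect d → Vect d → ℝ}
    {Vinf γ L s₀ c₁ t : ℝ} (h : LayerBounds (fun τ => Vinf - V τ) γ L s₀ c₁)
    (hγV : γ ≤ Vinf / 2) (hh : γ * L < M.h) (hh' : 2 * γ < M.h) (ht : M.GoodTime V f t)
    (ht₁ : L / c₁ + 2 ≤ t) (ht₂ : L ^ 3 / c₁ ^ 2 + 2 ≤ t) (ht₃ : 10 * L + 2 ≤ t)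
    (ht₄ : 2 * L ^ 2 / c₁ ≤ t) :
    M.A * s₀ * c₁ ^ 2 * M.β * Vinf * Real.exp (-M.β * Vinf ^ 2) / 8 * (γ ^ 4 / t ^ 3) ≤
      M.force V f t - M.F₀ (V t) := by
  have hA := M.A_pos hR hρ hβ
  have hs0 := h.s₀_pos
  have hs1 := h.s₀_le
  have hc := h.c₁_pos
  have hL := h.L_pos
  have hγ := h.γ_pos
  have ht2 : 2 ≤ t := by linarith
  have ht0 : 0 < t := by linarith
  have hts : 0 < t - s₀ := by linarith
  have hVinf : 0 < Vinf := by linarith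
  have hadd := h.integral_add le_rfl hs0.le ht0.le
  have hJ := h.const_le_integral le_rfl hs0.le h.initial
  rw [sub_zero] at hJ
  have hI := h.integral_le hs0.le (by linarith : s₀ ≤ t)
  have hI0 := h.integral_le le_rfl ht0.le
  have hIc : c₁ * γ ≤ ∫ σ in s₀..t, (Vinf - V σ) := by
    have h1 := h.const_le_integral hs0.le (by linarith : s₀ ≤ s₀ + 1) (m := c₁ * γ)
      fun σ hσ => h.lower σ ⟨hs0.le.trans hσ.1, by linarith [hσ.2]⟩
    have h2 := h.integral_nonneg (by linarith : 0 ≤ s₀ + 1) (by linarith : s₀ + 1 ≤ t)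
    have h3 := h.integral_add hs0.le (by linarith : 0 ≤ s₀ + 1) ht0.le
    linarith
  set I₁ := ∫ σ in s₀..t, (Vinf - V σ) with hI₁
  set I₀ := ∫ σ in (0 : ℝ)..t, (Vinf - V σ) with hI₀
  -- Length of the velocity window: the layer adds at least `4 γ s₀ / 5` to the integral, and
  -- averaging over a time longer by `s₀` costs at most `γ s₀ / 10` by `10 L ≤ t - s₀`.
  have hlen : γ * s₀ / (2 * t) ≤ I₀ / t - I₁ / (t - s₀) := by
    rw [div_sub_div _ _ ht0.ne' hts.ne', div_le_div_iff₀ (by positivity) (by positivity)]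
    have e1 : γ * L ≤ γ * (t - s₀) / 10 := by
      have : L ≤ (t - s₀) / 10 := by linarith
      calc γ * L ≤ γ * ((t - s₀) / 10) := by gcongr
        _ = _ := by ring
    have e2 : 4 / 5 * γ * s₀ * (t - s₀) ≤ (I₀ - I₁) * (t - s₀) := by gcongr; linarith
    have e3 : s₀ * I₁ ≤ s₀ * (γ * (t - s₀) / 10) := by gcongr; linarith
    have e4 : γ * s₀ * (t - s₀) / 2 ≤ I₀ * (t - s₀) - t * I₁ := by
      have : 0 ≤ γ * s₀ * (t - s₀) := by positivity
      linarith
    calc γ * s₀ * (t * (t - s₀)) = 2 * t * (γ * s₀ * (t - s₀) / 2) := by ring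
      _ ≤ 2 * t * (I₀ * (t - s₀) - t * I₁) := by gcongr
      _ = _ := by ring
  -- `W t` is of order `1 / t²`, the means of `W` are at least `c₁ γ / t`: half of this is left for
  -- `V t - u = w - W t`.
  have hWt : Vinf - V t ≤ c₁ * γ / (2 * t) := by
    refine (h.upper t ht0.le).trans ?_
    unfold decay
    rw [div_le_div_iff₀ (by positivity) (by positivity)]
    rw [div_le_iff₀ hc] at ht₄
    have e1 : t * t ≤ (L + t) ^ 2 := by rw [sq]; gcongr <;> linarith
    calc γ * L ^ 2 * (2 * t) = γ * t * (2 * L ^ 2) := by ring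
      _ ≤ γ * t * (t * c₁) := by gcongr
      _ = c₁ * γ * (t * t) := by ring
      _ ≤ _ := by gcongr
  have hm₁ : c₁ * γ / t ≤ I₁ / (t - s₀) := by
    rw [div_le_div_iff₀ ht0 hts]
    have : 0 ≤ c₁ * γ := by positivity
    calc c₁ * γ * (t - s₀) ≤ c₁ * γ * t := by gcongr; linarith
      _ ≤ I₁ * t := by gcongr
  have hm₂ : I₀ / t ≤ γ / 10 := by
    rw [div_le_div_iff₀ ht0 (by norm_num)]
    have : L * 10 ≤ t := by linarith
    calc I₀ * 10 ≤ γ * L * 10 := by gcongr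
      _ = γ * (L * 10) := by ring
      _ ≤ γ * t := by gcongr
  have key := ht.force_sub_ge_of_recollision hd hR hρ hβ hV hpos hesc ht0
    (a := c₁ * γ / (2 * t)) (κ := Vinf * γ) (B := Vinf ^ 2) (u₁ := Vinf - I₀ / t)
    (u₂ := Vinf - I₁ / (t - s₀)) (by positivity) (by positivity)
    (by have : 0 ≤ γ * s₀ / (2 * t) := by positivity
        linarith) ?_
  · refine le_trans ?_ key
    have e1 : M.A * s₀ * c₁ ^ 2 * M.β * Vinf * Real.exp (-M.β * Vinf ^ 2) / 8 * (γ ^ 4 / t ^ 3) =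
        M.A * (γ * s₀ / (2 * t) * ((c₁ * γ / (2 * t)) ^ 2 *
          (M.β * (Vinf * γ) * Real.exp (-M.β * Vinf ^ 2)))) := by
      field_simp; ring
    rw [e1]
    gcongr
    linarith
  · intro u hu
    obtain ⟨w, hw⟩ : ∃ w, w = Vinf - u := ⟨_, rfl⟩
    have huw : u = Vinf - w := by linarith
    have hw₁ : I₁ / (t - s₀) < w := by linarith [hu.2]
    have hw₂ : w < I₀ / t := by linarith [hu.1]
    have e2 : c₁ * γ / t = c₁ * γ / (2 * t) + c₁ * γ / (2 * t) := by field_simp; ring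
    have e3 : 0 < c₁ * γ / (2 * t) := by positivity
    have hwpos : 0 < w := by linarith
    have huV : c₁ * γ / (2 * t) ≤ V t - u := by linarith
    have hupos : 0 < u := by linarith
    obtain ⟨s, hs, hss, hzero, hafter⟩ := h.exists_hit ht₁ ht₂ (w := w)
      (by rwa [div_lt_iff₀ hts] at hw₁) (by rwa [lt_div_iff₀ ht0] at hw₂)
    have hst : s < t := by linarith
    have hy : ∀ τ, 0 ≤ τ → position V t - (t - τ) * u - position V τ =
        w * (t - τ) - ∫ σ in τ..t, (Vinf - V σ) := by
      intro τ hτ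
      have := position_sub_eq hV Vinf hτ ht0.le
      rw [huw]
      linear_combination this
    have hWs := h.initial s ⟨hs.le, hss.le⟩
    have hWu : ∀ τ, 0 ≤ τ → Vinf - V τ ≤ γ := fun τ hτ =>
      (h.upper τ hτ).trans (decay_le hγ.le hL hτ)
    have hVs : Vinf / 2 ≤ V s := by linarith [hWu s hs.le]
    refine ⟨huV, by linarith, pow_le_pow_left₀ hupos.le (by linarith) 2, s, hs, hst, ?_, ?_, ?_, ?_, ?_⟩
    · have := hy s hs.le
      rw [hzero, sub_self] at this
      linarith
    · exact ne_of_gt (by linarith)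
    · have e4 : u ^ 2 - (2 * V s - u) ^ 2 = 4 * V s * (u - V s) := by ring
      rw [e4]
      have e5 : 7 / 10 * γ ≤ u - V s := by linarith
      have e6 := mul_le_mul hVs e5 (by positivity) (by linarith)
      have e7 : 0 < Vinf * γ := by positivity
      linarith
    · intro τ hτ
      have hτ0 : 0 ≤ τ := (hs.trans hτ.1).le
      rw [hy τ hτ0]
      refine ⟨by linarith [hafter τ hτ], ?_⟩
      have e6 := h.integral_add hs.le hτ0 ht0.le
      have e7 := h.integral_le hs.le hτ.1.le
      have e8 : w * (t - τ) ≤ w * (t - s) := by gcongr; exact hτ.1.le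
      linarith
    · intro τ hτ
      have e6 := position_sub_eq hV Vinf hτ.1.le hs.le
      have e7 : position V s - (s - τ) * (2 * V s - u) - position V τ =
          (2 * (Vinf - V s) - w) * (s - τ) - ∫ σ in τ..s, (Vinf - V σ) := by
        rw [huw]; linear_combination e6
      have hsτ : 0 < s - τ := sub_pos.2 hτ.2
      have e8 : ∫ σ in τ..s, (Vinf - V σ) ≤ γ * (s - τ) := by
        have := intervalIntegral.integral_mono_on hτ.2.le (h.integrable hτ.1.le hs.le)
          (intervalIntegrable_const (c := γ)) fun σ hσ => hWu σ (hτ.1.le.trans hσ.1)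
        rw [intervalIntegral.integral_const, smul_eq_mul] at this
        linarith
      have e9 := h.integral_nonneg hτ.1.le hτ.2.le
      have e10 := hWu s hs.le
      rw [e7]
      -- Before `s` the particle approaches the base with velocity deficit `2 W s - w ≥ (8/5 - 1/10)
      -- γ`, more than the body's deficit `W ≤ γ`. It was in front, and no higher than `2 γ < h`
      -- because `s ≤ 1`: this is its first base collision.
      have e11 : 3 / 2 * γ * (s - τ) ≤ (2 * (Vinf - V s) - w) * (s - τ) := by
        gcongr; linarith
      have e12 : (2 * (Vinf - V s) - w) * (s - τ) ≤ 2 * γ * 1 :=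
        mul_le_mul (by linarith) (by linarith [hτ.1]) hsτ.le (by positivity)
      have e13 : 0 < γ * (s - τ) := by positivity
      exact ⟨by linarith, by linarith⟩

/-! ### The algebraic tail -/

/-- The barrier that bounds `Vinf - V` from below for large times. -/
theorem hasDerivAt_barrier (γ C a T t : ℝ) (ht : 0 < t) :
    HasDerivAt (fun τ => -(γ * Real.exp (-C * τ) + a * (τ⁻¹ ^ 3 - T * τ⁻¹ ^ 4)))
      (C * (γ * Real.exp (-C * t)) - a * (-3 * t⁻¹ ^ 4 + 4 * T * t⁻¹ ^ 5)) t := by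
  have h1 : HasDerivAt (fun τ : ℝ => -C * τ) (-C) t := by
    simpa using (hasDerivAt_id t).const_mul (-C)
  have h2 := hasDerivAt_inv ht.ne'
  have h3 := ((h2.fun_pow 3).fun_sub ((h2.fun_pow 4).const_mul T)).const_mul a
  refine ((h1.exp.const_mul γ).fun_add h3).fun_neg.congr_deriv ?_
  push_cast
  field_simp
  ring

/-- The barrier adds `a (τ⁻³ - T τ⁻⁴)` to the exponential. The correction makes the addition vanish
at `τ = T`, where only the exponential bound is known, and leaves at least half of `a τ⁻³` once `τ ≥
2 T`. -/
theorem Model.IsSolution.tail_le {M : Model d} {V : ℝ → ℝ} {f : ℝ → Vect d → Vect d → ℝ}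
    (hd : 2 ≤ d) (hR : 0 < M.R) (hρ : 0 < M.ρ) (hβ : 0 < M.β)
    {Vinf γ : ℝ} (hE : M.F₀ Vinf = M.E)
    (hs : M.IsSolution (Vinf - γ) V f) (hpos : ∀ t, 0 ≤ t → 0 < V t)
    (hexp : ∀ t, 0 ≤ t → γ * Real.exp (-(M.dF₀ Vinf) * t) ≤ Vinf - V t) (hγ : 0 < γ)
    {κ T : ℝ} (hκ : 0 ≤ κ) (hT : 1 ≤ T)
    (hr : ∀ t, T ≤ t → M.GoodTime V f t → κ / t ^ 3 ≤ M.force V f t - M.F₀ (V t))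
    {t : ℝ} (ht : 2 * T ≤ t) :
    γ * Real.exp (-(M.dF₀ Vinf) * t) + κ / (1 + M.dF₀ Vinf) / 2 / t ^ 3 ≤ Vinf - V t := by
  have hA := M.A_pos hR hρ hβ
  set C := M.dF₀ Vinf with hC
  have hCpos : 0 < C := (M.dF₀_zero_pos hA hβ).trans_le (M.dF₀_mono hA hβ (by simp))
  have hT0 : 0 < T := by linarith
  set a := κ / (1 + C) with ha
  have ha0 : 0 ≤ a := by positivity
  have hTt : T ≤ t := by linarith
  have h := hs.compare (σ := -1) (Vinf := Vinf) hT0.le hTt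
    (fun τ hτ => hasDerivAt_barrier γ C a T τ (hT0.trans_le hτ.1)) ?_ ?_ ?_
  · have ht0 : 0 < t := by linarith
    have e1 : t⁻¹ ^ 3 - T * t⁻¹ ^ 4 = (1 - T / t) / t ^ 3 := by field_simp
    have e2 : (1 : ℝ) / 2 ≤ 1 - T / t := by
      have : T / t ≤ 1 / 2 := by rw [div_le_div_iff₀ ht0 (by norm_num)]; linarith
      linarith
    have e3 : a / 2 / t ^ 3 ≤ a * (t⁻¹ ^ 3 - T * t⁻¹ ^ 4) := by
      rw [e1]
      calc a / 2 / t ^ 3 = a * ((1 / 2) / t ^ 3) := by ring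
        _ ≤ _ := by gcongr
    linarith
  · have hne : ∀ τ ∈ Icc T t, τ ≠ 0 := fun τ hτ => (hT0.trans_le hτ.1).ne'
    fun_prop (disch := assumption)
  · have e1 : T⁻¹ ^ 3 - T * T⁻¹ ^ 4 = 0 := by field_simp; ring
    rw [e1]
    have := hexp T hT0.le
    linarith
  · filter_upwards [hs.ae_goodTime hd hR hs.continuousOn] with τ hg hτ hlt
    have hτ0 : 0 < τ := hT0.trans hτ.1
    have h1 := hr τ hτ.1.le (hg hτ0)
    have h2 : 0 < γ * Real.exp (-C * τ) := by positivity
    have hexpτ := hexp τ hτ0.le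
    have h3 : V τ ≤ Vinf := by linarith
    have h4 := M.F₀_sub_le hβ h3 (C := C) fun W hW => M.dF₀_mono hA hβ (by
      have := hpos τ hτ0.le
      rw [abs_of_pos (this.trans hW.1), abs_of_pos ((this.trans hW.1).trans hW.2)]
      exact hW.2.le)
    rw [← hE]
    set q := τ⁻¹ with hq
    have hq0 : 0 < q := by positivity
    have hqT : T * q < 1 := by rw [hq, ← div_eq_mul_inv, div_lt_one hτ0]; exact hτ.1
    have hq1 : q ≤ 1 := by rw [hq]; exact inv_le_one_of_one_le₀ (by linarith [hτ.1])
    have h5 : κ / τ ^ 3 = a * (1 + C) * q ^ 3 := by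
      rw [ha, hq]; field_simp
    have h6 : Vinf - V τ ≤ γ * Real.exp (-C * τ) + a * q ^ 3 := by
      have : 0 ≤ a * (T * q ^ 4) := by positivity
      linarith
    have h7 : C * (Vinf - V τ) ≤ C * (γ * Real.exp (-C * τ) + a * q ^ 3) := by gcongr
    have h8 : a * (-3 * q ^ 4 + 4 * T * q ^ 5) ≤ a * q ^ 3 := by
      refine mul_le_mul_of_nonneg_left ?_ ha0
      have e1 : T * q * q ^ 4 ≤ 1 * q ^ 4 := by gcongr
      have e2 : q * q ^ 3 ≤ 1 * q ^ 3 := by gcongr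
      nlinarith
    rw [h5] at h1
    linarith

end HollowCylinder

end

/-! ### Choice of the constants -/

theorem theorem3p2 (d : ℕ) (hd : d = 2 ∨ d = 3) (M : HollowCylinder.Model d)
    (hR : 0 < M.R) (hh : 0 < M.h) (hρ : 0 < M.ρ) (hβ : 0 < M.β)
    (Vinf : ℝ) (hVinf : 0 < Vinf) (hE : M.F₀ Vinf = M.E) :
    ∃ γ₀ : ℝ, 0 < γ₀ ∧ ∃ Aminus : ℝ, 0 < Aminus ∧
      ∀ γ ∈ Set.Ioo 0 γ₀, ∃ tbar : ℝ, 0 < tbar ∧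
        ∀ (V : ℝ → ℝ) (f : ℝ → HollowCylinder.Vect d → HollowCylinder.Vect d → ℝ),
          M.IsSolution (Vinf - γ) V f →
            ∀ t : ℝ, 0 ≤ t →
              γ * Real.exp (-(deriv M.F₀ Vinf) * t) +
                  Set.indicator (Set.Ioi tbar) (fun s => Aminus * γ ^ 4 / s ^ 3) t ≤
                Vinf - V t := by
  have hd2 : 2 ≤ d := by omega
  have hA := M.A_pos hR hρ hβ
  have hc := M.dF₀_zero_pos hA hβ
  rw [(M.hasDerivAt_F₀ hβ Vinf).deriv]
  obtain ⟨C, hC⟩ : ∃ C, C = M.dF₀ Vinf := ⟨_, rfl⟩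
  have hCpos : 0 < C := hC ▸ hc.trans_le (M.dF₀_mono hA hβ (by simp))
  obtain ⟨L, hL⟩ : ∃ L, L = 4 / M.dF₀ 0 := ⟨_, rfl⟩
  have hLpos : 0 < L := by rw [hL]; positivity
  -- Chosen so that `exp (-C τ) ≥ 1 - 1/5` on the layer.
  obtain ⟨s₀, hs₀⟩ : ∃ s₀, s₀ = min 1 (1 / (5 * C)) := ⟨_, rfl⟩
  have hs₀pos : 0 < s₀ := by rw [hs₀]; exact lt_min one_pos (by positivity)
  obtain ⟨c₁, hc₁⟩ : ∃ c₁, c₁ = Real.exp (-C * 2) := ⟨_, rfl⟩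
  have hc₁pos : 0 < c₁ := by rw [hc₁]; positivity
  obtain ⟨κ, hκ⟩ : ∃ κ, κ = M.A * s₀ * c₁ ^ 2 * M.β * Vinf * Real.exp (-M.β * Vinf ^ 2) / 8 :=
    ⟨_, rfl⟩
  have hκpos : 0 < κ := by rw [hκ]; positivity
  obtain ⟨T, hT⟩ : ∃ T, T = 2 + 10 * L + L / c₁ + L ^ 3 / c₁ ^ 2 + 2 * L ^ 2 / c₁ := ⟨_, rfl⟩
  have hT1 : 0 < L / c₁ := by positivity
  have hT2 : 0 < L ^ 3 / c₁ ^ 2 := by positivity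
  have hT3 : 0 < 2 * L ^ 2 / c₁ := by positivity
  -- The three bounds on `γ` ensure `V > 0`, the conditions `2 γ L < h` and `2 γ < h` in the hollow,
  -- and the closing of the bootstrap.
  refine ⟨min (min (Vinf / 2) (M.h / (2 * (L + 1)))) (√(M.dF₀ 0 / (512 * M.A))),
    lt_min (lt_min (by positivity) (by positivity)) (Real.sqrt_pos.2 (by positivity)),
    κ / (1 + C) / 2, by positivity, ?_⟩
  rintro γ ⟨hγ, hγlt⟩
  rw [lt_min_iff, lt_min_iff] at hγlt
  obtain ⟨⟨hγV, hγh⟩, hγA⟩ := hγlt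
  have hsmall : 512 * M.A * γ ^ 2 ≤ M.dF₀ 0 := by
    rw [Real.lt_sqrt hγ.le, lt_div_iff₀ (by positivity)] at hγA
    linarith
  rw [lt_div_iff₀ (by positivity)] at hγh
  have hγL : 0 < γ * L := by positivity
  -- `T` collects the thresholds of `force_sub_ge`; the doubling is the one in `tail_le`. This time
  -- does not even depend on `γ`.
  refine ⟨2 * T, by linarith, fun V f hs => ?_⟩
  have hV := hs.continuousOn
  have hdec : ∀ t, 0 ≤ t → |Vinf - V t| ≤ HollowCylinder.decay γ L t := fun t ht =>
    hs.abs_le_decay hd2 hR hρ hβ hE hγ hL hsmall ht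
  have hpos : ∀ t, 0 ≤ t → 0 < V t := fun t ht => by
    have h1 := (abs_le.1 (hdec t ht)).2
    have h2 := HollowCylinder.decay_le hγ.le hLpos ht
    linarith
  have hesc : M.NoEscape V :=
    HollowCylinder.Model.noEscape_of_decay hV hγ hLpos (by linarith) hdec
  have hexp : ∀ t, 0 ≤ t → γ * Real.exp (-(M.dF₀ Vinf) * t) ≤ Vinf - V t := fun t ht =>
    hs.exp_le hd2 hR hρ hβ hE hγ hpos hesc ht
  have hlayer : HollowCylinder.LayerBounds (fun τ => Vinf - V τ) γ L s₀ c₁ := by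
    refine ⟨continuousOn_const.sub hV, hγ, hLpos, hs₀pos, hs₀ ▸ min_le_left _ _, hc₁pos,
      fun τ hτ => le_trans (by positivity) (hexp τ hτ), fun τ hτ => (abs_le.1 (hdec τ hτ)).2,
      fun τ hτ => le_trans ?_ (hexp τ hτ.1), fun τ hτ => le_trans ?_ (hexp τ hτ.1)⟩
    · have h1 : C * τ ≤ 1 / 5 := by
        have : τ ≤ 1 / (5 * C) := hτ.2.trans (hs₀ ▸ min_le_right _ _)
        rw [le_div_iff₀ (by positivity)] at this
        linarith
      have h2 := Real.add_one_le_exp (-C * τ)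
      rw [← hC, mul_comm]
      gcongr
      linarith
    · rw [← hC, hc₁, mul_comm]
      exact mul_le_mul_of_nonneg_left (Real.exp_le_exp.2 (by nlinarith [hτ.2])) hγ.le
  intro t ht
  rw [Set.indicator_apply]
  split_ifs with hlt
  · have hlt' : 2 * T < t := hlt
    have h := hs.tail_le hd2 hR hρ hβ hE hpos hexp hγ (κ := κ * γ ^ 4) (T := T) (by positivity)
      (by linarith) (fun r hr hgood => ?_) hlt'.le
    · refine le_trans (le_of_eq ?_) h
      rw [← hC]; ring
    · rw [mul_div_assoc, hκ]
      exact hgood.force_sub_ge hd2 hR hρ hβ hV hpos hesc hlayer hγV.le (by linarith)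
        (by linarith) (by linarith) (by linarith) (by linarith) (by linarith)
  · rw [add_zero]
    exact hexp t ht
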